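/- Model. A principal chooses irreversibly, at a time of her choice, between a safe action (payoff $\theta\in(0,1)$ to her, $\beta\in(0,\theta)$ to the agent) and a risky action with payoff $\omega\in\{0,1\}$ to both, where $\Pr(\omega=1)=\mu$ and $\beta<\mu<\theta$. Payoffs are discounted at rate $\rho>0$. Real news, which reveals $\omega$, arrives at a random time independent of $\omega$ with distribution function $G$ (possibly $\lim_{t\to\infty}G(t)<1$), continuous density $g$ on $[0,\infty)$, $G<1$, and strictly decreasing hazard rate $H=g/(1-G)$. With prior probability $\sigma\in(0,1)$ the agent is a faker, who does not know $\omega$ and can at one time produce a fake arrival of news $\omega=1$ (type-1 news), indistinguishable from a real one; otherwise the agent is passive. The first arrival ends the search, and news $\omega=0$ (always real) leads to the safe action. Let $\phi_P=\frac{\rho\theta}{\mu(1-\theta)}$, $\phi_A=\frac{\rho\mu}{\beta(1-\mu)}$, and assume $H(0)>\phi_P>\lim_{t\to\infty}H(t)$ and $\phi_P>\phi_A$. A profile $(a,F_P,F_A)$ consists of the probability $a(t)$ that the principal chooses risky after type-1 news at $t$, a mixed stopping time $F_P$ of the principal (at which she chooses safe if no news has come), and a mixed faking time $F_A$ of the faker.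 Both are probability distributions on $[0,\infty]$ whose restriction to $[0,\infty)$ is the sum of an absolutely continuous and a discrete part. At a tie the principal's stopping precedes the faker's arrival. The profile is an equilibrium if $F_P$ and $F_A$ are best responses and, for all $t\ge 0$, $a(t)$ is optimal given the Bayesian posterior on $\omega$ after type-1 news at $t$. It has beneficial search if the principal's expected payoff exceeds $\theta$. Let $u_P^{FB}(t)=\int_0^t e^{-\rho s}g(s)(\mu+(1-\mu)\theta)\,ds+e^{-\rho t}(1-G(t))\theta$ be the principal's payoff of waiting until $t$ for news that is always real. Claim. The function $u_P^{FB}$ has a unique maximizer $\tau_P$ on $[0,\infty)$, and $\tau_P>0$. Put $$\bar\sigma=1-\exp\Big(-\int_0^{\tau_P}\frac{\mu(1-\theta)H(s)-\rho\theta}{\theta-\mu}\,ds\Big)\in(0,1).$$ If the principal commits to naive search (wait until $\tau_P$ and then choose safe, acting on all news that arrives at or before $\tau_P$), then the faker's unique best response is to fake at $\tau_P$, and the principal's payoff is $$u_P^N(\sigma)=\int_0^{\tau_P}e^{-\rho s}g(s)(\mu+(1-\mu)\theta)\,ds+e^{-\rho\tau_P}(1-G(\tau_P))\big((1-\sigma)\theta+\sigma\mu\big).$$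 (i) If $0<\sigma<\bar\sigma$, then there is an equilibrium with beneficial search; it is unique among the equilibria with beneficial search ($F_P$ and $F_A$ are unique, and $a$ is unique up to a null set of times); and $u_P^N(\sigma)$ is strictly higher than the principal's payoff in this equilibrium and in every other equilibrium. (ii) There is $\widetilde\sigma_N$ with $\bar\sigma<\widetilde\sigma_N\le 1$ such that for all $\sigma\in(\bar\sigma,\widetilde\sigma_N)$ equilibria exist, none of them has beneficial search, and $u_P^N(\sigma)$ is strictly higher than the principal's payoff in every equilibrium. -/

import Mathlib

open MeasureTheory Set Filter Topology

noncomputable section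

/-- The primitives that are common knowledge, except for the prior probability `σ` of the faker type,
which is kept as a separate argument. `θ`, `β` are the safe payoffs of the principal and the agent,
`μ` is the prior probability of `ω = 1`, `ρ` is the discount rate, and `g` is the density on
`[0, ∞)` of the arrival time of real news. Real news need not arrive with probability one. -/
structure SearchModel where
  θ : ℝ
  β : ℝ
  μ : ℝ
  ρ : ℝ
  g : ℝ → ℝ
  θ_lt_one : θ < 1
  β_pos : 0 < β
  β_lt_μ : β < μ
  μ_lt_θ : μ < θ
  ρ_pos : 0 < ρ
  g_continuous : ContinuousOn g (Ici 0)
  g_nonneg : ∀ t, 0 ≤ t → 0 ≤ g t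
  cdf_lt_one : ∀ t, 0 ≤ t → (∫ s in (0 : ℝ)..t, g s) < 1
  hazard_strictAnti : StrictAntiOn (fun t => g t / (1 - ∫ s in (0 : ℝ)..t, g s)) (Ici 0)

/-- A mixed choice of a time in `[0, ∞]`, with an absolutely continuous part on `[0, ∞)` of density
`dens`, a discrete part with an atom of size `atom t` at `t`, and the remaining probability at `∞`. -/
structure MixedTime where
  dens : ℝ → ℝ
  atom : ℝ → ℝ
  dens_nonneg : ∀ t, 0 ≤ dens t
  dens_integrable : IntegrableOn dens (Ici 0)
  atom_nonneg : ∀ t, 0 ≤ atom t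
  atom_of_neg : ∀ t, t < 0 → atom t = 0
  atom_summable : Summable atom
  total_le_one : (∫ t in Ici (0 : ℝ), dens t) + ∑' t, atom t ≤ 1

namespace MixedTime

/-- The probability of a time in `[0, t]`. -/
def cdf (F : MixedTime) (t : ℝ) : ℝ :=
  (∫ s in Icc 0 t, F.dens s) + ∑' s, (Icc 0 t).indicator F.atom s

/-- The probability of the time `∞`. -/
def atInfty (F : MixedTime) : ℝ :=
  1 - ((∫ t in Ici (0 : ℝ), F.dens t) + ∑' t, F.atom t)

/-- The expectation of a payoff that is `u t` at a finite time `t` and `uInf` at `∞`. -/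
def expect (F : MixedTime) (u : ℝ → ℝ) (uInf : ℝ) : ℝ :=
  (∫ t in Ici (0 : ℝ), u t * F.dens t) + (∑' t, u t * F.atom t) + F.atInfty * uInf

end MixedTime

/-- A strategy profile: the probability `a t` of choosing risky after type-1 news at `t`, the
principal's stopping strategy `FP`, and the faker's faking strategy `FA`. -/
structure Profile where
  a : ℝ → ℝ
  FP : MixedTime
  FA : MixedTime

namespace SearchModel

variable (M : SearchModel)

/-- The distribution function of the arrival time of real news. -/
def G (t : ℝ) : ℝ := ∫ s in (0 : ℝ)..t, M.g s

/-- The hazard rate of real news. -/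
def H (t : ℝ) : ℝ := M.g t / (1 - M.G t)

def phiP : ℝ := M.ρ * M.θ / (M.μ * (1 - M.θ))

def phiA : ℝ := M.ρ * M.μ / (M.β * (1 - M.μ))

/-- `H 0 > φ_P > H ∞`. -/
def A1 : Prop := M.phiP < M.H 0 ∧ ∃ L, Tendsto M.H atTop (𝓝 L) ∧ L < M.phiP

/-- `φ_P > φ_A`. -/
def A2 : Prop := M.phiA < M.phiP

/-- The principal's first-best payoff of waiting for (real) news until `t`, and then choosing safe. -/
def uFB (t : ℝ) : ℝ :=
  (∫ s in (0 : ℝ)..t, Real.exp (-M.ρ * s) * M.g s * (M.μ + (1 - M.μ) * M.θ))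
    + Real.exp (-M.ρ * t) * (1 - M.G t) * M.θ

/-- The threshold prior, in terms of the principal's optimal first-best duration `τ`. -/
def sigmaBar (τ : ℝ) : ℝ :=
  1 - Real.exp (-∫ s in (0 : ℝ)..τ,
    (M.μ * (1 - M.θ) * M.H s - M.ρ * M.θ) / (M.θ - M.μ))

/-! ### The game without commitment -/

/-- The mass of type-0 news at `s`. -/
def w0 (σ : ℝ) (FA : MixedTime) (s : ℝ) : ℝ := (1 - M.μ) * M.g s * (1 - σ * FA.cdf s)

/-- The density of type-1 news at `s`, apart from atoms. -/
def w1 (σ : ℝ) (FA : MixedTime) (s : ℝ) : ℝ :=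
  M.μ * M.g s * (1 - σ * FA.cdf s) + σ * FA.dens s * (1 - M.G s)

/-- The posterior probability of `ω = 1` given type-1 news at `s`. At an atom of the faking strategy
the news is fake almost surely, and so the posterior is the prior. -/
def belief (σ : ℝ) (FA : MixedTime) (s : ℝ) : ℝ :=
  if 0 < FA.atom s then M.μ
  else (M.μ * M.g s * (1 - σ * FA.cdf s) + M.μ * (σ * FA.dens s) * (1 - M.G s)) / M.w1 σ FA s

/-- The principal's expected payoff from a search that is ended by news at a time in `A`. -/
def newsP (σ : ℝ) (a : ℝ → ℝ) (FA : MixedTime) (A : Set ℝ) : ℝ :=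
  (∫ s in A, Real.exp (-M.ρ * s) * (M.w0 σ FA s * M.θ
      + M.w1 σ FA s * ((1 - a s) * M.θ + a s * M.belief σ FA s)))
  + ∑' s, A.indicator (fun s => Real.exp (-M.ρ * s) * (σ * FA.atom s * (1 - M.G s))
      * ((1 - a s) * M.θ + a s * M.belief σ FA s)) s

/-- The principal's expected payoff of stopping at the finite time `t`. -/
def uP (σ : ℝ) (a : ℝ → ℝ) (FA : MixedTime) (t : ℝ) : ℝ :=
  M.newsP σ a FA (Icc 0 t)
    + Real.exp (-M.ρ * t) * ((1 - M.G t) * (1 - σ * FA.cdf t)) * M.θ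

/-- The principal's expected payoff of never stopping before news arrives. -/
def uPInf (σ : ℝ) (a : ℝ → ℝ) (FA : MixedTime) : ℝ := M.newsP σ a FA (Ici 0)

/-- The faker's expected payoff from a search that is ended at a time in `A`, by real news or by the
principal. -/
def endA (a : ℝ → ℝ) (FP : MixedTime) (A : Set ℝ) : ℝ :=
  (∫ s in A, Real.exp (-M.ρ * s) * ((1 - M.μ) * M.g s * (1 - FP.cdf s) * M.β
      + M.μ * M.g s * (1 - FP.cdf s) * ((1 - a s) * M.β + a s)
      + FP.dens s * (1 - M.G s) * M.β))
  + ∑' s, A.indicator (fun s => Real.exp (-M.ρ * s) * (FP.atom s * (1 - M.G s)) * M.β) s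

/-- The faker's expected payoff of faking at the finite time `t`. -/
def uA (a : ℝ → ℝ) (FP : MixedTime) (t : ℝ) : ℝ :=
  M.endA a FP (Icc 0 t)
    + Real.exp (-M.ρ * t) * ((1 - M.G t) * (1 - FP.cdf t)) * ((1 - a t) * M.β + M.μ * a t)

/-- The faker's expected payoff of never faking. -/
def uAInf (a : ℝ → ℝ) (FP : MixedTime) : ℝ := M.endA a FP (Ici 0)

/-- The principal's expected payoff from a strategy profile. -/
def payoffP (σ : ℝ) (E : Profile) : ℝ :=
  E.FP.expect (M.uP σ E.a E.FA) (M.uPInf σ E.a E.FA)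

/-- Equilibrium: both timing strategies are best responses, and the response to type-1 news is
optimal at every time given the posterior belief. -/
structure IsEquilibrium (σ : ℝ) (E : Profile) : Prop where
  measurable_a : Measurable E.a
  a_mem : ∀ t, E.a t ∈ Icc (0 : ℝ) 1
  agent_optimal : ∀ F : MixedTime,
    F.expect (M.uA E.a E.FP) (M.uAInf E.a E.FP) ≤ E.FA.expect (M.uA E.a E.FP) (M.uAInf E.a E.FP)
  response_optimal : ∀ t, 0 ≤ t →
    (M.θ < M.belief σ E.FA t → E.a t = 1) ∧ (M.belief σ E.FA t < M.θ → E.a t = 0)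
  stopping_optimal : ∀ F : MixedTime,
    F.expect (M.uP σ E.a E.FA) (M.uPInf σ E.a E.FA) ≤ M.payoffP σ E

/-- The principal gains from the ability to search. -/
def Beneficial (σ : ℝ) (E : Profile) : Prop := M.θ < M.payoffP σ E

/-! ### Commitment to naive search until `τ` -/

/-- The faker's payoff of faking at `t` when the principal is committed to wait until `τ` and to act
on all news at or before `τ`. Never faking has the same payoff as any `t > τ`. -/
def naiveA (τ t : ℝ) : ℝ :=
  if t ≤ τ then
    (∫ s in (0 : ℝ)..t, Real.exp (-M.ρ * s) * M.g s * (M.μ + (1 - M.μ) * M.β))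
      + Real.exp (-M.ρ * t) * (1 - M.G t) * M.μ
  else
    (∫ s in (0 : ℝ)..τ, Real.exp (-M.ρ * s) * M.g s * (M.μ + (1 - M.μ) * M.β))
      + Real.exp (-M.ρ * τ) * (1 - M.G τ) * M.β

/-- The principal's payoff with this commitment when the faker fakes at `t`: against the normal type
she has her first-best payoff of the duration `τ`, and against the faker she chooses risky at the
prior belief if `t ≤ τ` is reached without real news. -/
def naiveP (σ τ t : ℝ) : ℝ :=
  (1 - σ) * M.uFB τ + σ *
    (if t ≤ τ then
      (∫ s in (0 : ℝ)..t, Real.exp (-M.ρ * s) * M.g s * (M.μ + (1 - M.μ) * M.θ))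
        + Real.exp (-M.ρ * t) * (1 - M.G t) * M.μ
    else M.uFB τ)

/-- The principal's payoff with a commitment to naive search until `τ`. -/
def naivePayoff (σ τ : ℝ) : ℝ :=
  (∫ s in (0 : ℝ)..τ, Real.exp (-M.ρ * s) * M.g s * (M.μ + (1 - M.μ) * M.θ))
    + Real.exp (-M.ρ * τ) * (1 - M.G τ) * ((1 - σ) * M.θ + σ * M.μ)

end SearchModel

/-- Two profiles have the same distributions of stopping and faking times and, up to a null set of
times, the same response to news (the density of the faking times, and so the posterior belief, is
determined up to null sets only). -/
def Profile.Same (E E' : Profile) : Prop :=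
  (∀ t, 0 ≤ t → E.FP.cdf t = E'.FP.cdf t) ∧ (∀ t, 0 ≤ t → E.FA.cdf t = E'.FA.cdf t) ∧
    E.a =ᵐ[volume.restrict (Ici 0)] E'.a

end

/-! Write `h` for the hazard rate, `D` for `disc` and `X = 1 - σ F_A`. Both players' payoffs become
integrals of flows. An atom of faking is answered by the safe action and so costs the principal
nothing; hence stopping at `t` is worth `θ + ∫ D (gain - ρ θ X)` over `[0, t]`, where `gain` is the
positive part of the value of acting on news. Without faking this flow has the sign of `rateP`,
which is positive exactly before the time `τ` with `h τ = φ_P`. Up to `τ` also `h > φ_A`, so `rateA`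
is positive: the faker gains by delaying fake news that will be acted on.

Structure. In a beneficial equilibrium the principal has stopped by `τ`; let `T` be the last time of
the search. Before `T`, fake news that is acted on cannot be worth more than the faker's payoff
(`riskyA_le`). Otherwise the response would be below one, the principal's flow would be negative and
she would not stop there; the faker's excess then solves a linear equation with positive source, so
it persists up to `T`, where stopping must be complete. It follows that news is acted on at almost
all times, that faking has no atoms and is over by `T`, and that `T = τ` (`isRegular`). Where the
principal strictly prefers other times to stop, the faker waits, and then her payoff grows (`gap`).
So her optimal stopping times form an interval `[l, τ]`. Her indifference there makes `X` decay at
`fakeRate`, the faker's indifference makes `1 - F_P` decay at `stopRate`, and `X τ = 1 - σ`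
determines `l` (`beneficial_structure`). The prior `sigmaBar` is the one with `l = 0`, so `l > 0`
forces `σ < sigmaBar`. Conversely, these formulas define an equilibrium (`exists_isEquilibrium`).

Comparison. When all news is acted on and faking is over by `τ`, the principal's payoff of stopping
at `τ` is `μ + ∫ rateN D X + D τ (1 - σ)(θ - μ)`; naive search has the same formula with `X = 1`
under the integral. Since `rateN > 0`, naive search is strictly better (`lt_naivePayoff`). For `σ =
sigmaBar` and faking from time `0` on, the formula with `X` equals `θ`, so the naive payoff exceeds
`θ` at `sigmaBar`. It is affine and decreasing in `σ`, so it exceeds `θ` below `sigmaBar` and a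
little above it, while equilibria without beneficial search yield at most `θ`. -/

noncomputable section

/-! ### Linear integral equations -/

/-- A solution of a linear integral equation, multiplied by its integrating factor. -/
lemma linear_integral_equation {R m k : ℝ → ℝ} {l r : ℝ} (hm : Continuous m)
    (hk : Continuous k) (hRi : IntervalIntegrable R volume l r) (hlr : l ≤ r)
    (h : ∀ t ∈ Icc l r, R t = R l + ∫ s in l..t, (k s - m s * R s)) :
    R r * Real.exp (∫ s in l..r, m s)
      = R l + ∫ s in l..r, k s * Real.exp (∫ x in l..s, m x) := by
  have hmR : IntervalIntegrable (fun s => k s - m s * R s) volume l r :=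
    (hk.intervalIntegrable _ _).sub (hRi.continuousOn_mul hm.continuousOn)
  have hRc : ContinuousOn R (Icc l r) := by
    have h1 : ContinuousOn (fun t => R l + ∫ s in l..t, (k s - m s * R s)) (Icc l r) := by
      refine continuousOn_const.add ?_
      have := intervalIntegral.continuousOn_primitive_interval (f := fun s => k s - m s * R s)
        (μ := volume) (a := l) (b := r) (by
          rw [uIcc_of_le hlr]
          exact (intervalIntegrable_iff_integrableOn_Icc_of_le hlr).1 hmR)
      rwa [uIcc_of_le hlr] at this
    exact h1.congr h
  -- `R` is controlled only on `[l, r]`. Freezing it beyond the endpoints gives a continuous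
  -- function on the line, so that `Z` below is differentiable everywhere.
  set Q : ℝ → ℝ := fun t => R (projIcc l r hlr t) with hQ
  have hQc : Continuous Q := by
    have : Continuous ((Icc l r).domRestrict R) := continuousOn_iff_continuous_domRestrict.1 hRc
    exact this.comp continuous_projIcc
  have hQR : ∀ t ∈ Icc l r, Q t = R t := fun t ht => by simp [hQ, projIcc_of_mem hlr ht]
  have hE : ∀ t, HasDerivAt (fun t => Real.exp (∫ x in l..t, m x))
      (Real.exp (∫ x in l..t, m x) * m t) t := fun t =>
    (intervalIntegral.integral_hasDerivAt_right (hm.intervalIntegrable _ _)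
      hm.stronglyMeasurable.stronglyMeasurableAtFilter hm.continuousAt).exp
  have hEc : Continuous (fun t => Real.exp (∫ x in l..t, m x)) :=
    continuous_iff_continuousAt.2 fun t => (hE t).continuousAt
  have hint : Continuous fun s => k s - m s * Q s := hk.sub (hm.mul hQc)
  set Z : ℝ → ℝ := fun t => R l + ∫ s in l..t, (k s - m s * Q s) with hZ
  have hZd : ∀ t, HasDerivAt Z (k t - m t * Q t) t := fun t =>
    (intervalIntegral.integral_hasDerivAt_right (hint.intervalIntegrable _ _)
      hint.stronglyMeasurable.stronglyMeasurableAtFilter hint.continuousAt).const_add _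
  have hZR : ∀ t ∈ Icc l r, Z t = R t := by
    intro t ht
    have : ∫ s in l..t, (k s - m s * Q s) = ∫ s in l..t, (k s - m s * R s) := by
      refine intervalIntegral.integral_congr fun s hs => ?_
      rw [uIcc_of_le ht.1] at hs
      simp only [hQR s ⟨hs.1, hs.2.trans ht.2⟩]
    rw [h t ht, ← this]
  have key := intervalIntegral.integral_eq_sub_of_hasDerivAt
    (f := fun t => Z t * Real.exp (∫ x in l..t, m x))
    (f' := fun t => (k t - m t * Q t) * Real.exp (∫ x in l..t, m x)
      + Z t * (Real.exp (∫ x in l..t, m x) * m t)) (a := l) (b := r)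
    (fun t _ => (hZd t).mul (hE t))
    (by
      have hZc : Continuous Z := continuous_iff_continuousAt.2 fun t => (hZd t).continuousAt
      exact ((hint.mul hEc).add (hZc.mul (hEc.mul hm))).intervalIntegrable _ _)
  have h2 : (∫ t in l..r, ((k t - m t * Q t) * Real.exp (∫ x in l..t, m x)
      + Z t * (Real.exp (∫ x in l..t, m x) * m t)))
      = ∫ s in l..r, k s * Real.exp (∫ x in l..s, m x) := by
    refine intervalIntegral.integral_congr fun s hs => ?_
    rw [uIcc_of_le hlr] at hs
    simp only [hQR s hs, hZR s hs]
    ring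
  rw [h2] at key
  simp only [hZR r ⟨hlr, le_rfl⟩, hZR l ⟨le_rfl, hlr⟩, intervalIntegral.integral_same,
    Real.exp_zero, mul_one] at key
  linarith

/-- The solution of a homogeneous linear integral equation. -/
lemma homogeneous_integral_equation {R m : ℝ → ℝ} {l r : ℝ} (hm : Continuous m)
    (hRi : IntervalIntegrable R volume l r) (hlr : l ≤ r)
    (h : ∀ t ∈ Icc l r, R t = R l - ∫ s in l..t, m s * R s) :
    R r = R l * Real.exp (-∫ s in l..r, m s) := by
  have := linear_integral_equation (k := fun _ => 0) hm continuous_const hRi hlr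
    (fun t ht => by rw [h t ht]; simp [sub_eq_add_neg])
  simp only [zero_mul, intervalIntegral.integral_zero, add_zero] at this
  rw [← this, mul_assoc, ← Real.exp_add]
  simp

/-! ### Discounting and the hazard rate of real news -/

namespace SearchModel

variable (M : SearchModel)

lemma μ_pos : 0 < M.μ := M.β_pos.trans M.β_lt_μ
lemma θ_pos : 0 < M.θ := M.μ_pos.trans M.μ_lt_θ
lemma μ_lt_one : M.μ < 1 := M.μ_lt_θ.trans M.θ_lt_one
lemma β_lt_one : M.β < 1 := M.β_lt_μ.trans M.μ_lt_one

/-- The density of real news, extended to the real line by its value at `0`. -/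
def gExt (t : ℝ) : ℝ := M.g (max t 0)

/-- The survival function of real news. -/
def surv (t : ℝ) : ℝ := 1 - ∫ s in (0 : ℝ)..t, M.gExt s

/-- The hazard rate of real news, extended continuously to the real line. -/
def haz (t : ℝ) : ℝ := M.gExt t / M.surv t

/-- The discount factor times the survival function of real news. -/
def disc (t : ℝ) : ℝ := Real.exp (-M.ρ * t) * M.surv t

lemma gExt_eq {t : ℝ} (ht : 0 ≤ t) : M.gExt t = M.g t := by simp [gExt, max_eq_left ht]

lemma gExt_nonneg (t : ℝ) : 0 ≤ M.gExt t := M.g_nonneg _ (le_max_right _ _)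

lemma gExt_continuous : Continuous M.gExt :=
  M.g_continuous.comp_continuous (continuous_id.max continuous_const) fun t => le_max_right t 0

lemma G_eq {t : ℝ} (ht : 0 ≤ t) : M.G t = 1 - M.surv t := by
  unfold G surv
  have : (∫ s in (0 : ℝ)..t, M.g s) = ∫ s in (0 : ℝ)..t, M.gExt s := by
    refine intervalIntegral.integral_congr fun s hs => ?_
    rw [uIcc_of_le ht] at hs
    exact (M.gExt_eq hs.1).symm
  rw [this]; ring

lemma one_sub_G {t : ℝ} (ht : 0 ≤ t) : 1 - M.G t = M.surv t := by rw [M.G_eq ht]; ring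

lemma surv_pos (t : ℝ) : 0 < M.surv t := by
  rcases le_total 0 t with ht | ht
  · rw [← M.one_sub_G ht]
    have := M.cdf_lt_one t ht
    unfold G; linarith
  · unfold surv
    rw [intervalIntegral.integral_symm]
    have : 0 ≤ ∫ s in t..0, M.gExt s :=
      intervalIntegral.integral_nonneg ht fun s _ => M.gExt_nonneg s
    linarith

lemma surv_hasDerivAt (t : ℝ) : HasDerivAt M.surv (-M.gExt t) t :=
  (intervalIntegral.integral_hasDerivAt_right (M.gExt_continuous.intervalIntegrable _ _)
      M.gExt_continuous.stronglyMeasurable.stronglyMeasurableAtFilter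
      M.gExt_continuous.continuousAt).const_sub 1

lemma surv_continuous : Continuous M.surv :=
  continuous_iff_continuousAt.2 fun t => (M.surv_hasDerivAt t).continuousAt

lemma surv_zero : M.surv 0 = 1 := by simp [surv]

lemma haz_continuous : Continuous M.haz :=
  M.gExt_continuous.div M.surv_continuous fun t => (M.surv_pos t).ne'

lemma H_eq {t : ℝ} (ht : 0 ≤ t) : M.H t = M.haz t := by
  unfold H haz; rw [M.one_sub_G ht, M.gExt_eq ht]

lemma disc_pos (t : ℝ) : 0 < M.disc t := mul_pos (Real.exp_pos _) (M.surv_pos t)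

lemma disc_zero : M.disc 0 = 1 := by simp [disc, surv_zero]

lemma disc_eq {t : ℝ} (ht : 0 ≤ t) : M.disc t = Real.exp (-M.ρ * t) * (1 - M.G t) := by
  rw [M.one_sub_G ht]; rfl

lemma gExt_eq_haz (t : ℝ) : M.gExt t = M.haz t * M.surv t := by
  unfold haz; rw [div_mul_cancel₀ _ (M.surv_pos t).ne']

lemma disc_mul_haz {t : ℝ} (ht : 0 ≤ t) : Real.exp (-M.ρ * t) * M.g t = M.disc t * M.haz t := by
  rw [← M.gExt_eq ht, gExt_eq_haz, disc]; ring

lemma disc_hasDerivAt (t : ℝ) : HasDerivAt M.disc (-((M.ρ + M.haz t) * M.disc t)) t := by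
  have h1 : HasDerivAt (fun t => Real.exp (-M.ρ * t)) (Real.exp (-M.ρ * t) * (-M.ρ * 1)) t :=
    ((hasDerivAt_id t).const_mul (-M.ρ)).exp
  have := h1.mul (M.surv_hasDerivAt t)
  refine this.congr_deriv ?_
  rw [M.gExt_eq_haz, disc]; ring

lemma disc_continuous : Continuous M.disc :=
  continuous_iff_continuousAt.2 fun t => (M.disc_hasDerivAt t).continuousAt

lemma integral_disc (a b : ℝ) :
    ∫ s in a..b, (M.ρ + M.haz s) * M.disc s = M.disc a - M.disc b := by
  have := intervalIntegral.integral_eq_sub_of_hasDerivAt (a := a) (b := b)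
    (fun t _ => (M.disc_hasDerivAt t))
    (((continuous_const.add M.haz_continuous).mul M.disc_continuous).neg.intervalIntegrable _ _)
  rw [intervalIntegral.integral_neg] at this
  linarith

lemma haz_strictAntiOn : StrictAntiOn M.haz (Ici 0) := by
  intro s hs t ht hst
  have := M.hazard_strictAnti hs ht hst
  rw [← M.H_eq hs, ← M.H_eq ht]
  exact this

lemma haz_nonneg (t : ℝ) : 0 ≤ M.haz t := div_nonneg (M.gExt_nonneg t) (M.surv_pos t).le

/-- A strictly decreasing nonnegative function has no zero. This keeps the density of type-1 news
positive, so that the quotient in `belief` is never `0 / 0`. -/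
lemma haz_pos {t : ℝ} (ht : 0 ≤ t) : 0 < M.haz t :=
  (M.haz_nonneg (t + 1)).trans_lt
    (M.haz_strictAntiOn ht (show (0 : ℝ) ≤ t + 1 by linarith) (by linarith))

lemma haz_le {t : ℝ} (ht : 0 ≤ t) : M.haz t ≤ M.haz 0 :=
  M.haz_strictAntiOn.antitoneOn (mem_Ici.2 le_rfl) ht ht

lemma surv_le_one {t : ℝ} (ht : 0 ≤ t) : M.surv t ≤ 1 := by
  unfold surv
  have := intervalIntegral.integral_nonneg (μ := volume) ht fun s _ => M.gExt_nonneg s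
  linarith

lemma disc_le_exp {t : ℝ} (ht : 0 ≤ t) : M.disc t ≤ Real.exp (-M.ρ * t) :=
  mul_le_of_le_one_right (Real.exp_pos _).le (M.surv_le_one ht)

lemma disc_le_one {t : ℝ} (ht : 0 ≤ t) : M.disc t ≤ 1 := by
  refine (M.disc_le_exp ht).trans (Real.exp_le_one_iff.2 ?_)
  nlinarith [M.ρ_pos]

lemma tendsto_disc : Tendsto M.disc atTop (𝓝 0) := by
  have h : Tendsto (fun t => Real.exp (-M.ρ * t)) atTop (𝓝 0) := by
    refine Real.tendsto_exp_atBot.comp ?_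
    exact tendsto_id.const_mul_atTop_of_neg (by linarith [M.ρ_pos])
  exact tendsto_of_tendsto_of_tendsto_of_le_of_le' tendsto_const_nhds h
    (Eventually.of_forall fun t => (M.disc_pos t).le)
    ((eventually_ge_atTop 0).mono fun t ht => M.disc_le_exp ht)

lemma integrableOn_disc : IntegrableOn M.disc (Ici 0) := by
  have h : IntegrableOn (fun t => Real.exp (-M.ρ * t)) (Ici 0) := by
    rw [integrableOn_Ici_iff_integrableOn_Ioi]
    exact exp_neg_integrableOn_Ioi 0 M.ρ_pos
  refine Integrable.mono' h M.disc_continuous.aestronglyMeasurable ?_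
  refine (ae_restrict_iff' measurableSet_Ici).2 (Eventually.of_forall fun t ht => ?_)
  rw [Real.norm_of_nonneg (M.disc_pos t).le]
  exact M.disc_le_exp ht

lemma disc_strictAnti : StrictAnti M.disc := by
  intro s t hst
  unfold disc
  have h1 : Real.exp (-M.ρ * t) < Real.exp (-M.ρ * s) :=
    Real.exp_lt_exp.2 (by nlinarith [M.ρ_pos])
  have h2 : M.surv t ≤ M.surv s := by
    unfold surv
    have := intervalIntegral.integral_add_adjacent_intervals
      (M.gExt_continuous.intervalIntegrable 0 s (μ := volume))
      (M.gExt_continuous.intervalIntegrable s t)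
    have h3 := intervalIntegral.integral_nonneg (μ := volume) hst.le fun s _ => M.gExt_nonneg s
    linarith
  exact mul_lt_mul h1 h2 (M.surv_pos t) (Real.exp_pos _).le

/-! ### The flow payoffs -/

/-- The rate at which the principal gains from waiting for real news. -/
def rateP (t : ℝ) : ℝ := M.μ * (1 - M.θ) * M.haz t - M.ρ * M.θ

/-- The rate at which the faker gains from postponing fake news that will be acted on. -/
def rateA (t : ℝ) : ℝ := M.β * (1 - M.μ) * M.haz t - M.ρ * M.μ

/-- The rate at which the principal gains from postponing fake news that she acts on. -/
def rateN (t : ℝ) : ℝ := (1 - M.μ) * M.θ * M.haz t - M.ρ * M.μ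

lemma rateP_continuous : Continuous M.rateP :=
  (continuous_const.mul M.haz_continuous).sub continuous_const

lemma rateA_continuous : Continuous M.rateA :=
  (continuous_const.mul M.haz_continuous).sub continuous_const

lemma rateN_continuous : Continuous M.rateN :=
  (continuous_const.mul M.haz_continuous).sub continuous_const

/-- `τ` is the time at which waiting stops to pay in the first best. -/
structure IsThreshold (τ : ℝ) : Prop where
  pos : 0 < τ
  haz_eq : M.haz τ = M.phiP
  phiA_lt : M.phiA < M.phiP

variable {M}

lemma exists_isThreshold (h1 : M.A1) (h2 : M.A2) : ∃ τ, M.IsThreshold τ := by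
  obtain ⟨h0, L, hL, hLP⟩ := h1
  rw [M.H_eq le_rfl] at h0
  obtain ⟨T, hT0, hT⟩ : ∃ T, 0 ≤ T ∧ M.haz T < M.phiP := by
    obtain ⟨T, hT1, hT2⟩ := ((hL.eventually (gt_mem_nhds hLP)).and (eventually_ge_atTop 0)).exists
    exact ⟨T, hT2, by rwa [← M.H_eq hT2]⟩
  obtain ⟨τ, hτ, hτe⟩ := intermediate_value_Icc' hT0 (M.haz_continuous.continuousOn)
    ⟨hT.le, h0.le⟩
  refine ⟨τ, lt_of_le_of_ne hτ.1 ?_, hτe, h2⟩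
  rintro rfl
  exact h0.ne' hτe

namespace IsThreshold

variable {τ : ℝ} (hτ : M.IsThreshold τ)
include hτ

lemma rateP_eq (t : ℝ) : M.rateP t = M.μ * (1 - M.θ) * (M.haz t - M.haz τ) := by
  have h1 : M.μ * (1 - M.θ) ≠ 0 := (mul_pos M.μ_pos (by linarith [M.θ_lt_one])).ne'
  have : M.ρ * M.θ = M.μ * (1 - M.θ) * M.haz τ := by
    rw [hτ.haz_eq, phiP, mul_div_cancel₀ _ h1]
  unfold rateP; rw [this]; ring

lemma rateP_pos {t : ℝ} (h0 : 0 ≤ t) (ht : t < τ) : 0 < M.rateP t := by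
  rw [hτ.rateP_eq]
  have := M.haz_strictAntiOn h0 hτ.pos.le ht
  exact mul_pos (mul_pos M.μ_pos (by linarith [M.θ_lt_one])) (by linarith)

lemma rateP_neg {t : ℝ} (ht : τ < t) : M.rateP t < 0 := by
  rw [hτ.rateP_eq]
  have := M.haz_strictAntiOn hτ.pos.le (hτ.pos.le.trans ht.le) ht
  exact mul_neg_of_pos_of_neg (mul_pos M.μ_pos (by linarith [M.θ_lt_one])) (by linarith)

lemma rateP_nonneg {t : ℝ} (h0 : 0 ≤ t) (ht : t ≤ τ) : 0 ≤ M.rateP t := by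
  rcases ht.lt_or_eq with h | h
  · exact (hτ.rateP_pos h0 h).le
  · rw [hτ.rateP_eq, h]; simp

lemma phiP_le_haz {t : ℝ} (h0 : 0 ≤ t) (ht : t ≤ τ) : M.phiP ≤ M.haz t := by
  rw [← hτ.haz_eq]; exact M.haz_strictAntiOn.antitoneOn h0 hτ.pos.le ht

/-- Up to the threshold the hazard is at least `phiP`, hence above `phiA`. This is where the
assumption `A2` does its work. -/
lemma rateA_pos {t : ℝ} (h0 : 0 ≤ t) (ht : t ≤ τ) : 0 < M.rateA t := by
  have h1 := hτ.phiA_lt.trans_le (hτ.phiP_le_haz h0 ht)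
  have h2 : 0 < M.β * (1 - M.μ) := mul_pos M.β_pos (by linarith [M.μ_lt_one])
  rw [phiA, div_lt_iff₀ h2] at h1
  unfold rateA; linarith

/-- `rateN` exceeds `rateA` by `(1 - μ)(θ - β)` times the hazard. -/
lemma rateN_pos {t : ℝ} (h0 : 0 ≤ t) (ht : t ≤ τ) : 0 < M.rateN t := by
  have h1 := hτ.rateA_pos h0 ht
  unfold rateA at h1; unfold rateN
  have h2 := mul_pos (mul_pos (sub_pos.2 (M.β_lt_μ.trans M.μ_lt_θ))
    (sub_pos.2 M.μ_lt_one)) (M.haz_pos h0)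
  nlinarith

end IsThreshold

end SearchModel

/-! ### Mixed times as measures, integration by parts and expectations -/

namespace MixedTime

variable (F : MixedTime)

/-- The distribution of a mixed time on `[0, ∞)`, as a measure. -/
def law : Measure ℝ :=
  (volume.restrict (Ici 0)).withDensity (fun t => ENNReal.ofReal (F.dens t))
    + Measure.sum fun t => ENNReal.ofReal (F.atom t) • Measure.dirac t

lemma aemeasurable_dens :
    AEMeasurable (fun t => ENNReal.ofReal (F.dens t)) (volume.restrict (Ici 0)) :=
  F.dens_integrable.aemeasurable.ennreal_ofReal

lemma nonneg_of_atom_ne {t : ℝ} (h : F.atom t ≠ 0) : 0 ≤ t := by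
  by_contra hlt
  exact h (F.atom_of_neg t (not_le.1 hlt))

instance : IsFiniteMeasure F.law := by
  have h1 : IsFiniteMeasure
      ((volume.restrict (Ici (0 : ℝ))).withDensity fun t => ENNReal.ofReal (F.dens t)) := by
    refine isFiniteMeasure_withDensity ?_
    rw [← ofReal_integral_eq_lintegral_ofReal F.dens_integrable
      (Eventually.of_forall F.dens_nonneg)]
    exact ENNReal.ofReal_ne_top
  have h2 : IsFiniteMeasure
      (Measure.sum fun t => ENNReal.ofReal (F.atom t) • Measure.dirac t) := by
    refine ⟨?_⟩
    rw [Measure.sum_apply _ MeasurableSet.univ]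
    simpa using F.atom_summable.tsum_ofReal_lt_top
  unfold law
  infer_instance

/-- Integration against the distribution of a mixed time. -/
lemma setIntegral_law {f : ℝ → ℝ} (hf : Measurable f) {B : Set ℝ} {C : ℝ}
    (hC : ∀ t ∈ B, |f t| ≤ C) (hB : MeasurableSet B) (hB0 : B ⊆ Ici 0) :
    ∫ t in B, f t ∂F.law
      = (∫ t in B, f t * F.dens t) + ∑' t, B.indicator (fun t => f t * F.atom t) t := by
  have hi : Integrable (B.indicator f) F.law := by
    refine Integrable.of_bound (hf.indicator hB).aestronglyMeasurable (max C 0)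
      (Eventually.of_forall fun t => ?_)
    by_cases ht : t ∈ B
    · rw [indicator_of_mem ht]; exact (hC t ht).trans (le_max_left _ _)
    · rw [indicator_of_notMem ht]; simp
  rw [← integral_indicator hB]
  have hi' := hi
  unfold law at hi' ⊢
  rw [integral_add_measure (integrable_add_measure.1 hi').1 (integrable_add_measure.1 hi').2]
  congr 1
  · rw [integral_withDensity_eq_integral_toReal_smul₀ F.aemeasurable_dens
      (Eventually.of_forall fun t => ENNReal.ofReal_lt_top)]
    have : ∀ t, (ENNReal.ofReal (F.dens t)).toReal • B.indicator f t
        = B.indicator (fun t => f t * F.dens t) t := by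
      intro t
      rw [ENNReal.toReal_ofReal (F.dens_nonneg t)]
      by_cases ht : t ∈ B
      · simp [ht, mul_comm]
      · simp [ht]
    simp only [this]
    rw [setIntegral_indicator hB, inter_eq_right.2 hB0]
  · rw [integral_sum_measure (integrable_add_measure.1 hi').2]
    refine tsum_congr fun t => ?_
    rw [integral_smul_measure, integral_dirac, ENNReal.toReal_ofReal (F.atom_nonneg t)]
    by_cases ht : t ∈ B
    · simp [ht, mul_comm]
    · simp [ht]

lemma law_real {B : Set ℝ} (hB : MeasurableSet B) (hB0 : B ⊆ Ici 0) :
    F.law.real B = (∫ t in B, F.dens t) + ∑' t, B.indicator F.atom t := by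
  have := F.setIntegral_law (f := fun _ => 1) measurable_const (C := 1) (by simp) hB hB0
  simpa using this

lemma cdf_eq (t : ℝ) : F.cdf t = F.law.real (Icc 0 t) :=
  (F.law_real measurableSet_Icc fun _ h => h.1).symm

lemma law_real_Ici : F.law.real (Ici 0) = 1 - F.atInfty := by
  rw [F.law_real measurableSet_Ici subset_rfl, atInfty]
  have : ∀ t, (Ici (0 : ℝ)).indicator F.atom t = F.atom t := by
    intro t
    by_cases ht : t ∈ Ici (0 : ℝ)
    · simp [ht]
    · rw [indicator_of_notMem ht, F.atom_of_neg t (not_le.1 ht)]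
  simp [this]

lemma atInfty_nonneg : 0 ≤ F.atInfty := by
  have := F.total_le_one
  unfold atInfty; linarith

lemma cdf_mono : Monotone F.cdf := fun s t h => by
  rw [cdf_eq, cdf_eq]
  exact measureReal_mono (Icc_subset_Icc_right h)

lemma cdf_nonneg (t : ℝ) : 0 ≤ F.cdf t := by rw [cdf_eq]; exact measureReal_nonneg

lemma cdf_le (t : ℝ) : F.cdf t ≤ 1 - F.atInfty := by
  rw [cdf_eq, ← law_real_Ici]
  exact measureReal_mono fun _ h => h.1

lemma cdf_le_one (t : ℝ) : F.cdf t ≤ 1 := by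
  have := F.cdf_le t
  have := F.atInfty_nonneg
  linarith

lemma cdf_sub {l r : ℝ} (hl : 0 ≤ l) (h : l ≤ r) : F.cdf r - F.cdf l = F.law.real (Ioc l r) := by
  rw [cdf_eq, cdf_eq, ← Icc_union_Ioc_eq_Icc hl h,
    measureReal_union _ measurableSet_Ioc]
  · ring
  · exact Set.disjoint_left.2 fun x hx hx' => (hx.2.trans_lt hx'.1).false

lemma one_sub_atInfty_sub_cdf {t : ℝ} (ht : 0 ≤ t) :
    1 - F.atInfty - F.cdf t = F.law.real (Ioi t) := by
  have : Ici (0 : ℝ) = Icc 0 t ∪ Ioi t := (Icc_union_Ioi_eq_Ici ht).symm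
  rw [cdf_eq, ← law_real_Ici, this, measureReal_union _ measurableSet_Ioi]
  · ring
  · exact Set.disjoint_left.2 fun x hx hx' => (hx.2.trans_lt hx').false

lemma law_real_eq_zero {B : Set ℝ} (hB : MeasurableSet B) (hB0 : B ⊆ Ici 0)
    (hd : ∀ᵐ t, t ∈ B → F.dens t = 0) (ha : ∀ t ∈ B, F.atom t = 0) : F.law.real B = 0 := by
  rw [F.law_real hB hB0, setIntegral_eq_zero_of_ae_eq_zero hd]
  have : ∀ t, B.indicator F.atom t = 0 := by
    intro t
    by_cases ht : t ∈ B
    · simp [ht, ha t ht]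
    · simp [ht]
  simp [this]

lemma cdf_rightCont (t : ℝ) : Tendsto F.cdf (𝓝[>] t) (𝓝 (F.cdf t)) := by
  rcases lt_or_ge t 0 with h | h
  · have h0 : ∀ s, s < 0 → F.cdf s = 0 := fun s hs => by
      rw [cdf_eq, Icc_eq_empty (not_le.2 hs)]; simp
    rw [h0 t h]
    refine tendsto_const_nhds.congr' ?_
    filter_upwards [mem_nhdsWithin_of_mem_nhds (Iio_mem_nhds h)] with s hs
    exact (h0 s hs).symm
  · have h1 : ⋂ n : ℕ, Icc 0 (t + 1 / ((n : ℝ) + 1)) = Icc 0 t := by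
      ext x
      simp only [mem_iInter, mem_Icc]
      refine ⟨fun hx => ⟨(hx 0).1, le_of_forall_pos_le_add fun ε hε => ?_⟩, fun hx n =>
        ⟨hx.1, hx.2.trans (by have := Nat.one_div_pos_of_nat (α := ℝ) (n := n); linarith)⟩⟩
      obtain ⟨n, hn⟩ := exists_nat_one_div_lt hε
      exact (hx n).2.trans (by linarith)
    have h2 : Tendsto (fun n : ℕ => F.cdf (t + 1 / ((n : ℝ) + 1))) atTop (𝓝 (F.cdf t)) := by
      simp only [cdf_eq]
      have := tendsto_measure_iInter_atTop (μ := F.law)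
        (s := fun n : ℕ => Icc 0 (t + 1 / ((n : ℝ) + 1)))
        (fun n => measurableSet_Icc.nullMeasurableSet)
        (fun m n hmn => Icc_subset_Icc_right
          (by have := Nat.one_div_le_one_div (α := ℝ) hmn; linarith)) ⟨0, measure_ne_top _ _⟩
      rw [h1] at this
      exact (ENNReal.tendsto_toReal (measure_ne_top _ _)).comp this
    rw [Metric.tendsto_nhdsWithin_nhds]
    intro ε hε
    obtain ⟨n, hn⟩ := (h2.eventually (Metric.ball_mem_nhds _ hε)).exists
    refine ⟨1 / ((n : ℝ) + 1), Nat.one_div_pos_of_nat, fun {x} hx hxd => ?_⟩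
    rw [Real.dist_eq, abs_of_pos (sub_pos.2 hx)] at hxd
    rw [Real.dist_eq, abs_of_nonneg (sub_nonneg.2 (F.cdf_mono (le_of_lt hx)))]
    rw [Real.dist_eq, abs_of_nonneg (sub_nonneg.2 (F.cdf_mono (by
      have := Nat.one_div_pos_of_nat (α := ℝ) (n := n); linarith)))] at hn
    have := F.cdf_mono (show x ≤ t + 1 / ((n : ℝ) + 1) by linarith)
    linarith

lemma ae_atom_eq_zero : ∀ᵐ t, F.atom t = 0 := by
  have h : (Function.support F.atom).Countable := F.atom_summable.countable_support
  filter_upwards [h.ae_notMem volume] with t ht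
  simpa using ht

/-- Integration by parts. -/
lemma integral_by_parts {D D' : ℝ → ℝ} (hD : ∀ t, HasDerivAt D (D' t) t) (hD' : Continuous D')
    {t : ℝ} (ht : 0 ≤ t) :
    (∫ s in Icc 0 t, D s * F.dens s) + (∑' s, (Icc 0 t).indicator (fun s => D s * F.atom s) s)
      = D t * F.cdf t - ∫ s in (0 : ℝ)..t, D' s * F.cdf s := by
  have hDc : Continuous D := continuous_iff_continuousAt.2 fun s => (hD s).continuousAt
  obtain ⟨C, hC⟩ := isCompact_Icc.exists_bound_of_continuousOn (s := Icc 0 t) hDc.continuousOn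
  obtain ⟨C', hC'⟩ := isCompact_Icc.exists_bound_of_continuousOn (s := Icc 0 t) hD'.continuousOn
  rw [← F.setIntegral_law hDc.measurable hC measurableSet_Icc fun _ h => h.1]
  -- With `D s` written as `D t` minus the integral of `D'` over `[s, t]`, Fubini allows integration
  -- over the law first; the law gives mass `cdf r` to `[0, r]`.
  have hDs : ∀ s ∈ Icc 0 t, D s = D t - ∫ r in Ioc 0 t, (Ici s).indicator D' r := by
    intro s hs
    have h1 := intervalIntegral.integral_eq_sub_of_hasDerivAt (a := s) (b := t)
      (fun x _ => hD x) (hD'.intervalIntegrable _ _)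
    rw [intervalIntegral.integral_of_le hs.2, ← integral_Icc_eq_integral_Ioc] at h1
    rw [setIntegral_indicator measurableSet_Ici]
    have h2 : (∫ r in Ioc 0 t ∩ Ici s, D' r) = ∫ r in Icc s t, D' r := by
      refine setIntegral_congr_set ?_
      have : (Icc 0 t ∩ Ici s : Set ℝ) = Icc s t := by
        ext x; simp only [mem_inter_iff, mem_Icc, mem_Ici]
        exact ⟨fun h => ⟨h.2, h.1.2⟩, fun h => ⟨⟨hs.1.trans h.1, h.2⟩, h.1⟩⟩
      rw [← this]
      exact Ioc_ae_eq_Icc.inter (ae_eq_refl _)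
    rw [h2, h1]; ring
  rw [setIntegral_congr_fun measurableSet_Icc hDs]
  have hK : Measurable fun p : ℝ × ℝ => (Ici p.1).indicator D' p.2 := by
    have : (fun p : ℝ × ℝ => (Ici p.1).indicator D' p.2)
        = {p : ℝ × ℝ | p.1 ≤ p.2}.indicator fun p => D' p.2 := by
      ext p; simp [indicator]
    rw [this]
    exact (hD'.measurable.comp measurable_snd).indicator
      (measurableSet_le measurable_fst measurable_snd)
  have hKi : Integrable (fun p : ℝ × ℝ => (Ici p.1).indicator D' p.2)
      ((F.law.restrict (Icc 0 t)).prod (volume.restrict (Ioc 0 t))) := by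
    refine Integrable.of_bound hK.aestronglyMeasurable (max C' 0) ?_
    have h1 : ∀ᵐ p ∂((F.law.restrict (Icc 0 t)).prod (volume.restrict (Ioc 0 t))),
        p.2 ∈ Ioc 0 t :=
      Measure.quasiMeasurePreserving_snd.ae (ae_restrict_mem measurableSet_Ioc)
    filter_upwards [h1] with p hp
    by_cases h : p.2 ∈ Ici p.1
    · rw [indicator_of_mem h]
      exact (hC' p.2 ⟨hp.1.le, hp.2⟩).trans (le_max_left _ _)
    · rw [indicator_of_notMem h]; simp
  rw [integral_sub (integrable_const _) hKi.integral_prod_left, setIntegral_const, ← F.cdf_eq,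
    integral_integral_swap hKi, intervalIntegral.integral_of_le ht, smul_eq_mul, mul_comm]
  congr 1
  refine setIntegral_congr_fun measurableSet_Ioc fun r hr => ?_
  have : ∀ s, (Ici s).indicator D' r = (Iic r).indicator (fun _ => D' r) s := by
    intro s; simp [indicator]
  simp only [this]
  rw [setIntegral_indicator measurableSet_Iic, setIntegral_const, smul_eq_mul, mul_comm, cdf_eq]
  congr 2
  ext x; simp only [mem_inter_iff, mem_Icc, mem_Iic]
  exact ⟨fun h => ⟨h.1.1, h.2⟩, fun h => ⟨⟨h.1, h.2.trans hr.2⟩, h.2⟩⟩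

/-! ### Expectations -/

lemma expect_le {u : ℝ → ℝ} {uInf V : ℝ} (hu : ∀ t, 0 ≤ t → u t ≤ V) (hI : uInf ≤ V)
    (hV : 0 ≤ V) : F.expect u uInf ≤ V := by
  have h1 : (∫ t in Ici (0 : ℝ), u t * F.dens t) ≤ ∫ t in Ici (0 : ℝ), V * F.dens t := by
    by_cases hi : IntegrableOn (fun t => u t * F.dens t) (Ici 0)
    · exact setIntegral_mono_on hi (F.dens_integrable.const_mul V) measurableSet_Ici
        fun t ht => mul_le_mul_of_nonneg_right (hu t ht) (F.dens_nonneg t)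
    -- A divergent integral has the default value `0`, and likewise the sum below; this is why `0 ≤
    -- V` is needed.
    · rw [integral_undef hi]
      exact setIntegral_nonneg measurableSet_Ici fun t _ => mul_nonneg hV (F.dens_nonneg t)
  have hle : ∀ t, u t * F.atom t ≤ V * F.atom t := by
    intro t
    by_cases h : F.atom t = 0
    · simp [h]
    · exact mul_le_mul_of_nonneg_right (hu t (F.nonneg_of_atom_ne h)) (F.atom_nonneg t)
  have h2 : (∑' t, u t * F.atom t) ≤ ∑' t, V * F.atom t := by
    by_cases hs : Summable fun t => u t * F.atom t
    · exact hs.tsum_le_tsum hle (F.atom_summable.mul_left V)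
    · rw [tsum_eq_zero_of_not_summable hs]
      exact tsum_nonneg fun t => mul_nonneg hV (F.atom_nonneg t)
  have h3 : F.atInfty * uInf ≤ F.atInfty * V := mul_le_mul_of_nonneg_left hI F.atInfty_nonneg
  rw [integral_const_mul] at h1
  rw [tsum_mul_left] at h2
  unfold expect
  have : V * (∫ t in Ici (0 : ℝ), F.dens t) + V * (∑' t, F.atom t) + F.atInfty * V = V := by
    unfold atInfty; ring
  linarith

lemma expect_eq {u : ℝ → ℝ} {uInf V : ℝ} (hd : ∀ᵐ t, 0 ≤ t → F.dens t ≠ 0 → u t = V)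
    (ha : ∀ t, F.atom t ≠ 0 → u t = V) (hI : F.atInfty ≠ 0 → uInf = V) :
    F.expect u uInf = V := by
  have h1 : (∫ t in Ici (0 : ℝ), u t * F.dens t) = ∫ t in Ici (0 : ℝ), V * F.dens t := by
    refine setIntegral_congr_ae measurableSet_Ici ?_
    filter_upwards [hd] with t ht ht0
    by_cases h : F.dens t = 0
    · simp [h]
    · rw [ht ht0 h]
  have h2 : (∑' t, u t * F.atom t) = ∑' t, V * F.atom t := by
    refine tsum_congr fun t => ?_
    by_cases h : F.atom t = 0
    · simp [h]
    · rw [ha t h]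
  have h3 : F.atInfty * uInf = F.atInfty * V := by
    by_cases h : F.atInfty = 0
    · simp [h]
    · rw [hI h]
  rw [expect, h1, h2, h3, integral_const_mul, tsum_mul_left]
  unfold atInfty; ring

/-- A payoff that is nowhere above its expectation is equal to it on the support. -/
lemma eq_of_le_expect {u : ℝ → ℝ} {uInf V C : ℝ} (hu : ∀ t, 0 ≤ t → u t ≤ V) (hI : uInf ≤ V)
    (hV : V ≤ F.expect u uInf) (hm : AEStronglyMeasurable u (volume.restrict (Ici 0)))
    (hC : ∀ t, 0 ≤ t → |u t| ≤ C) :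
    (∀ᵐ t, 0 ≤ t → F.dens t ≠ 0 → u t = V) ∧ (∀ t, F.atom t ≠ 0 → u t = V) ∧
      (F.atInfty ≠ 0 → uInf = V) := by
  have hi : IntegrableOn (fun t => u t * F.dens t) (Ici 0) := by
    refine Integrable.bdd_mul (c := C) F.dens_integrable hm ?_
    exact (ae_restrict_iff' measurableSet_Ici).2 (Eventually.of_forall fun t ht => hC t ht)
  have hs : Summable fun t => u t * F.atom t := by
    refine Summable.of_norm_bounded (F.atom_summable.mul_left C) fun t => ?_
    rw [norm_mul, Real.norm_of_nonneg (F.atom_nonneg t)]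
    by_cases h : F.atom t = 0
    · simp [h]
    · exact mul_le_mul_of_nonneg_right (hC t (F.nonneg_of_atom_ne h)) (F.atom_nonneg t)
  have e1 : (∫ t in Ici (0 : ℝ), (V - u t) * F.dens t)
      = V * (∫ t in Ici (0 : ℝ), F.dens t) - ∫ t in Ici (0 : ℝ), u t * F.dens t := by
    rw [← integral_const_mul, ← integral_sub (F.dens_integrable.const_mul V) hi]
    simp only [sub_mul]
  have e2 : (∑' t, (V - u t) * F.atom t)
      = V * (∑' t, F.atom t) - ∑' t, u t * F.atom t := by
    rw [← tsum_mul_left, ← (F.atom_summable.mul_left V).tsum_sub hs]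
    simp only [sub_mul]
  have hs2 : Summable fun t => (V - u t) * F.atom t := by
    simpa only [sub_mul] using (F.atom_summable.mul_left V).sub hs
  have hi2 : IntegrableOn (fun t => (V - u t) * F.dens t) (Ici 0) := by
    simpa only [sub_mul] using! (F.dens_integrable.const_mul V).sub hi
  have n1 : 0 ≤ᵐ[volume.restrict (Ici 0)] fun t => (V - u t) * F.dens t :=
    (ae_restrict_iff' measurableSet_Ici).2 (Eventually.of_forall fun t ht =>
      mul_nonneg (sub_nonneg.2 (hu t ht)) (F.dens_nonneg t))
  have n2 : ∀ t, 0 ≤ (V - u t) * F.atom t := by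
    intro t
    by_cases h : F.atom t = 0
    · simp [h]
    · exact mul_nonneg (sub_nonneg.2 (hu t (F.nonneg_of_atom_ne h))) (F.atom_nonneg t)
  have p1 := integral_nonneg_of_ae n1
  have p2 : 0 ≤ ∑' t, (V - u t) * F.atom t := tsum_nonneg n2
  have p3 : 0 ≤ F.atInfty * (V - uInf) := mul_nonneg F.atInfty_nonneg (by linarith)
  have tot : (∫ t in Ici (0 : ℝ), (V - u t) * F.dens t) + (∑' t, (V - u t) * F.atom t)
      + F.atInfty * (V - uInf) = V - F.expect u uInf := by
    rw [e1, e2]; unfold expect atInfty; ring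
  refine ⟨?_, fun t ht => ?_, fun h => ?_⟩
  · have z : (∫ t in Ici (0 : ℝ), (V - u t) * F.dens t) = 0 := by linarith
    have := (integral_eq_zero_iff_of_nonneg_ae n1 hi2).1 z
    filter_upwards [(ae_restrict_iff' measurableSet_Ici).1 this] with t ht ht0 hd
    have := (mul_eq_zero.1 (ht ht0)).resolve_right hd
    linarith
  · have z : (∑' t, (V - u t) * F.atom t) = 0 := by linarith
    have := congrFun ((hasSum_zero_iff_of_nonneg n2).1 (z ▸ hs2.hasSum)) t
    have := (mul_eq_zero.1 this).resolve_right ht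
    linarith
  · have z : F.atInfty * (V - uInf) = 0 := by linarith
    have := (mul_eq_zero.1 z).resolve_left h
    linarith

/-- The time `t` with certainty. -/
def pure (t : ℝ) (ht : 0 ≤ t) : MixedTime where
  dens _ := 0
  atom := Pi.single t 1
  dens_nonneg _ := le_rfl
  dens_integrable := integrableOn_zero
  atom_nonneg s := by by_cases h : s = t <;> simp [h]
  atom_of_neg s hs := by simp [(hs.trans_le ht).ne]
  atom_summable := (hasSum_pi_single t (1 : ℝ)).summable
  total_le_one := by simp [tsum_pi_single]

lemma pure_expect {t : ℝ} (ht : 0 ≤ t) (u : ℝ → ℝ) (uInf : ℝ) :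
    (pure t ht).expect u uInf = u t := by
  refine expect_eq _ (Eventually.of_forall fun s _ h => (h rfl).elim) (fun s hs => ?_)
    fun h => (h ?_).elim
  · by_cases hst : s = t
    · rw [hst]
    · exact (hs (by simp [pure, hst])).elim
  · simp [atInfty, pure, tsum_pi_single]

/-- The time `∞` with certainty. -/
def never : MixedTime where
  dens _ := 0
  atom _ := 0
  dens_nonneg _ := le_rfl
  dens_integrable := integrableOn_zero
  atom_nonneg _ := le_rfl
  atom_of_neg _ _ := rfl
  atom_summable := summable_zero
  total_le_one := by simp

lemma never_expect (u : ℝ → ℝ) (uInf : ℝ) : never.expect u uInf = uInf := by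
  simp [expect, never, atInfty]

end MixedTime

/-! ### Primitives of functions on the half-line -/

section Primitive

variable {f : ℝ → ℝ} (hf : IntegrableOn f (Ici 0))
include hf

lemma intervalIntegrable_of_Ici {a b : ℝ} (ha : 0 ≤ a) (hb : 0 ≤ b) :
    IntervalIntegrable f volume a b :=
  ⟨hf.mono_set fun _ h => ha.trans h.1.le, hf.mono_set fun _ h => hb.trans h.1.le⟩

lemma primitive_sub {a b : ℝ} (ha : 0 ≤ a) (hb : 0 ≤ b) :
    (∫ s in (0 : ℝ)..b, f s) - (∫ s in (0 : ℝ)..a, f s) = ∫ s in a..b, f s := by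
  rw [← intervalIntegral.integral_add_adjacent_intervals
    (intervalIntegrable_of_Ici hf le_rfl ha) (intervalIntegrable_of_Ici hf ha hb)]
  ring

lemma continuousOn_primitive_Ici : ContinuousOn (fun t => ∫ s in (0 : ℝ)..t, f s) (Ici 0) := by
  have hi : Integrable ((Ici 0).indicator f) := (integrable_indicator_iff measurableSet_Ici).2 hf
  have h := intervalIntegral.continuous_primitive (fun a b => hi.intervalIntegrable (a := a) (b := b)) 0
  refine h.continuousOn.congr fun t ht => intervalIntegral.integral_congr fun s hs => ?_
  rw [uIcc_of_le ht] at hs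
  exact (indicator_of_mem (show s ∈ Ici (0 : ℝ) from hs.1) f).symm

lemma tendsto_primitive_Ici :
    Tendsto (fun t => ∫ s in Icc 0 t, f s) atTop (𝓝 (∫ s in Ici 0, f s)) := by
  have h := intervalIntegral_tendsto_integral_Ioi 0 (hf.mono_set Ioi_subset_Ici_self) tendsto_id
  rw [← integral_Ici_eq_integral_Ioi] at h
  refine h.congr' ?_
  filter_upwards [eventually_ge_atTop 0] with t ht
  rw [id, intervalIntegral.integral_of_le ht, integral_Icc_eq_integral_Ioc]

end Primitive

lemma tendsto_tsum_indicator_Icc {c : ℝ → ℝ} {b : ℝ → ℝ} (hb : Summable b)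
    (hc : ∀ s, 0 ≤ s → |c s| ≤ b s) (hb0 : ∀ s, 0 ≤ b s) :
    Tendsto (fun t => ∑' s, (Icc 0 t).indicator c s) atTop (𝓝 (∑' s, (Ici 0).indicator c s)) := by
  refine tendsto_tsum_of_dominated_convergence hb (fun s => ?_)
    (Eventually.of_forall fun t s => ?_)
  · refine tendsto_const_nhds.congr' ?_
    filter_upwards [eventually_ge_atTop s] with t ht
    by_cases hs : 0 ≤ s
    · rw [indicator_of_mem (show s ∈ Ici (0 : ℝ) from hs),
        indicator_of_mem (show s ∈ Icc 0 t from ⟨hs, ht⟩)]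
    · rw [indicator_of_notMem (show s ∉ Ici (0 : ℝ) from hs),
        indicator_of_notMem (show s ∉ Icc 0 t from fun h => hs h.1)]
  · by_cases hs : s ∈ Icc 0 t
    · rw [indicator_of_mem hs]; exact hc s hs.1
    · rw [indicator_of_notMem hs]; simpa using hb0 s

/-! ### Payoffs as integrals of flows -/

namespace SearchModel

variable (M : SearchModel)

/-- The probability that no faker has faked until `s`. -/
def rem (σ : ℝ) (FA : MixedTime) (s : ℝ) : ℝ := 1 - σ * FA.cdf s

/-- The flow gain from the option to act on type-1 news. -/
def gain (σ : ℝ) (FA : MixedTime) (s : ℝ) : ℝ :=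
  max (M.μ * (1 - M.θ) * M.haz s * rem σ FA s - (M.θ - M.μ) * (σ * FA.dens s)) 0

/-- The principal's discounted flow payoff of waiting. -/
def flowP (σ : ℝ) (FA : MixedTime) (s : ℝ) : ℝ :=
  M.disc s * (M.gain σ FA s - M.ρ * M.θ * rem σ FA s)

/-- The faker's discounted flow payoff of waiting, relative to an immediate safe action. -/
def flowA (a : ℝ → ℝ) (FP : MixedTime) (s : ℝ) : ℝ :=
  M.disc s * (1 - FP.cdf s) * (M.μ * (1 - M.β) * M.haz s * a s - M.ρ * M.β)

/-- The faker's payoff of faking at `t` if fake news at `t` leads to the safe action. -/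
def baseA (a : ℝ → ℝ) (FP : MixedTime) (t : ℝ) : ℝ :=
  M.β + ∫ s in (0 : ℝ)..t, M.flowA a FP s

/-- The faker's payoff of faking at `t` if fake news at `t` leads to the risky action. -/
def riskyA (a : ℝ → ℝ) (FP : MixedTime) (t : ℝ) : ℝ :=
  M.baseA a FP t + M.disc t * (1 - FP.cdf t) * (M.μ - M.β)

/-- The response to news is optimal given the posterior belief. -/
def OptimalResponse (σ : ℝ) (a : ℝ → ℝ) (FA : MixedTime) : Prop :=
  ∀ t, 0 ≤ t → (M.θ < M.belief σ FA t → a t = 1) ∧ (M.belief σ FA t < M.θ → a t = 0)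

/-- Integration by parts, with `-(ρ + haz) disc` as the derivative of `disc`. It absorbs the atoms
of a mixed time into a flow; it is used with `c = σ` for faking and `c = 1` for stopping. -/
lemma discounted_law (F : MixedTime) (c : ℝ) {t : ℝ} (ht : 0 ≤ t) :
    c * ((∫ s in Icc 0 t, M.disc s * F.dens s)
      + ∑' s, (Icc 0 t).indicator (fun s => M.disc s * F.atom s) s)
      = 1 - M.disc t * (1 - c * F.cdf t)
        - ∫ s in (0 : ℝ)..t, (M.ρ + M.haz s) * M.disc s * (1 - c * F.cdf s) := by
  have hk : Continuous fun s => (M.ρ + M.haz s) * M.disc s :=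
    (continuous_const.add M.haz_continuous).mul M.disc_continuous
  have hY : IntervalIntegrable F.cdf volume 0 t := F.cdf_mono.intervalIntegrable
  have hi := hY.continuousOn_mul (hk.continuousOn (s := uIcc 0 t))
  rw [F.integral_by_parts M.disc_hasDerivAt hk.neg ht]
  have h1 : (∫ s in (0 : ℝ)..t, (M.ρ + M.haz s) * M.disc s * (1 - c * F.cdf s))
      = (1 - M.disc t) - c * ∫ s in (0 : ℝ)..t, (M.ρ + M.haz s) * M.disc s * F.cdf s := by
    have h00 : 1 - M.disc t = ∫ s in (0 : ℝ)..t, (M.ρ + M.haz s) * M.disc s := by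
      rw [M.integral_disc, M.disc_zero]
    rw [h00, ← intervalIntegral.integral_const_mul,
      ← intervalIntegral.integral_sub (hk.intervalIntegrable _ _) (hi.const_mul c)]
    refine intervalIntegral.integral_congr fun s _ => ?_
    ring
  have h2 : (∫ s in (0 : ℝ)..t, -((M.ρ + M.haz s) * M.disc s) * F.cdf s)
      = -∫ s in (0 : ℝ)..t, (M.ρ + M.haz s) * M.disc s * F.cdf s := by
    rw [← intervalIntegral.integral_neg]
    refine intervalIntegral.integral_congr fun s _ => ?_
    ring
  rw [h1, h2]; ring

/-! ### Integrability -/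

lemma integrableOn_disc_mul {f : ℝ → ℝ} {C : ℝ} (hf : Measurable f)
    (hC : ∀ t, 0 ≤ t → |f t| ≤ C) : IntegrableOn (fun s => M.disc s * f s) (Ici 0) := by
  have := Integrable.bdd_mul (c := C) M.integrableOn_disc hf.aestronglyMeasurable
    ((ae_restrict_iff' measurableSet_Ici).2 (Eventually.of_forall fun t ht => hC t ht))
  exact this.congr (Eventually.of_forall fun s => mul_comm _ _)

lemma integrableOn_disc_mul_dens (F : MixedTime) :
    IntegrableOn (fun s => M.disc s * F.dens s) (Ici 0) := by
  refine Integrable.bdd_mul (c := 1) F.dens_integrable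
    M.disc_continuous.aestronglyMeasurable ?_
  refine (ae_restrict_iff' measurableSet_Ici).2 (Eventually.of_forall fun t ht => ?_)
  rw [Real.norm_of_nonneg (M.disc_pos t).le]
  exact M.disc_le_one ht

section rem

variable {σ : ℝ} (h0 : 0 < σ) (h1 : σ < 1) (FA : MixedTime)

lemma rem_measurable : Measurable (rem σ FA) :=
  measurable_const.sub (FA.cdf_mono.measurable.const_mul σ)

include h0

lemma rem_le_one (s : ℝ) : rem σ FA s ≤ 1 := by
  have := mul_nonneg h0.le (FA.cdf_nonneg s)
  unfold rem; linarith

lemma le_rem (s : ℝ) : 1 - σ ≤ rem σ FA s := by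
  have := mul_le_mul_of_nonneg_left (FA.cdf_le_one s) h0.le
  unfold rem; linarith

lemma rem_antitone : Antitone (rem σ FA) := fun s t h => by
  have := mul_le_mul_of_nonneg_left (FA.cdf_mono h) h0.le
  unfold rem; linarith

include h1

lemma rem_pos (s : ℝ) : 0 < rem σ FA s := by
  have := le_rem h0 FA s
  linarith

lemma abs_rem (s : ℝ) : |rem σ FA s| ≤ 1 := by
  rw [abs_of_pos (rem_pos h0 h1 FA s)]; exact rem_le_one h0 FA s

lemma abs_haz_mul_rem {s : ℝ} (hs : 0 ≤ s) : |M.haz s * rem σ FA s| ≤ M.haz 0 * 1 := by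
  rw [abs_mul, abs_of_nonneg (M.haz_nonneg s)]
  exact mul_le_mul (M.haz_le hs) (abs_rem h0 h1 FA s) (abs_nonneg _) (M.haz_nonneg 0)

lemma integrableOn_haz_rem :
    IntegrableOn (fun s => M.disc s * (M.haz s * rem σ FA s)) (Ici 0) :=
  M.integrableOn_disc_mul (M.haz_continuous.measurable.mul (rem_measurable FA))
    fun _ ht => M.abs_haz_mul_rem h0 h1 FA ht

lemma integrableOn_rem : IntegrableOn (fun s => M.disc s * rem σ FA s) (Ici 0) :=
  M.integrableOn_disc_mul (rem_measurable FA) fun t _ => abs_rem h0 h1 FA t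

lemma integrableOn_gain : IntegrableOn (fun s => M.disc s * M.gain σ FA s) (Ici 0) := by
  have := (((M.integrableOn_haz_rem h0 h1 FA).const_mul (M.μ * (1 - M.θ))).sub
    ((M.integrableOn_disc_mul_dens FA).const_mul ((M.θ - M.μ) * σ))).pos_part
  refine this.congr (Eventually.of_forall fun s => ?_)
  simp only [gain, mul_max_of_nonneg _ _ (M.disc_pos s).le, mul_zero, Pi.sub_apply]
  congr 1
  ring

lemma integrableOn_flowP : IntegrableOn (M.flowP σ FA) (Ici 0) := by
  have := (M.integrableOn_gain h0 h1 FA).sub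
    ((M.integrableOn_rem h0 h1 FA).const_mul (M.ρ * M.θ))
  refine this.congr (Eventually.of_forall fun s => ?_)
  simp only [flowP, Pi.sub_apply]
  ring

/-! ### Beliefs -/

variable {FA}

lemma w1_pos {s : ℝ} (hs : 0 ≤ s) : 0 < M.w1 σ FA s := by
  have h2 : 0 < M.g s := by
    rw [← M.gExt_eq hs, M.gExt_eq_haz]; exact mul_pos (M.haz_pos hs) (M.surv_pos s)
  have h3 := mul_pos (mul_pos M.μ_pos h2) (rem_pos h0 h1 FA s)
  have h4 := mul_nonneg (mul_nonneg h0.le (FA.dens_nonneg s)) (M.surv_pos s).le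
  unfold w1
  rw [M.one_sub_G hs]
  unfold rem at h3
  linarith

/-- Clearing the denominator of the posterior leaves the benefit of acting on real news minus the
loss from acting on a fake; its sign decides the response. -/
lemma belief_sub_mul {s : ℝ} (hs : 0 ≤ s) (ha : FA.atom s = 0) :
    (M.belief σ FA s - M.θ) * M.w1 σ FA s = M.surv s *
      (M.μ * (1 - M.θ) * M.haz s * rem σ FA s - (M.θ - M.μ) * (σ * FA.dens s)) := by
  rw [belief, if_neg (by rw [ha]; exact lt_irrefl _), sub_mul,
    div_mul_cancel₀ _ (M.w1_pos h0 h1 hs).ne', w1, M.one_sub_G hs, ← M.gExt_eq hs, M.gExt_eq_haz,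
    rem]
  ring

lemma theta_lt_belief_iff {s : ℝ} (hs : 0 ≤ s) (ha : FA.atom s = 0) :
    M.θ < M.belief σ FA s ↔
      (M.θ - M.μ) * (σ * FA.dens s) < M.μ * (1 - M.θ) * M.haz s * rem σ FA s := by
  have h := M.belief_sub_mul h0 h1 hs ha
  have hw := M.w1_pos h0 h1 (FA := FA) hs
  have hS := M.surv_pos s
  rw [← sub_pos, ← mul_pos_iff_of_pos_right hw, h, mul_pos_iff_of_pos_left hS, sub_pos]

lemma belief_lt_theta_iff {s : ℝ} (hs : 0 ≤ s) (ha : FA.atom s = 0) :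
    M.belief σ FA s < M.θ ↔
      M.μ * (1 - M.θ) * M.haz s * rem σ FA s < (M.θ - M.μ) * (σ * FA.dens s) := by
  have h := M.belief_sub_mul h0 h1 hs ha
  have hw := M.w1_pos h0 h1 (FA := FA) hs
  have hS := M.surv_pos s
  have h' : (M.θ - M.belief σ FA s) * M.w1 σ FA s = M.surv s *
      ((M.θ - M.μ) * (σ * FA.dens s) - M.μ * (1 - M.θ) * M.haz s * rem σ FA s) := by
    linear_combination -h
  rw [← sub_pos, ← mul_pos_iff_of_pos_right hw, h', mul_pos_iff_of_pos_left hS, sub_pos]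

lemma theta_lt_belief_of_dens_eq_zero {s : ℝ} (hs : 0 ≤ s) (ha : FA.atom s = 0)
    (hd : FA.dens s = 0) : M.θ < M.belief σ FA s := by
  rw [M.theta_lt_belief_iff h0 h1 hs ha, hd, mul_zero, mul_zero]
  exact mul_pos (mul_pos (mul_pos M.μ_pos (by linarith [M.θ_lt_one])) (M.haz_pos hs))
    (rem_pos h0 h1 FA s)

variable {a : ℝ → ℝ} (hr : M.OptimalResponse σ a FA)
include hr

omit h0 h1 in
lemma response_of_atom {s : ℝ} (hs : 0 ≤ s) (ha : FA.atom s ≠ 0) : a s = 0 := by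
  refine (hr s hs).2 ?_
  rw [belief, if_pos (lt_of_le_of_ne (FA.atom_nonneg s) ha.symm)]
  exact M.μ_lt_θ

/-- Under an optimal response the gain over the safe action is the positive part `gain`, however
indifference is resolved. The integrand therefore no longer depends on `a`. -/
lemma news_integrand {s : ℝ} (hs : 0 ≤ s) (ha : FA.atom s = 0) :
    Real.exp (-M.ρ * s) * (M.w0 σ FA s * M.θ
      + M.w1 σ FA s * ((1 - a s) * M.θ + a s * M.belief σ FA s))
      = M.θ * (M.disc s * (M.haz s * rem σ FA s)) + M.θ * σ * (M.disc s * FA.dens s)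
        + M.disc s * M.gain σ FA s := by
  have h := M.belief_sub_mul h0 h1 hs ha
  have e1 : M.w0 σ FA s + M.w1 σ FA s
      = M.surv s * (M.haz s * rem σ FA s + σ * FA.dens s) := by
    rw [w0, w1, M.one_sub_G hs, ← M.gExt_eq hs, M.gExt_eq_haz, rem]; ring
  have e2 : a s * ((M.belief σ FA s - M.θ) * M.w1 σ FA s) = M.surv s * M.gain σ FA s := by
    rcases lt_trichotomy (M.belief σ FA s) M.θ with hb | hb | hb
    · rw [(hr s hs).2 hb, gain, max_eq_right]
      · ring
      · rw [M.belief_lt_theta_iff h0 h1 hs ha] at hb; linarith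
    · rw [hb, sub_self, zero_mul] at h
      rw [gain, max_eq_right, hb]
      · ring
      · exact (((mul_eq_zero.1 h.symm).resolve_left (M.surv_pos s).ne')).le
    · rw [(hr s hs).1 hb, h, gain, max_eq_left]
      · ring
      · rw [M.theta_lt_belief_iff h0 h1 hs ha] at hb; linarith
  rw [disc]
  linear_combination Real.exp (-M.ρ * s) * M.θ * e1 + Real.exp (-M.ρ * s) * e2

-- News at an atom leads to the safe action, so it is worth as much as stopping at that time.
omit h0 h1 in
lemma news_atom {s : ℝ} (hs : 0 ≤ s) :
    Real.exp (-M.ρ * s) * (σ * FA.atom s * (1 - M.G s))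
      * ((1 - a s) * M.θ + a s * M.belief σ FA s) = M.θ * σ * (M.disc s * FA.atom s) := by
  by_cases ha : FA.atom s = 0
  · simp [ha]
  · rw [M.response_of_atom hr hs ha, M.disc_eq hs]; ring

lemma newsP_eq {A : Set ℝ} (hA : MeasurableSet A) (hA0 : A ⊆ Ici 0) :
    M.newsP σ a FA A = (∫ s in A, (M.θ * (M.disc s * (M.haz s * rem σ FA s))
        + M.θ * σ * (M.disc s * FA.dens s) + M.disc s * M.gain σ FA s))
      + ∑' s, A.indicator (fun s => M.θ * σ * (M.disc s * FA.atom s)) s := by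
  unfold newsP
  congr 1
  · refine setIntegral_congr_ae hA ?_
    filter_upwards [FA.ae_atom_eq_zero] with s hs hsA
    exact M.news_integrand h0 h1 hr (hA0 hsA) hs
  · refine tsum_congr fun s => ?_
    by_cases hs : s ∈ A
    · rw [indicator_of_mem hs, indicator_of_mem hs, M.news_atom hr (hA0 hs)]
    · rw [indicator_of_notMem hs, indicator_of_notMem hs]

omit hr in
lemma integrableOn_news : IntegrableOn (fun s => M.θ * (M.disc s * (M.haz s * rem σ FA s))
        + M.θ * σ * (M.disc s * FA.dens s) + M.disc s * M.gain σ FA s) (Ici 0) :=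
  (((M.integrableOn_haz_rem h0 h1 FA).const_mul _).add
    ((M.integrableOn_disc_mul_dens FA).const_mul _)).add (M.integrableOn_gain h0 h1 FA)

/-- The principal's payoff as the integral of her flow payoff. -/
lemma uP_eq {t : ℝ} (ht : 0 ≤ t) :
    M.uP σ a FA t = M.θ + ∫ s in (0 : ℝ)..t, M.flowP σ FA s := by
  have sub : Icc 0 t ⊆ Ici (0 : ℝ) := fun _ h => h.1
  have i1 := (M.integrableOn_haz_rem h0 h1 FA)
  have i2 := (M.integrableOn_disc_mul_dens FA)
  have i3 := (M.integrableOn_gain h0 h1 FA)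
  have i4 := (M.integrableOn_rem h0 h1 FA)
  have i12 : IntegrableOn (fun s => M.θ * (M.disc s * (M.haz s * rem σ FA s))
      + M.θ * σ * (M.disc s * FA.dens s)) (Icc 0 t) :=
    ((i1.mono_set sub).const_mul _).add ((i2.mono_set sub).const_mul _)
  rw [uP, M.newsP_eq h0 h1 hr measurableSet_Icc sub, integral_add i12 (i3.mono_set sub),
    integral_add ((i1.mono_set sub).const_mul _) ((i2.mono_set sub).const_mul _),
    integral_const_mul, integral_const_mul]
  have hs : (∑' s, (Icc 0 t).indicator (fun s => M.θ * σ * (M.disc s * FA.atom s)) s)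
      = M.θ * σ * ∑' s, (Icc 0 t).indicator (fun s => M.disc s * FA.atom s) s := by
    rw [← tsum_mul_left]
    refine tsum_congr fun s => ?_
    by_cases h : s ∈ Icc 0 t <;> simp [h]
  -- The safe payoffs after fakes and after stopping at `t` are traded for a flow at rate `ρ + haz`.
  -- Its `haz` part cancels the safe payoff of real news, which leaves the cost of delay `ρ θ`.
  have hk := M.discounted_law FA σ ht
  have hsplit : (∫ s in (0 : ℝ)..t, M.flowP σ FA s)
      = (∫ s in (0 : ℝ)..t, M.disc s * M.gain σ FA s)
        + M.θ * (∫ s in (0 : ℝ)..t, M.disc s * (M.haz s * rem σ FA s))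
        - M.θ * ∫ s in (0 : ℝ)..t, (M.ρ + M.haz s) * M.disc s * (1 - σ * FA.cdf s) := by
    have j1 := intervalIntegrable_of_Ici i1 le_rfl ht
    have j3 := intervalIntegrable_of_Ici i3 le_rfl ht
    have j4 := intervalIntegrable_of_Ici i4 le_rfl ht
    have j5 : IntervalIntegrable
        (fun s => (M.ρ + M.haz s) * M.disc s * (1 - σ * FA.cdf s)) volume 0 t := by
      refine ((j4.const_mul M.ρ).add j1).congr fun s _ => ?_
      simp only [rem]
      ring
    rw [← intervalIntegral.integral_const_mul, ← intervalIntegral.integral_const_mul,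
      ← intervalIntegral.integral_add j3 (j1.const_mul _),
      ← intervalIntegral.integral_sub (j3.add (j1.const_mul _)) (j5.const_mul _)]
    refine intervalIntegral.integral_congr fun s _ => ?_
    simp only [flowP, rem]
    ring
  rw [hs, hsplit, intervalIntegral.integral_of_le ht, intervalIntegral.integral_of_le ht,
    ← integral_Icc_eq_integral_Ioc, ← integral_Icc_eq_integral_Ioc]
  have hd := M.disc_eq ht
  linear_combination M.θ * hk - M.θ * (1 - σ * FA.cdf t) * hd

/-- The residual safe payoff is discounted away, so bounds on finite stopping times pass to `∞`. -/
lemma tendsto_uP : Tendsto (M.uP σ a FA) atTop (𝓝 (M.uPInf σ a FA)) := by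
  have t1 := tendsto_primitive_Ici (M.integrableOn_news (FA := FA) h0 h1)
  have t2 := tendsto_tsum_indicator_Icc (c := fun s => M.θ * σ * (M.disc s * FA.atom s))
    (FA.atom_summable.mul_left (M.θ * σ)) (fun s hs => by
      have := M.disc_pos s
      have := M.disc_le_one hs
      have := FA.atom_nonneg s
      have hc : 0 ≤ M.θ * σ := mul_nonneg M.θ_pos.le h0.le
      rw [abs_of_nonneg (by positivity)]
      exact mul_le_mul_of_nonneg_left (mul_le_of_le_one_left ‹_› ‹_›) hc)
    (fun s => mul_nonneg (mul_nonneg M.θ_pos.le h0.le) (FA.atom_nonneg s))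
  have t3 : Tendsto (fun t => M.disc t * (rem σ FA t * M.θ)) atTop (𝓝 0) := by
    refine M.tendsto_disc.zero_mul_isBoundedUnder_le ?_
    refine isBoundedUnder_of ⟨M.θ, fun t => ?_⟩
    simp only [Function.comp, norm_mul, Real.norm_eq_abs, abs_of_pos M.θ_pos]
    exact mul_le_of_le_one_left M.θ_pos.le (abs_rem h0 h1 FA t)
  have := (t1.add t2).add t3
  rw [add_zero, ← M.newsP_eq h0 h1 hr measurableSet_Ici subset_rfl] at this
  refine this.congr' ?_
  filter_upwards [eventually_ge_atTop 0] with t ht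
  rw [uP, M.newsP_eq h0 h1 hr measurableSet_Icc fun _ h => h.1, M.disc_eq ht, rem]
  ring

end rem

/-! ### The payoff of the faker -/

section faker

variable {a : ℝ → ℝ} (hm : Measurable a) (ha : ∀ t, a t ∈ Icc (0 : ℝ) 1) (FP : MixedTime)

lemma abs_one_sub_cdf (t : ℝ) : |1 - FP.cdf t| ≤ 1 := by
  rw [abs_of_nonneg (by linarith [FP.cdf_le_one t])]; linarith [FP.cdf_nonneg t]

lemma one_sub_cdf_measurable : Measurable fun t => 1 - FP.cdf t :=
  measurable_const.sub FP.cdf_mono.measurable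

lemma integrableOn_one_sub_cdf : IntegrableOn (fun s => M.disc s * (1 - FP.cdf s)) (Ici 0) :=
  M.integrableOn_disc_mul (one_sub_cdf_measurable FP) fun t _ => abs_one_sub_cdf FP t

lemma integrableOn_haz_one_sub_cdf :
    IntegrableOn (fun s => M.disc s * (M.haz s * (1 - FP.cdf s))) (Ici 0) :=
  M.integrableOn_disc_mul (C := M.haz 0 * 1)
    (M.haz_continuous.measurable.mul (one_sub_cdf_measurable FP)) fun t ht => by
    rw [abs_mul, abs_of_nonneg (M.haz_nonneg t)]
    exact mul_le_mul (M.haz_le ht) (abs_one_sub_cdf FP t) (abs_nonneg _) (M.haz_nonneg 0)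

include hm ha

lemma integrableOn_haz_act :
    IntegrableOn (fun s => M.disc s * (M.haz s * (1 - FP.cdf s) * a s)) (Ici 0) :=
  M.integrableOn_disc_mul (C := M.haz 0 * 1 * 1)
    ((M.haz_continuous.measurable.mul (one_sub_cdf_measurable FP)).mul hm) fun t ht => by
    rw [abs_mul, abs_mul, abs_of_nonneg (M.haz_nonneg t), abs_of_nonneg (ha t).1]
    have := M.haz_nonneg 0
    exact mul_le_mul (mul_le_mul (M.haz_le ht) (abs_one_sub_cdf FP t) (abs_nonneg _)
      (M.haz_nonneg 0)) (ha t).2 (ha t).1 (by positivity)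

lemma integrableOn_flowA : IntegrableOn (M.flowA a FP) (Ici 0) := by
  have := ((M.integrableOn_haz_act hm ha FP).const_mul (M.μ * (1 - M.β))).sub
    ((M.integrableOn_one_sub_cdf FP).const_mul (M.ρ * M.β))
  refine this.congr (Eventually.of_forall fun s => ?_)
  simp only [flowA, Pi.sub_apply]
  ring

omit hm ha in
lemma endA_eq {A : Set ℝ} (hA : MeasurableSet A) (hA0 : A ⊆ Ici 0) :
    M.endA a FP A = (∫ s in A, (M.β * (M.disc s * (M.haz s * (1 - FP.cdf s)))
        + M.μ * (1 - M.β) * (M.disc s * (M.haz s * (1 - FP.cdf s) * a s))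
        + M.β * (M.disc s * FP.dens s)))
      + ∑' s, A.indicator (fun s => M.β * (M.disc s * FP.atom s)) s := by
  unfold endA
  congr 1
  · refine setIntegral_congr_fun hA fun s hs => ?_
    have e1 := M.disc_mul_haz (hA0 hs)
    have e2 := M.disc_eq (hA0 hs)
    linear_combination (1 - FP.cdf s) * (M.β + M.μ * (1 - M.β) * a s) * e1
      - FP.dens s * M.β * e2
  · refine tsum_congr fun s => ?_
    by_cases hs : s ∈ A
    · rw [indicator_of_mem hs, indicator_of_mem hs, M.disc_eq (hA0 hs)]; ring
    · rw [indicator_of_notMem hs, indicator_of_notMem hs]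

lemma integrableOn_end : IntegrableOn (fun s => M.β * (M.disc s * (M.haz s * (1 - FP.cdf s)))
        + M.μ * (1 - M.β) * (M.disc s * (M.haz s * (1 - FP.cdf s) * a s))
        + M.β * (M.disc s * FP.dens s)) (Ici 0) :=
  (((M.integrableOn_haz_one_sub_cdf FP).const_mul _).add
    ((M.integrableOn_haz_act hm ha FP).const_mul _)).add
    ((M.integrableOn_disc_mul_dens FP).const_mul _)

/-- The faker's payoff in terms of the payoff with a safe response. -/
lemma uA_eq {t : ℝ} (ht : 0 ≤ t) :
    M.uA a FP t = M.baseA a FP t + M.disc t * (1 - FP.cdf t) * (M.μ - M.β) * a t := by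
  have sub : Icc 0 t ⊆ Ici (0 : ℝ) := fun _ h => h.1
  have i1 := M.integrableOn_haz_one_sub_cdf FP
  have i2 := M.integrableOn_haz_act hm ha FP
  have i3 := M.integrableOn_disc_mul_dens FP
  have i4 := M.integrableOn_one_sub_cdf FP
  have i12 : IntegrableOn (fun s => M.β * (M.disc s * (M.haz s * (1 - FP.cdf s)))
      + M.μ * (1 - M.β) * (M.disc s * (M.haz s * (1 - FP.cdf s) * a s))) (Icc 0 t) :=
    ((i1.mono_set sub).const_mul _).add ((i2.mono_set sub).const_mul _)
  rw [uA, M.endA_eq FP measurableSet_Icc sub, integral_add i12 ((i3.mono_set sub).const_mul _),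
    integral_add ((i1.mono_set sub).const_mul _) ((i2.mono_set sub).const_mul _),
    integral_const_mul, integral_const_mul, integral_const_mul]
  have hs : (∑' s, (Icc 0 t).indicator (fun s => M.β * (M.disc s * FP.atom s)) s)
      = M.β * ∑' s, (Icc 0 t).indicator (fun s => M.disc s * FP.atom s) s := by
    rw [← tsum_mul_left]
    refine tsum_congr fun s => ?_
    by_cases h : s ∈ Icc 0 t <;> simp [h]
  have hk := M.discounted_law FP 1 ht
  simp only [one_mul] at hk
  have hsplit : (∫ s in (0 : ℝ)..t, M.flowA a FP s)
      = M.β * (∫ s in (0 : ℝ)..t, M.disc s * (M.haz s * (1 - FP.cdf s)))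
        + M.μ * (1 - M.β) * (∫ s in (0 : ℝ)..t, M.disc s * (M.haz s * (1 - FP.cdf s) * a s))
        - M.β * ∫ s in (0 : ℝ)..t, (M.ρ + M.haz s) * M.disc s * (1 - FP.cdf s) := by
    have j1 := intervalIntegrable_of_Ici i1 le_rfl ht
    have j2 := intervalIntegrable_of_Ici i2 le_rfl ht
    have j4 := intervalIntegrable_of_Ici i4 le_rfl ht
    have j5 : IntervalIntegrable
        (fun s => (M.ρ + M.haz s) * M.disc s * (1 - FP.cdf s)) volume 0 t := by
      refine ((j4.const_mul M.ρ).add j1).congr fun s _ => ?_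
      ring
    rw [← intervalIntegral.integral_const_mul, ← intervalIntegral.integral_const_mul,
      ← intervalIntegral.integral_const_mul,
      ← intervalIntegral.integral_add (j1.const_mul _) (j2.const_mul _),
      ← intervalIntegral.integral_sub ((j1.const_mul _).add (j2.const_mul _)) (j5.const_mul _)]
    refine intervalIntegral.integral_congr fun s _ => ?_
    simp only [flowA]
    ring
  rw [hs, baseA, hsplit, intervalIntegral.integral_of_le ht, intervalIntegral.integral_of_le ht,
    ← integral_Icc_eq_integral_Ioc, ← integral_Icc_eq_integral_Ioc]
  have hd := M.disc_eq ht
  linear_combination M.β * hk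
    - (1 - FP.cdf t) * ((1 - a t) * M.β + M.μ * a t) * hd

lemma tendsto_uA : Tendsto (M.uA a FP) atTop (𝓝 (M.uAInf a FP)) := by
  have t1 := tendsto_primitive_Ici (M.integrableOn_end hm ha FP)
  have t2 := tendsto_tsum_indicator_Icc (c := fun s => M.β * (M.disc s * FP.atom s))
    (FP.atom_summable.mul_left M.β) (fun s hs => by
      have := M.disc_pos s
      have := M.disc_le_one hs
      have := FP.atom_nonneg s
      have hc := M.β_pos
      rw [abs_of_nonneg (by positivity)]
      exact mul_le_mul_of_nonneg_left (mul_le_of_le_one_left ‹_› ‹_›) hc.le)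
    (fun s => mul_nonneg M.β_pos.le (FP.atom_nonneg s))
  have t3 : Tendsto (fun t => M.disc t * ((1 - FP.cdf t) * ((1 - a t) * M.β + M.μ * a t)))
      atTop (𝓝 0) := by
    refine M.tendsto_disc.zero_mul_isBoundedUnder_le ?_
    refine isBoundedUnder_of ⟨1 * (M.β + M.μ), fun t => ?_⟩
    have h1 := (ha t).1
    have h2 := (ha t).2
    have h3 := M.β_pos
    have h4 := M.μ_pos
    simp only [Function.comp, norm_mul, Real.norm_eq_abs]
    refine mul_le_mul (abs_one_sub_cdf FP t) ?_ (abs_nonneg _) zero_le_one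
    rw [abs_of_nonneg (by nlinarith)]
    nlinarith
  have := (t1.add t2).add t3
  rw [add_zero, ← M.endA_eq FP measurableSet_Ici subset_rfl] at this
  refine this.congr' ?_
  filter_upwards [eventually_ge_atTop 0] with t ht
  rw [uA, M.endA_eq FP measurableSet_Icc fun _ h => h.1, M.disc_eq ht]
  ring

end faker

end SearchModel

/-! ### Signs and bounds of integrals -/

lemma integral_neg_of_ae_neg {f : ℝ → ℝ} {a b : ℝ} (hab : a < b)
    (hf : IntervalIntegrable f volume a b) (h : ∀ᵐ s, s ∈ Ioo a b → f s < 0) :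
    ∫ s in a..b, f s < 0 := by
  have h' : ∀ᵐ s ∂(volume.restrict (Ioc a b)), f s < 0 := by
    rw [← restrict_Ioo_eq_restrict_Ioc]
    exact (ae_restrict_iff' measurableSet_Ioo).2 h
  have := intervalIntegral.integral_lt_integral_of_ae_le_of_measure_setOfPred_lt_ne_zero
    (g := fun _ => (0 : ℝ)) hab.le hf intervalIntegrable_const (h'.mono fun s hs => hs.le) (by
      rw [measure_eq_measure_of_null_sdiff (subset_univ _)]
      · simpa using hab
      · exact measure_mono_null (fun s hs => hs.2) (ae_iff.1 h'))
  simpa using this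

lemma integral_pos_of_ae_pos {f : ℝ → ℝ} {a b : ℝ} (hab : a < b)
    (hf : IntervalIntegrable f volume a b) (h : ∀ᵐ s, s ∈ Ioo a b → 0 < f s) :
    0 < ∫ s in a..b, f s := by
  have := integral_neg_of_ae_neg hab hf.neg (by
    filter_upwards [h] with s hs hab
    simpa using hs hab)
  simpa using this

lemma abs_primitive_le {f : ℝ → ℝ} (hf : IntegrableOn f (Ici 0)) {t : ℝ} (ht : 0 ≤ t) :
    |∫ s in (0 : ℝ)..t, f s| ≤ ∫ s in Ici (0 : ℝ), |f s| := by
  rw [intervalIntegral.integral_of_le ht]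
  refine (abs_integral_le_integral_abs).trans ?_
  exact setIntegral_mono_set hf.abs (Eventually.of_forall fun _ => abs_nonneg _)
    (Eventually.of_forall fun s hs => hs.1.le)

lemma integral_congr_ae_Ioo {f g : ℝ → ℝ} {a b : ℝ} (hab : a ≤ b)
    (h : ∀ᵐ s, s ∈ Ioo a b → f s = g s) : ∫ s in a..b, f s = ∫ s in a..b, g s := by
  rw [intervalIntegral.integral_of_le hab, intervalIntegral.integral_of_le hab,
    integral_Ioc_eq_integral_Ioo, integral_Ioc_eq_integral_Ioo]
  exact setIntegral_congr_ae measurableSet_Ioo h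

/-! ### Regularity and monotonicity of the payoffs -/

namespace SearchModel

variable {M : SearchModel}

lemma disc_eq_exp (a b : ℝ) :
    M.disc b = M.disc a * Real.exp (-∫ s in a..b, (M.ρ + M.haz s)) := by
  have hc : Continuous fun s => M.ρ + M.haz s := continuous_const.add M.haz_continuous
  have key : ∀ a b, a ≤ b → M.disc b = M.disc a * Real.exp (-∫ s in a..b, (M.ρ + M.haz s)) :=
    fun a b h => homogeneous_integral_equation hc (M.disc_continuous.intervalIntegrable _ _) h
      fun t _ => by rw [M.integral_disc]; ring
  rcases le_total a b with h | h
  · exact key a b h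
  · rw [key b a h, mul_assoc, ← Real.exp_add, intervalIntegral.integral_symm a b]
    simp

section continuity

variable {a : ℝ → ℝ} (hm : Measurable a) (ha : ∀ t, a t ∈ Icc (0 : ℝ) 1) (FP : MixedTime)
include hm ha

lemma baseA_continuousOn : ContinuousOn (M.baseA a FP) (Ici 0) :=
  continuousOn_const.add (continuousOn_primitive_Ici (M.integrableOn_flowA hm ha FP))

/-- Continuity is one-sided because the stopping time may have atoms. -/
lemma riskyA_rightCont {t : ℝ} (ht : 0 ≤ t) :
    Tendsto (M.riskyA a FP) (𝓝[>] t) (𝓝 (M.riskyA a FP t)) := by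
  have h1 : Tendsto (M.baseA a FP) (𝓝[>] t) (𝓝 (M.baseA a FP t)) :=
    (M.baseA_continuousOn hm ha FP t ht).mono_left
      (nhdsWithin_mono _ fun s hs => ht.trans (le_of_lt hs))
  have h2 : Tendsto M.disc (𝓝[>] t) (𝓝 (M.disc t)) :=
    M.disc_continuous.continuousAt.mono_left nhdsWithin_le_nhds
  exact h1.add ((h2.mul (tendsto_const_nhds.sub (FP.cdf_rightCont t))).mul tendsto_const_nhds)

lemma uA_aestronglyMeasurable :
    AEStronglyMeasurable (M.uA a FP) (volume.restrict (Ici 0)) := by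
  have h1 := (M.baseA_continuousOn hm ha FP).aestronglyMeasurable measurableSet_Ici (μ := volume)
  have h2 : Measurable fun t => M.disc t * (1 - FP.cdf t) * (M.μ - M.β) * a t :=
    ((M.disc_continuous.measurable.mul (one_sub_cdf_measurable FP)).mul_const _).mul hm
  refine (h1.add h2.aestronglyMeasurable).congr ?_
  exact (ae_restrict_iff' measurableSet_Ici).2 (Eventually.of_forall fun t ht =>
    (M.uA_eq hm ha FP ht).symm)

lemma abs_uA_le : ∃ C, ∀ t, 0 ≤ t → |M.uA a FP t| ≤ C := by
  refine ⟨|M.β| + (∫ s in Ici (0 : ℝ), |M.flowA a FP s|) + 1 * 1 * |M.μ - M.β| * 1,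
    fun t ht => ?_⟩
  rw [M.uA_eq hm ha FP ht, baseA]
  refine (abs_add_le _ _).trans (add_le_add ((abs_add_le _ _).trans (add_le_add le_rfl
    (abs_primitive_le (M.integrableOn_flowA hm ha FP) ht))) ?_)
  rw [abs_mul, abs_mul, abs_mul, abs_of_pos (M.disc_pos t), abs_of_nonneg (ha t).1]
  have := M.disc_le_one ht
  have := abs_one_sub_cdf FP t
  have := (ha t).2
  have := (ha t).1
  gcongr

end continuity

section payoffP

variable {σ : ℝ} (h0 : 0 < σ) (h1 : σ < 1) {FA : MixedTime} {a : ℝ → ℝ}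
  (hr : M.OptimalResponse σ a FA)
include h0 h1 hr

lemma uP_continuousOn : ContinuousOn (M.uP σ a FA) (Ici 0) :=
  (continuousOn_const.add (continuousOn_primitive_Ici (M.integrableOn_flowP h0 h1 FA))).congr
    fun _ ht => M.uP_eq h0 h1 hr ht

lemma uP_sub {s t : ℝ} (hs : 0 ≤ s) (ht : 0 ≤ t) :
    M.uP σ a FA t - M.uP σ a FA s = ∫ x in s..t, M.flowP σ FA x := by
  rw [M.uP_eq h0 h1 hr hs, M.uP_eq h0 h1 hr ht,
    ← primitive_sub (M.integrableOn_flowP h0 h1 FA) hs ht]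
  ring

lemma abs_uP_le : ∃ C, ∀ t, 0 ≤ t → |M.uP σ a FA t| ≤ C := by
  refine ⟨|M.θ| + ∫ s in Ici (0 : ℝ), |M.flowP σ FA s|, fun t ht => ?_⟩
  rw [M.uP_eq h0 h1 hr ht]
  exact (abs_add_le _ _).trans (add_le_add le_rfl
    (abs_primitive_le (M.integrableOn_flowP h0 h1 FA) ht))

-- Fakes only dilute the news, so `gain` is at most its value for a zero faking density.
omit hr in
lemma flowP_le (s : ℝ) : M.flowP σ FA s ≤ M.disc s * (rem σ FA s * M.rateP s) := by
  have hg : M.gain σ FA s ≤ M.μ * (1 - M.θ) * M.haz s * rem σ FA s := by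
    have h2 : 0 ≤ (M.θ - M.μ) * (σ * FA.dens s) :=
      mul_nonneg (by linarith [M.μ_lt_θ]) (mul_nonneg h0.le (FA.dens_nonneg s))
    have h3 : 0 ≤ M.μ * (1 - M.θ) * M.haz s * rem σ FA s :=
      mul_nonneg (mul_nonneg (mul_nonneg M.μ_pos.le (by linarith [M.θ_lt_one]))
        (M.haz_nonneg s)) (rem_pos h0 h1 FA s).le
    exact max_le (by linarith) h3
  unfold flowP rateP
  refine mul_le_mul_of_nonneg_left ?_ (M.disc_pos s).le
  linarith

omit hr in
lemma flowP_neg {τ s : ℝ} (hτ : M.IsThreshold τ) (hs : τ < s) : M.flowP σ FA s < 0 :=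
  (flowP_le h0 h1 s).trans_lt (mul_neg_of_pos_of_neg (M.disc_pos s)
    (mul_neg_of_pos_of_neg (rem_pos h0 h1 FA s) (hτ.rateP_neg hs)))

lemma uP_strictAnti {τ s t : ℝ} (hτ : M.IsThreshold τ) (hs : τ ≤ s) (hst : s < t) :
    M.uP σ a FA t < M.uP σ a FA s := by
  have hs0 := hτ.pos.le.trans hs
  have := integral_neg_of_ae_neg hst (intervalIntegrable_of_Ici
    (M.integrableOn_flowP h0 h1 FA) hs0 (hs0.trans hst.le))
    (Eventually.of_forall fun x hx => flowP_neg h0 h1 hτ (hs.trans_lt hx.1))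
  rw [← uP_sub h0 h1 hr hs0 (hs0.trans hst.le)] at this
  linarith

lemma uPInf_lt {τ : ℝ} (hτ : M.IsThreshold τ) : M.uPInf σ a FA < M.uP σ a FA τ := by
  refine lt_of_le_of_lt (le_of_tendsto (M.tendsto_uP h0 h1 hr) ?_)
    (uP_strictAnti h0 h1 hr hτ le_rfl (lt_add_one τ))
  filter_upwards [eventually_gt_atTop (τ + 1)] with t ht
  exact (uP_strictAnti h0 h1 hr hτ (by linarith) ht).le

/-- A response below one reveals a posterior of at most `θ`. News then has no option value and only
the cost of delay is left. -/
lemma flowP_of_response_lt_one {s : ℝ} (hs : 0 ≤ s) (ha : FA.atom s = 0) (h : a s < 1) :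
    M.flowP σ FA s < 0 := by
  have hb : ¬ M.θ < M.belief σ FA s := fun hb => h.ne ((hr s hs).1 hb)
  rw [M.theta_lt_belief_iff h0 h1 hs ha, not_lt] at hb
  rw [flowP, gain, max_eq_right (by linarith)]
  have := mul_pos (M.disc_pos s) (mul_pos (mul_pos M.ρ_pos M.θ_pos) (rem_pos h0 h1 FA s))
  linarith

lemma flowP_of_response_pos {s : ℝ} (hs : 0 ≤ s) (ha : FA.atom s = 0) (h : 0 < a s) :
    M.flowP σ FA s
      = M.disc s * (rem σ FA s * M.rateP s) - (M.θ - M.μ) * σ * (M.disc s * FA.dens s) := by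
  have hb : ¬ M.belief σ FA s < M.θ := fun hb => h.ne' ((hr s hs).2 hb)
  rw [M.belief_lt_theta_iff h0 h1 hs ha, not_lt] at hb
  rw [flowP, gain, max_eq_left (by linarith), rateP]
  ring

/-- The principal's payoff if she acts on all news and the faking strategy has no atoms. -/
lemma uP_eq_of_response_pos (hat : ∀ s, FA.atom s = 0) (hpos : ∀ᵐ s, 0 ≤ s → 0 < a s) {t : ℝ}
    (ht : 0 ≤ t) :
    M.uP σ a FA t = M.μ + (∫ s in (0 : ℝ)..t, M.rateN s * (M.disc s * rem σ FA s))
      + M.disc t * rem σ FA t * (M.θ - M.μ) := by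
  have i1 := intervalIntegrable_of_Ici (M.integrableOn_rem h0 h1 FA) le_rfl ht
  have i2 := intervalIntegrable_of_Ici (M.integrableOn_disc_mul_dens FA) le_rfl ht
  have i3 : IntervalIntegrable (fun s => M.disc s * (rem σ FA s * M.rateP s)) volume 0 t :=
    (i1.continuousOn_mul (g := M.rateP) M.rateP_continuous.continuousOn).congr fun s _ => by
      ring
  have i4 : IntervalIntegrable (fun s => (M.ρ + M.haz s) * M.disc s * (1 - σ * FA.cdf s))
      volume 0 t :=
    (i1.continuousOn_mul (g := fun s => M.ρ + M.haz s)
      (continuous_const.add M.haz_continuous).continuousOn).congr fun s _ => by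
      simp only [rem]; ring
  have hk := M.discounted_law FA σ ht
  simp only [hat, mul_zero, indicator_zero, tsum_zero, add_zero] at hk
  rw [integral_Icc_eq_integral_Ioc, ← intervalIntegral.integral_of_le ht] at hk
  have e1 : (∫ s in (0 : ℝ)..t, M.flowP σ FA s)
      = (∫ s in (0 : ℝ)..t, M.disc s * (rem σ FA s * M.rateP s))
        - (M.θ - M.μ) * σ * ∫ s in (0 : ℝ)..t, M.disc s * FA.dens s := by
    rw [← intervalIntegral.integral_const_mul,
      ← intervalIntegral.integral_sub i3 (i2.const_mul _)]
    refine integral_congr_ae_Ioo ht ?_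
    filter_upwards [hpos] with s hs hst
    exact flowP_of_response_pos h0 h1 hr hst.1.le (hat s) (hs hst.1.le)
  -- This rests on `rateN = rateP + (θ - μ)(ρ + haz)`.
  have e2 : (∫ s in (0 : ℝ)..t, M.rateN s * (M.disc s * rem σ FA s))
      = (∫ s in (0 : ℝ)..t, M.disc s * (rem σ FA s * M.rateP s))
        + (M.θ - M.μ) * ∫ s in (0 : ℝ)..t, (M.ρ + M.haz s) * M.disc s * (1 - σ * FA.cdf s) := by
    rw [← intervalIntegral.integral_const_mul,
      ← intervalIntegral.integral_add i3 (i4.const_mul _)]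
    refine intervalIntegral.integral_congr fun s _ => ?_
    simp only [rateN, rateP, rem]
    ring
  rw [M.uP_eq h0 h1 hr ht, e1, e2]
  unfold rem
  linear_combination -(M.θ - M.μ) * hk

end payoffP

/-! ### Properties of equilibria -/

/-- The faker's expected payoff. -/
def payoffA (M : SearchModel) (E : Profile) : ℝ :=
  E.FA.expect (M.uA E.a E.FP) (M.uAInf E.a E.FP)

namespace IsEquilibrium

variable {σ : ℝ} {E : Profile} (hE : M.IsEquilibrium σ E)
include hE

lemma uA_le {t : ℝ} (ht : 0 ≤ t) : M.uA E.a E.FP t ≤ M.payoffA E := by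
  have := hE.agent_optimal (MixedTime.pure t ht)
  rwa [MixedTime.pure_expect] at this

lemma uAInf_le : M.uAInf E.a E.FP ≤ M.payoffA E := by
  have := hE.agent_optimal MixedTime.never
  rwa [MixedTime.never_expect] at this

lemma uP_le {t : ℝ} (ht : 0 ≤ t) : M.uP σ E.a E.FA t ≤ M.payoffP σ E := by
  have := hE.stopping_optimal (MixedTime.pure t ht)
  rwa [MixedTime.pure_expect] at this

lemma uPInf_le : M.uPInf σ E.a E.FA ≤ M.payoffP σ E := by
  have := hE.stopping_optimal MixedTime.never
  rwa [MixedTime.never_expect] at this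

lemma faker_support :
    (∀ᵐ t, 0 ≤ t → E.FA.dens t ≠ 0 → M.uA E.a E.FP t = M.payoffA E) ∧
      (∀ t, E.FA.atom t ≠ 0 → M.uA E.a E.FP t = M.payoffA E) ∧
      (E.FA.atInfty ≠ 0 → M.uAInf E.a E.FP = M.payoffA E) := by
  obtain ⟨C, hC⟩ := abs_uA_le (M := M) hE.measurable_a hE.a_mem E.FP
  exact E.FA.eq_of_le_expect (fun _ ht => hE.uA_le ht) hE.uAInf_le le_rfl
    (uA_aestronglyMeasurable hE.measurable_a hE.a_mem E.FP) hC

section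

variable (h0 : 0 < σ) (h1 : σ < 1)
include h0 h1

lemma stopping_support :
    (∀ᵐ t, 0 ≤ t → E.FP.dens t ≠ 0 → M.uP σ E.a E.FA t = M.payoffP σ E) ∧
      (∀ t, E.FP.atom t ≠ 0 → M.uP σ E.a E.FA t = M.payoffP σ E) ∧
      (E.FP.atInfty ≠ 0 → M.uPInf σ E.a E.FA = M.payoffP σ E) := by
  obtain ⟨C, hC⟩ := abs_uP_le h0 h1 hE.response_optimal
  exact E.FP.eq_of_le_expect (fun _ ht => hE.uP_le ht) hE.uPInf_le le_rfl
    ((uP_continuousOn h0 h1 hE.response_optimal).aestronglyMeasurable measurableSet_Ici) hC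

lemma stopping_null {B : Set ℝ} (hB : MeasurableSet B) (hB0 : B ⊆ Ici 0)
    (h : ∀ t ∈ B, M.uP σ E.a E.FA t ≠ M.payoffP σ E) : E.FP.law.real B = 0 := by
  obtain ⟨s1, s2, -⟩ := hE.stopping_support h0 h1
  refine E.FP.law_real_eq_zero hB hB0 ?_ fun t ht => ?_
  · filter_upwards [s1] with t ht htB
    by_contra hd
    exact h t htB (ht (hB0 htB) hd)
  · by_contra hd
    exact h t ht (s2 t hd)

lemma cdf_eq_of_lt {s t : ℝ} (hs : 0 ≤ s) (hst : s ≤ t)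
    (h : ∀ x ∈ Ioc s t, M.uP σ E.a E.FA x < M.payoffP σ E) : E.FP.cdf t = E.FP.cdf s := by
  have := hE.stopping_null h0 h1 measurableSet_Ioc (fun x hx => hs.trans hx.1.le)
    (fun x hx => (h x hx).ne)
  rw [← E.FP.cdf_sub hs hst] at this
  linarith

/-- A response below one requires a posterior of at most `θ`, hence a positive density of faking,
and the faker fakes only at optimal times. -/
lemma ae_uA_eq_of_response_lt_one :
    ∀ᵐ s, 0 ≤ s → E.a s < 1 → M.uA E.a E.FP s = M.payoffA E := by
  filter_upwards [hE.faker_support.1, E.FA.ae_atom_eq_zero] with s hs hat hs0 ha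
  refine hs hs0 fun hd => ha.ne ((hE.response_optimal s hs0).1 ?_)
  exact M.theta_lt_belief_of_dens_eq_zero h0 h1 hs0 hat hd

omit h0 h1 in
lemma uA_eq_riskyA_sub {t : ℝ} (ht : 0 ≤ t) : M.uA E.a E.FP t
    = M.riskyA E.a E.FP t - M.disc t * (1 - E.FP.cdf t) * (M.μ - M.β) * (1 - E.a t) := by
  rw [M.uA_eq hE.measurable_a hE.a_mem E.FP ht, riskyA]; ring

omit hE h0 h1 in
lemma weight_pos {t : ℝ} (h : E.FP.cdf t < 1) :
    0 < M.disc t * (1 - E.FP.cdf t) * (M.μ - M.β) :=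
  mul_pos (mul_pos (M.disc_pos t) (by linarith)) (by linarith [M.β_lt_μ])

/-- The last time of the search. -/
lemma exists_last (hB : M.Beneficial σ E) {τ : ℝ} (hτ : M.IsThreshold τ) :
    ∃ T, 0 < T ∧ T ≤ τ ∧ E.FP.cdf T = 1 ∧ M.uP σ E.a E.FA T = M.payoffP σ E ∧
      ∀ t, t < T → E.FP.cdf t < 1 := by
  have hr := hE.response_optimal
  -- Past `τ` the payoff of stopping falls strictly, so no later time is optimal, and neither is
  -- `∞`.
  have hP1 : E.FP.cdf τ = 1 := by
    have h3 := hE.stopping_null h0 h1 measurableSet_Ioi (B := Ioi τ)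
      (fun x hx => hτ.pos.le.trans (le_of_lt hx))
      (fun x hx => ((uP_strictAnti h0 h1 hr hτ le_rfl hx).trans_le (hE.uP_le hτ.pos.le)).ne)
    rw [← E.FP.one_sub_atInfty_sub_cdf hτ.pos.le] at h3
    have h4 : E.FP.atInfty = 0 := by
      by_contra h
      exact ((uPInf_lt h0 h1 hr hτ).trans_le (hE.uP_le hτ.pos.le)).ne
        ((hE.stopping_support h0 h1).2.2 h)
    linarith
  have hu0 : M.uP σ E.a E.FA 0 < M.payoffP σ E := by
    rw [M.uP_eq h0 h1 hr le_rfl]; simpa [Beneficial] using hB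
  have hP0 : E.FP.cdf 0 = 0 := by
    rw [E.FP.cdf_eq]
    refine hE.stopping_null h0 h1 measurableSet_Icc (fun x hx => hx.1) fun x hx => ?_
    rw [Icc_self, mem_singleton_iff] at hx
    rw [hx]; exact hu0.ne
  set S : Set ℝ := {t | 0 ≤ t ∧ E.FP.cdf t = 1} with hS
  have hSb : BddBelow S := ⟨0, fun t ht => ht.1⟩
  have hSn : S.Nonempty := ⟨τ, hτ.pos.le, hP1⟩
  set T := sInf S with hT
  have hT0 : 0 ≤ T := le_csInf hSn fun t ht => ht.1
  have hPT : E.FP.cdf T = 1 := by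
    refine tendsto_nhds_unique (E.FP.cdf_rightCont T) (tendsto_const_nhds.congr' ?_)
    filter_upwards [self_mem_nhdsWithin] with t ht
    obtain ⟨s, hs, hst⟩ := exists_lt_of_csInf_lt hSn ht
    exact le_antisymm (hs.2 ▸ E.FP.cdf_mono hst.le) (E.FP.cdf_le_one t)
  have hlt : ∀ t, t < T → E.FP.cdf t < 1 := by
    intro t ht
    refine lt_of_le_of_ne (E.FP.cdf_le_one t) fun h => ?_
    rcases lt_or_ge t 0 with h' | h'
    · have := E.FP.cdf_mono h'.le
      rw [hP0, h] at this; linarith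
    · exact (csInf_le hSb (show t ∈ S from ⟨h', h⟩)).not_gt ht
  have hTpos : 0 < T := lt_of_le_of_ne hT0 fun h => by
    rw [← h, hP0] at hPT; exact zero_ne_one hPT
  refine ⟨T, hTpos, csInf_le hSb ⟨hτ.pos.le, hP1⟩, hPT, ?_, hlt⟩
  -- If `T` were not optimal, then by continuity neither would be the times just before it, and the
  -- cdf would have reached one earlier.
  by_contra hne
  have hltV := lt_of_le_of_ne (hE.uP_le hT0) hne
  have hev := (uP_continuousOn h0 h1 hr T hT0).eventually (gt_mem_nhds hltV)
  obtain ⟨δ, hδ, hball⟩ := Metric.mem_nhdsWithin_iff.1 hev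
  have hl0 : 0 ≤ max 0 (T - δ / 2) := le_max_left _ _
  have hlT : max 0 (T - δ / 2) < T := max_lt hTpos (by linarith)
  have := hE.cdf_eq_of_lt h0 h1 hl0 hlT.le fun x hx => hball ⟨by
    rw [Metric.mem_ball, Real.dist_eq, abs_lt]
    constructor <;> linarith [hx.1, hx.2, le_max_right 0 (T - δ / 2)], hl0.trans hx.1.le⟩
  exact (hlt _ hlT).ne (by rw [← this, hPT])

/-- Before the search ends, fake news that is acted on cannot be worth more than the faker's
payoff. -/
lemma riskyA_le {τ T : ℝ} (hτ : M.IsThreshold τ) (hTτ : T ≤ τ) (hPT : E.FP.cdf T = 1)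
    (hlt : ∀ t, t < T → E.FP.cdf t < 1) {t0 : ℝ} (ht0 : 0 ≤ t0) (ht0T : t0 < T) :
    M.riskyA E.a E.FP t0 ≤ M.payoffA E := by
  by_contra hcon
  rw [not_le] at hcon
  have hr := hE.response_optimal
  have hm := hE.measurable_a
  have ha := hE.a_mem
  -- `t1` will be the end of the longest interval from `t0` on which acted-on fakes beat the faker's
  -- payoff; the contradiction is that it can be extended.
  set K : Set ℝ := {t | t ∈ Icc t0 T ∧ ∀ s ∈ Ico t0 t, M.payoffA E < M.riskyA E.a E.FP s} with hK
  have hK0 : t0 ∈ K := ⟨⟨le_rfl, ht0T.le⟩, fun s hs => (hs.2.not_ge hs.1).elim⟩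
  have hKb : BddAbove K := ⟨T, fun t ht => ht.1.2⟩
  set t1 := sSup K with ht1
  have h01 : t0 ≤ t1 := le_csSup hKb hK0
  have h1T : t1 ≤ T := csSup_le ⟨t0, hK0⟩ fun t ht => ht.1.2
  have hR : ∀ s ∈ Ico t0 t1, M.payoffA E < M.riskyA E.a E.FP s := by
    intro s hs
    obtain ⟨t, ht, hst⟩ := exists_lt_of_lt_csSup ⟨t0, hK0⟩ hs.2
    exact ht.2 s ⟨hs.1, hst⟩
  have hlt1 : ∀ s ∈ Ico t0 t1, E.a s < 1 := by
    intro s hs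
    have h3 := hE.uA_le (ht0.trans hs.1)
    rw [hE.uA_eq_riskyA_sub (ht0.trans hs.1)] at h3
    have h4 := hR s hs
    have h5 := weight_pos (M := M) (hlt s (hs.2.trans_le h1T))
    by_contra h6
    have h7 : E.a s = 1 := le_antisymm (ha s).2 (not_lt.1 h6)
    rw [h7] at h3
    linarith
  have hdec : ∀ x ∈ Ioc t0 t1, M.uP σ E.a E.FA x < M.payoffP σ E := by
    intro x hx
    have hx0 := ht0.trans hx.1.le
    have := integral_neg_of_ae_neg hx.1
      (intervalIntegrable_of_Ici (M.integrableOn_flowP h0 h1 E.FA) ht0 hx0) (by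
        filter_upwards [E.FA.ae_atom_eq_zero] with s hs hsI
        exact flowP_of_response_lt_one h0 h1 hr (ht0.trans hsI.1.le) hs
          (hlt1 s ⟨hsI.1.le, hsI.2.trans_le hx.2⟩))
    rw [← uP_sub h0 h1 hr ht0 hx0] at this
    linarith [hE.uP_le ht0]
  have hPc : ∀ t ∈ Icc t0 t1, E.FP.cdf t = E.FP.cdf t0 := fun t ht =>
    hE.cdf_eq_of_lt h0 h1 ht0 ht.1 fun x hx => hdec x ⟨hx.1, hx.2.trans ht.2⟩
  have hp : E.FP.cdf t0 < 1 := hlt t0 ht0T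
  have h1T' : t1 < T := lt_of_le_of_ne h1T fun h => by
    have := hPc t1 ⟨h01, le_rfl⟩
    rw [h, hPT] at this; linarith
  set p := E.FP.cdf t0 with hpdef
  -- On `[t0, t1)` the faker is indifferent at almost all times, so `W` is the premium `disc (1 -
  -- p)(μ - β)` times `1 - a`. Eliminating `a` from `flowA` gives a linear equation for `W` with
  -- source `(1 - p) disc rateA > 0`, so `W` stays positive up to and including `t1`.
  set W : ℝ → ℝ := fun t => M.baseA E.a E.FP t + M.disc t * (1 - p) * (M.μ - M.β) - M.payoffA E
    with hW
  have hWR : ∀ t ∈ Icc t0 t1, W t = M.riskyA E.a E.FP t - M.payoffA E := by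
    intro t ht
    simp only [hW, riskyA, hPc t ht]
  have hδ : 0 < M.μ - M.β := by linarith [M.β_lt_μ]
  have hWc : ContinuousOn W (Ici 0) :=
    ((baseA_continuousOn hm ha E.FP).add
      ((M.disc_continuous.mul_const _).mul_const _).continuousOn).sub continuousOn_const
  have hWi : ∀ t, t0 ≤ t → IntervalIntegrable W volume t0 t := fun t ht =>
    (hWc.mono (by rw [uIcc_of_le ht]; exact fun x hx => ht0.trans hx.1)).intervalIntegrable
  have hmc : Continuous fun s => M.μ * (1 - M.β) * M.haz s / (M.μ - M.β) :=
    (continuous_const.mul M.haz_continuous).div_const _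
  have hkc : Continuous fun s => (1 - p) * M.disc s * M.rateA s :=
    (continuous_const.mul M.disc_continuous).mul M.rateA_continuous
  have heq := linear_integral_equation hmc hkc (hWi t1 h01) h01 (by
    intro t ht
    have hi := intervalIntegrable_of_Ici (M.integrableOn_flowA hm ha E.FP) ht0 (ht0.trans ht.1)
    have hdi : IntervalIntegrable (fun s => (M.ρ + M.haz s) * M.disc s) volume t0 t :=
      ((continuous_const.add M.haz_continuous).mul M.disc_continuous).intervalIntegrable _ _
    have e1 : W t - W t0 = (∫ s in t0..t, M.flowA E.a E.FP s)
        - (1 - p) * (M.μ - M.β) * ∫ s in t0..t, (M.ρ + M.haz s) * M.disc s := by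
      rw [M.integral_disc, ← primitive_sub (M.integrableOn_flowA hm ha E.FP) ht0
        (ht0.trans ht.1)]
      simp only [hW, baseA]; ring
    have e2 : (∫ s in t0..t, M.flowA E.a E.FP s)
        - (1 - p) * (M.μ - M.β) * (∫ s in t0..t, (M.ρ + M.haz s) * M.disc s)
        = ∫ s in t0..t, ((1 - p) * M.disc s * M.rateA s
          - M.μ * (1 - M.β) * M.haz s / (M.μ - M.β) * W s) := by
      rw [← intervalIntegral.integral_const_mul, ← intervalIntegral.integral_sub hi
        (hdi.const_mul _)]
      refine integral_congr_ae_Ioo ht.1 ?_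
      filter_upwards [hE.ae_uA_eq_of_response_lt_one h0 h1] with s hs hsI
      have hs0 := ht0.trans hsI.1.le
      have hs1 : s ∈ Ico t0 t1 := ⟨hsI.1.le, hsI.2.trans_le ht.2⟩
      have h3 := hs hs0 (hlt1 s hs1)
      rw [hE.uA_eq_riskyA_sub hs0] at h3
      have h4 := hWR s ⟨hs1.1, hs1.2.le⟩
      rw [hPc s ⟨hs1.1, hs1.2.le⟩] at h3
      have h5 : W s = M.disc s * (1 - p) * (M.μ - M.β) * (1 - E.a s) := by linarith
      rw [flowA, hPc s ⟨hs1.1, hs1.2.le⟩, h5, rateA]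
      field_simp
      ring
    linarith)
  have hW0 : 0 < W t0 := by rw [hWR t0 ⟨le_rfl, h01⟩]; linarith
  have hint : 0 ≤ ∫ s in t0..t1, (1 - p) * M.disc s * M.rateA s
      * Real.exp (∫ x in t0..s, M.μ * (1 - M.β) * M.haz x / (M.μ - M.β)) := by
    refine intervalIntegral.integral_nonneg h01 fun s hs => ?_
    have := hτ.rateA_pos (ht0.trans hs.1) (hs.2.trans (h1T.trans hTτ))
    have := M.disc_pos s
    have : 0 ≤ 1 - p := by linarith
    positivity
  have hW1 : 0 < W t1 := by
    have h3 : 0 < W t1 * Real.exp (∫ x in t0..t1, M.μ * (1 - M.β) * M.haz x / (M.μ - M.β)) := by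
      linarith
    exact (mul_pos_iff_of_pos_right (Real.exp_pos _)).1 h3
  rw [hWR t1 ⟨h01, le_rfl⟩, sub_pos] at hW1
  -- Right continuity carries the strict inequality beyond `t1`.
  have hev := (riskyA_rightCont hm ha E.FP (ht0.trans h01)).eventually (lt_mem_nhds hW1)
  obtain ⟨u, hu, huI⟩ := (mem_nhdsGT_iff_exists_Ioo_subset' (h1T')).1 hev
  have hmem : min u T ∈ K := by
    refine ⟨⟨h01.trans (le_min (le_of_lt hu) h1T), min_le_right _ _⟩, fun s hs => ?_⟩
    rcases lt_trichotomy s t1 with h | h | h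
    · exact hR s ⟨hs.1, h⟩
    · rw [h]; exact hW1
    · exact huI ⟨h, hs.2.trans_le (min_le_left _ _)⟩
  exact (le_csSup hKb hmem).not_gt (lt_min hu h1T')

end

end IsEquilibrium

end SearchModel

/-! ### Structure of equilibria with beneficial search -/

namespace SearchModel

variable {M : SearchModel}

/-- The faking rate that keeps the principal indifferent. -/
def fakeRate (M : SearchModel) (t : ℝ) : ℝ := M.rateP t / (M.θ - M.μ)

/-- The stopping rate that keeps the faker indifferent. -/
def stopRate (M : SearchModel) (t : ℝ) : ℝ := M.rateA t / (M.μ - M.β)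

lemma fakeRate_continuous : Continuous M.fakeRate := M.rateP_continuous.div_const _

lemma stopRate_continuous : Continuous M.stopRate := M.rateA_continuous.div_const _

/-- The solution of a discounted indifference condition. -/
lemma eq_exp_of_integral_equation {q n f : ℝ → ℝ} {l r : ℝ} (hlr : l ≤ r)
    (hn : Continuous n) (hf : ∀ s, f s = n s - (M.ρ + M.haz s))
    (hq : IntervalIntegrable q volume l r) (hq1 : q l = 1)
    (h : ∀ t ∈ Icc l r, M.disc t * q t = M.disc l * q l - ∫ s in l..t, n s * (M.disc s * q s)) :
    q r = Real.exp (-∫ s in l..r, f s) := by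
  have key := homogeneous_integral_equation (R := fun s => M.disc s * q s) hn
    (hq.continuousOn_mul M.disc_continuous.continuousOn) hlr h
  simp only [hq1, mul_one] at key
  rw [disc_eq_exp l r, mul_assoc] at key
  have key2 := mul_left_cancel₀ (M.disc_pos l).ne' key
  have hc : Continuous fun s => M.ρ + M.haz s := continuous_const.add M.haz_continuous
  have : (∫ s in l..r, f s) = (∫ s in l..r, n s) - ∫ s in l..r, (M.ρ + M.haz s) := by
    rw [← intervalIntegral.integral_sub (hn.intervalIntegrable _ _) (hc.intervalIntegrable _ _)]
    exact intervalIntegral.integral_congr fun s _ => hf s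
  rw [this, neg_sub, sub_eq_add_neg, Real.exp_add, ← key2, ← mul_assoc, ← Real.exp_add]
  simp

namespace IsThreshold

variable {τ : ℝ} (hτ : M.IsThreshold τ)
include hτ

lemma fakeRate_pos {t : ℝ} (h0 : 0 ≤ t) (ht : t < τ) : 0 < M.fakeRate t :=
  div_pos (hτ.rateP_pos h0 ht) (by linarith [M.μ_lt_θ])

lemma stopRate_pos {t : ℝ} (h0 : 0 ≤ t) (ht : t ≤ τ) : 0 < M.stopRate t :=
  div_pos (hτ.rateA_pos h0 ht) (by linarith [M.β_lt_μ])

lemma integral_fakeRate_pos {s t : ℝ} (h0 : 0 ≤ s) (hst : s < t) (ht : t ≤ τ) :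
    0 < ∫ x in s..t, M.fakeRate x :=
  integral_pos_of_ae_pos hst (fakeRate_continuous.intervalIntegrable _ _)
    (Eventually.of_forall fun _ hx =>
      hτ.fakeRate_pos (h0.trans hx.1.le) (hx.2.trans_le ht))

lemma one_sub_sigmaBar : 1 - M.sigmaBar τ = Real.exp (-∫ s in (0 : ℝ)..τ, M.fakeRate s) := by
  have : (∫ s in (0 : ℝ)..τ, (M.μ * (1 - M.θ) * M.H s - M.ρ * M.θ) / (M.θ - M.μ))
      = ∫ s in (0 : ℝ)..τ, M.fakeRate s := by
    refine intervalIntegral.integral_congr fun s hs => ?_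
    rw [uIcc_of_le hτ.pos.le] at hs
    simp only [fakeRate, rateP, M.H_eq hs.1]
  rw [sigmaBar, this]; ring

lemma sigmaBar_pos : 0 < M.sigmaBar τ := by
  have h1 := hτ.one_sub_sigmaBar
  have h2 : Real.exp (-∫ s in (0 : ℝ)..τ, M.fakeRate s) < 1 := by
    rw [Real.exp_lt_one_iff]
    linarith [hτ.integral_fakeRate_pos le_rfl hτ.pos le_rfl]
  linarith

lemma sigmaBar_lt_one : M.sigmaBar τ < 1 := by
  have h1 := hτ.one_sub_sigmaBar
  have h2 := Real.exp_pos (-∫ s in (0 : ℝ)..τ, M.fakeRate s)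
  linarith

end IsThreshold

/-- As long as the principal does not stop and acts on news, delaying a fake changes its value at a
rate proportional to `rateA`, which is positive up to `τ`. -/
lemma riskyA_lt_riskyA {a : ℝ → ℝ} (hm : Measurable a)
    (ha : ∀ t, a t ∈ Icc (0 : ℝ) 1) {FP : MixedTime} {τ s t : ℝ} (hτ : M.IsThreshold τ)
    (hs : 0 ≤ s) (hst : s < t) (ht : t ≤ τ) (hact : ∀ᵐ x, 0 ≤ x → a x = 1)
    (hP : ∀ x ∈ Icc s t, FP.cdf x = FP.cdf s) (hp : FP.cdf s < 1) :
    M.riskyA a FP s < M.riskyA a FP t := by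
  have hi := M.integrableOn_flowA hm ha FP
  have hdi : IntervalIntegrable (fun s => (M.ρ + M.haz s) * M.disc s) volume s t :=
    ((continuous_const.add M.haz_continuous).mul M.disc_continuous).intervalIntegrable _ _
  have e1 : M.riskyA a FP t - M.riskyA a FP s = (∫ x in s..t, M.flowA a FP x)
      - (1 - FP.cdf s) * (M.μ - M.β) * ∫ x in s..t, (M.ρ + M.haz x) * M.disc x := by
    rw [M.integral_disc, ← primitive_sub hi hs (hs.trans hst.le), riskyA, riskyA, baseA, baseA,
      hP t ⟨hst.le, le_rfl⟩]
    ring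
  have e2 : (∫ x in s..t, M.flowA a FP x)
      - (1 - FP.cdf s) * (M.μ - M.β) * (∫ x in s..t, (M.ρ + M.haz x) * M.disc x)
      = ∫ x in s..t, (1 - FP.cdf s) * (M.disc x * M.rateA x) := by
    rw [← intervalIntegral.integral_const_mul, ← intervalIntegral.integral_sub
      (intervalIntegrable_of_Ici hi hs (hs.trans hst.le)) (hdi.const_mul _)]
    refine integral_congr_ae_Ioo hst.le ?_
    filter_upwards [hact] with x hx hxI
    rw [flowA, hx (hs.trans hxI.1.le), hP x ⟨hxI.1.le, hxI.2.le⟩, rateA]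
    ring
  have e3 : 0 < ∫ x in s..t, (1 - FP.cdf s) * (M.disc x * M.rateA x) := by
    refine integral_pos_of_ae_pos hst ((continuous_const.mul
      (M.disc_continuous.mul M.rateA_continuous)).intervalIntegrable _ _)
      (Eventually.of_forall fun x hx => ?_)
    have := hτ.rateA_pos (hs.trans hx.1.le) (hx.2.le.trans ht)
    have := M.disc_pos x
    have : 0 < 1 - FP.cdf s := by linarith
    positivity
  linarith

namespace IsEquilibrium

variable {σ : ℝ} {E : Profile}

/-- The consequences of beneficial search for actions and for the ends of the supports. -/
structure IsRegular (M : SearchModel) (σ : ℝ) (E : Profile) (τ : ℝ) : Prop where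
  stop_eq_one : E.FP.cdf τ = 1
  stop_lt_one : ∀ t, t < τ → E.FP.cdf t < 1
  uP_eq : M.uP σ E.a E.FA τ = M.payoffP σ E
  riskyA_le : ∀ t, 0 ≤ t → t < τ → M.riskyA E.a E.FP t ≤ M.payoffA E
  atom_eq_zero : ∀ t, E.FA.atom t = 0
  fake_eq_one : E.FA.cdf τ = 1
  act : ∀ᵐ t, 0 ≤ t → E.a t = 1

section

variable (hE : M.IsEquilibrium σ E) (h0 : 0 < σ) (h1 : σ < 1) {τ : ℝ} (hτ : M.IsThreshold τ)
include hE h0 h1 hτ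

lemma isRegular (hB : M.Beneficial σ E) : IsRegular M σ E τ := by
  obtain ⟨T, hT0, hTτ, hPT, huT, hlt⟩ := hE.exists_last h0 h1 hB hτ
  have hr := hE.response_optimal
  have hm := hE.measurable_a
  have ha := hE.a_mem
  have hi := M.integrableOn_flowA hm ha E.FP
  have hR : ∀ t, 0 ≤ t → t < T → M.riskyA E.a E.FP t ≤ M.payoffA E := fun t ht htT =>
    hE.riskyA_le h0 h1 hτ hTτ hPT hlt ht htT
  have hone : ∀ t, 0 ≤ t → t < T → M.uA E.a E.FP t = M.payoffA E → E.a t = 1 := by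
    intro t ht htT h
    rw [hE.uA_eq_riskyA_sub ht] at h
    have h3 := hR t ht htT
    have h4 := weight_pos (M := M) (hlt t htT)
    by_contra h5
    have h6 : E.a t < 1 := lt_of_le_of_ne (ha t).2 h5
    nlinarith [mul_pos h4 (sub_pos.2 h6)]
  have hact : ∀ᵐ t, 0 ≤ t → t < T → E.a t = 1 := by
    filter_upwards [hE.ae_uA_eq_of_response_lt_one h0 h1] with t ht h0t htT
    by_contra h5
    exact h5 (hone t h0t htT (ht h0t (lt_of_le_of_ne (ha t).2 h5)))
  have hPge : ∀ t, T ≤ t → E.FP.cdf t = 1 := fun t ht =>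
    le_antisymm (E.FP.cdf_le_one t) (hPT ▸ E.FP.cdf_mono ht)
  have hbase : ∀ t, T ≤ t → M.uA E.a E.FP t = M.baseA E.a E.FP T := by
    intro t ht
    have ht0 := hT0.le.trans ht
    rw [M.uA_eq hm ha E.FP ht0, hPge t ht]
    have : (∫ s in T..t, M.flowA E.a E.FP s) = 0 := by
      rw [intervalIntegral.integral_congr (g := fun _ => 0)]
      · simp
      · intro s hs
        rw [uIcc_of_le ht] at hs
        simp [flowA, hPge s hs.1]
    rw [← primitive_sub hi hT0.le ht0] at this
    unfold baseA
    linarith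
  have hInf : M.uAInf E.a E.FP = M.baseA E.a E.FP T := by
    refine tendsto_nhds_unique (M.tendsto_uA hm ha E.FP) (tendsto_const_nhds.congr' ?_)
    filter_upwards [eventually_ge_atTop T] with t ht
    exact (hbase t ht).symm
  -- Just before `T`, an acted-on fake earns a premium proportional to `1 - F_P t`. Waiting until
  -- `T` instead gains at most `C (T - t)` times the same factor, so for `t` close to `T` waiting is
  -- worse.
  have hstrict : M.baseA E.a E.FP T < M.payoffA E := by
    by_contra hcon
    rw [not_lt] at hcon
    set C := M.μ * (1 - M.β) * M.haz 0 with hC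
    have hCpos : 0 < C := mul_pos (mul_pos M.μ_pos (by linarith [M.β_lt_one]))
      (M.haz_pos le_rfl)
    have hδ : 0 < M.μ - M.β := by linarith [M.β_lt_μ]
    have hbd : ∀ t, 0 ≤ t → t < T → M.disc T * (M.μ - M.β) ≤ C * (T - t) := by
      intro t ht htT
      have h3 := hR t ht htT
      have hq : 0 < 1 - E.FP.cdf t := by linarith [hlt t htT]
      have h4 : M.baseA E.a E.FP T - M.baseA E.a E.FP t ≤ (1 - E.FP.cdf t) * C * (T - t) := by
        have : M.baseA E.a E.FP T - M.baseA E.a E.FP t = ∫ s in t..T, M.flowA E.a E.FP s := by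
          rw [← primitive_sub hi ht hT0.le, baseA, baseA]; ring
        rw [this]
        have h5 : (∫ s in t..T, M.flowA E.a E.FP s) ≤ ∫ s in t..T, (1 - E.FP.cdf t) * C := by
          refine intervalIntegral.integral_mono_on htT.le
            (intervalIntegrable_of_Ici hi ht hT0.le) intervalIntegrable_const fun s hs => ?_
          have hs0 := ht.trans hs.1
          have k1 : M.disc s * (1 - E.FP.cdf s) ≤ 1 - E.FP.cdf t := by
            have := M.disc_le_one hs0
            have := M.disc_pos s
            have := E.FP.cdf_mono hs.1
            have := E.FP.cdf_le_one s
            nlinarith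
          have k2 : M.μ * (1 - M.β) * M.haz s * E.a s - M.ρ * M.β ≤ C := by
            have k3 : 0 ≤ M.μ * (1 - M.β) :=
              (mul_pos M.μ_pos (by linarith [M.β_lt_one])).le
            have k4 : M.μ * (1 - M.β) * M.haz s * E.a s ≤ C :=
              (mul_le_of_le_one_right (mul_nonneg k3 (M.haz_nonneg s)) (ha s).2).trans
                (mul_le_mul_of_nonneg_left (M.haz_le hs0) k3)
            have := mul_pos M.ρ_pos M.β_pos
            linarith
          have k5 : 0 ≤ M.disc s * (1 - E.FP.cdf s) :=
            mul_nonneg (M.disc_pos s).le (by linarith [E.FP.cdf_le_one s])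
          exact (mul_le_mul_of_nonneg_left k2 k5).trans
            (mul_le_mul_of_nonneg_right k1 hCpos.le)
        rw [intervalIntegral.integral_const, smul_eq_mul] at h5
        linarith
      have h6 : M.disc T ≤ M.disc t := M.disc_strictAnti.antitone htT.le
      rw [riskyA] at h3
      have h7 : M.disc t * (M.μ - M.β) * (1 - E.FP.cdf t) ≤ C * (T - t) * (1 - E.FP.cdf t) := by
        linarith
      exact (mul_le_mul_of_nonneg_right h6 hδ.le).trans (le_of_mul_le_mul_right h7 hq)
    have hpos : 0 < M.disc T * (M.μ - M.β) := mul_pos (M.disc_pos T) hδ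
    -- The first bound keeps `T - ε` nonnegative; the second makes `C ε` at most half of the
    -- premium.
    set ε := min T (M.disc T * (M.μ - M.β) / (2 * C)) with hε
    have hεpos : 0 < ε := lt_min hT0 (by positivity)
    have h8 := hbd (T - ε) (by linarith [min_le_left T (M.disc T * (M.μ - M.β) / (2 * C))])
      (by linarith)
    have h9 : ε * (2 * C) ≤ M.disc T * (M.μ - M.β) :=
      (le_div_iff₀ (by positivity)).1 (min_le_right _ _)
    nlinarith
  obtain ⟨s1, s2, s3⟩ := hE.faker_support
  have hatom : ∀ t, E.FA.atom t = 0 := by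
    intro t
    by_contra h
    have ht0 := E.FA.nonneg_of_atom_ne h
    rcases lt_or_ge t T with htT | htT
    · have := hone t ht0 htT (s2 t h)
      rw [M.response_of_atom hr ht0 h] at this
      exact zero_ne_one this
    · have := s2 t h
      rw [hbase t htT] at this
      exact hstrict.ne this
  have hdens : ∀ᵐ t, T ≤ t → E.FA.dens t = 0 := by
    filter_upwards [s1] with t ht htT
    by_contra h
    have := ht (hT0.le.trans htT) h
    rw [hbase t htT] at this
    exact hstrict.ne this
  have hFAT : E.FA.cdf T = 1 := by
    have h3 : E.FA.law.real (Ioi T) = 0 :=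
      E.FA.law_real_eq_zero measurableSet_Ioi (fun x hx => hT0.le.trans (le_of_lt hx))
        (hdens.mono fun t ht h => ht (le_of_lt h)) fun t _ => hatom t
    rw [← E.FA.one_sub_atInfty_sub_cdf hT0.le] at h3
    have h4 : E.FA.atInfty = 0 := by
      by_contra h
      have := s3 h
      rw [hInf] at this
      exact hstrict.ne this
    linarith
  have hact' : ∀ᵐ t, 0 ≤ t → E.a t = 1 := by
    filter_upwards [hact, hdens] with t h3 h4 ht
    rcases lt_or_ge t T with h | h
    · exact h3 ht h
    · exact (hr t ht).1 (M.theta_lt_belief_of_dens_eq_zero h0 h1 ht (hatom t) (h4 h))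
  -- No one fakes after `T`, so if `T < τ` the flow on `(T, τ)` would be positive and stopping at
  -- `τ` would beat the optimal time `T`.
  have hTeq : T = τ := by
    by_contra hne
    have hTlt : T < τ := lt_of_le_of_ne hTτ hne
    have h3 := integral_pos_of_ae_pos hTlt (intervalIntegrable_of_Ici
      (M.integrableOn_flowP h0 h1 E.FA) hT0.le hτ.pos.le) (by
        filter_upwards [hact', hdens] with t h3 h4 ht
        have ht0 := hT0.le.trans ht.1.le
        rw [flowP_of_response_pos h0 h1 hr ht0 (hatom t) (by rw [h3 ht0]; exact one_pos),
          h4 ht.1.le, mul_zero, mul_zero, sub_zero]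
        exact mul_pos (M.disc_pos t) (mul_pos (rem_pos h0 h1 E.FA t)
          (hτ.rateP_pos ht0 ht.2)))
    rw [← uP_sub h0 h1 hr hT0.le hτ.pos.le, huT] at h3
    linarith [hE.uP_le hτ.pos.le]
  subst hTeq
  exact ⟨hPT, hlt, huT, hR, hatom, hFAT, hact'⟩

omit h0 h1 hτ in
lemma ae_riskyA_eq (hreg : IsRegular M σ E τ) :
    ∀ᵐ t, 0 ≤ t → E.FA.dens t ≠ 0 → M.riskyA E.a E.FP t = M.payoffA E := by
  filter_upwards [hE.faker_support.1, hreg.act] with t h3 h4 ht hd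
  rw [← h3 ht hd, hE.uA_eq_riskyA_sub ht, h4 ht]
  ring

/-- While the principal strictly prefers to continue, the faker does not fake and the principal's
payoff of stopping grows. -/
lemma gap (hreg : IsRegular M σ E τ) {l r : ℝ} (hl : 0 ≤ l) (hlr : l < r) (hr' : r ≤ τ)
    (hgap : ∀ x ∈ Ioo l r, M.uP σ E.a E.FA x < M.payoffP σ E) :
    (∀ᵐ s, s ∈ Ioo l r → E.FA.dens s = 0) ∧ M.uP σ E.a E.FA l < M.uP σ E.a E.FA r := by
  have hd : ∀ᵐ s, s ∈ Ioo l r → E.FA.dens s = 0 := by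
    filter_upwards [hE.ae_riskyA_eq hreg] with s hs hsI
    by_contra h
    have hs0 := hl.trans hsI.1.le
    have h3 := hs hs0 h
    -- Faking at `s` would be optimal, but an acted-on fake at a later `t` in the gap is worth
    -- strictly more.
    obtain ⟨t, hst, htr⟩ := exists_between hsI.2
    have h4 := riskyA_lt_riskyA hE.measurable_a hE.a_mem hτ hs0 hst (htr.le.trans hr') hreg.act
      (fun x hx => hE.cdf_eq_of_lt h0 h1 hs0 hx.1 fun y hy =>
        hgap y ⟨hsI.1.trans hy.1, (hy.2.trans hx.2).trans_lt htr⟩)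
      (hreg.stop_lt_one s (hsI.2.trans_le hr'))
    linarith [hreg.riskyA_le t (hs0.trans hst.le) (htr.trans_le hr')]
  refine ⟨hd, ?_⟩
  have h3 := integral_pos_of_ae_pos hlr (intervalIntegrable_of_Ici
    (M.integrableOn_flowP h0 h1 E.FA) hl (hl.trans hlr.le)) (by
      filter_upwards [hreg.act, hd] with t h3 h4 ht
      have ht0 := hl.trans ht.1.le
      rw [flowP_of_response_pos h0 h1 hE.response_optimal ht0 (hreg.atom_eq_zero t)
        (by rw [h3 ht0]; exact one_pos), h4 ht, mul_zero, mul_zero, sub_zero]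
      exact mul_pos (M.disc_pos t) (mul_pos (rem_pos h0 h1 E.FA t)
        (hτ.rateP_pos ht0 (ht.2.trans_le hr'))))
  rw [← uP_sub h0 h1 hE.response_optimal hl (hl.trans hlr.le)] at h3
  linarith

/-- In an equilibrium with beneficial search the first part of the search is without faking, and
then both sides mix until the end. -/
theorem beneficial_structure (hB : M.Beneficial σ E) :
    ∃ l, 0 < l ∧ l < τ ∧ 1 - σ = Real.exp (-∫ s in l..τ, M.fakeRate s) ∧
      (∀ t ∈ Icc 0 l, E.FA.cdf t = 0) ∧
      (∀ t ∈ Icc l τ, 1 - σ * E.FA.cdf t = Real.exp (-∫ s in l..t, M.fakeRate s)) ∧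
      (∀ t, τ ≤ t → E.FA.cdf t = 1) ∧
      (∀ t ∈ Icc 0 l, E.FP.cdf t = 0) ∧
      (∀ t ∈ Ico l τ, 1 - E.FP.cdf t = Real.exp (-∫ s in l..t, M.stopRate s)) ∧
      (∀ t, τ ≤ t → E.FP.cdf t = 1) ∧
      (∀ᵐ t, 0 ≤ t → E.a t = 1) ∧
      M.payoffP σ E = M.μ + (∫ s in (0 : ℝ)..τ, M.rateN s * (M.disc s * rem σ E.FA s))
        + M.disc τ * (1 - σ) * (M.θ - M.μ) := by
  have hreg := hE.isRegular h0 h1 hτ hB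
  have hr := hE.response_optimal
  have hm := hE.measurable_a
  have ha := hE.a_mem
  have hpos : ∀ᵐ t, 0 ≤ t → 0 < E.a t := hreg.act.mono fun t h ht => by rw [h ht]; exact one_pos
  have hu := fun {t : ℝ} (ht : 0 ≤ t) =>
    uP_eq_of_response_pos h0 h1 hr hreg.atom_eq_zero hpos ht
  have huc := uP_continuousOn h0 h1 hr
  have hi := M.integrableOn_flowA hm ha E.FP
  set V := M.payoffP σ E with hV
  set S : Set ℝ := {t | t ∈ Icc 0 τ ∧ M.uP σ E.a E.FA t = V} with hS
  have hSc : IsCompact S := by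
    have h3 : S = Icc 0 τ ∩ M.uP σ E.a E.FA ⁻¹' {V} := by ext; simp [hS]
    rw [h3]
    exact isCompact_Icc.of_isClosed_subset ((huc.mono fun _ h => h.1).preimage_isClosed_of_isClosed
      isClosed_Icc isClosed_singleton) inter_subset_left
  have hSn : S.Nonempty := ⟨τ, ⟨hτ.pos.le, le_rfl⟩, hreg.uP_eq⟩
  set l := sInf S with hl
  have hlS : l ∈ S := hSc.sInf_mem hSn
  have hltV : ∀ t, 0 ≤ t → t < l → M.uP σ E.a E.FA t < V := by
    intro t ht htl
    refine lt_of_le_of_ne (hE.uP_le ht) fun h => ?_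
    exact (csInf_le hSc.bddBelow ⟨⟨ht, htl.le.trans hlS.1.2⟩, h⟩).not_gt htl
  have hl0 : 0 < l := by
    refine lt_of_le_of_ne hlS.1.1 fun h => ?_
    have h3 := hlS.2
    rw [← h, M.uP_eq h0 h1 hr le_rfl, intervalIntegral.integral_same, add_zero] at h3
    exact hB.ne h3
  -- Otherwise take the last optimal time before `t1`. By `gap` the payoff would grow on the
  -- interval that follows it, and so exceed its maximum `V`.
  have hcond : ∀ t ∈ Icc l τ, M.uP σ E.a E.FA t = V := by
    intro t1 ht1
    by_contra hne
    have ht10 := hl0.le.trans ht1.1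
    have hlt := lt_of_le_of_ne (hE.uP_le ht10) hne
    set S' : Set ℝ := S ∩ Icc l t1 with hS'
    have hSc' : IsCompact S' := hSc.inter_right isClosed_Icc
    have hSn' : S'.Nonempty := ⟨l, hlS, le_rfl, ht1.1⟩
    have hmem : sSup S' ∈ S' := hSc'.sSup_mem hSn'
    have hlt1 : sSup S' < t1 := lt_of_le_of_ne hmem.2.2 fun h => by
      have := hmem.1.2
      rw [h] at this
      exact hne this
    have h3 := (hE.gap h0 h1 hτ hreg hmem.1.1.1 hlt1 ht1.2 fun x hx => by
      refine lt_of_le_of_ne (hE.uP_le (hmem.1.1.1.trans hx.1.le)) fun h => ?_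
      exact (le_csSup hSc'.bddAbove ⟨⟨⟨hmem.1.1.1.trans hx.1.le, hx.2.le.trans ht1.2⟩, h⟩,
        hmem.2.1.trans hx.1.le, hx.2.le⟩).not_gt hx.1).2
    rw [hmem.1.2] at h3
    exact hlt.not_gt h3
  have hFAl : E.FA.cdf l = 0 := by
    have h3 := (hE.gap h0 h1 hτ hreg le_rfl hl0 hlS.1.2 fun x hx => hltV x hx.1.le hx.2).1
    rw [E.FA.cdf_eq]
    refine E.FA.law_real_eq_zero measurableSet_Icc (fun x hx => hx.1) ?_
      fun t _ => hreg.atom_eq_zero t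
    filter_upwards [h3, compl_mem_ae_iff.2 (measure_singleton (0 : ℝ)),
      compl_mem_ae_iff.2 (measure_singleton l)] with t h4 h5 h6 h7
    exact h4 ⟨lt_of_le_of_ne h7.1 (Ne.symm h5), lt_of_le_of_ne h7.2 h6⟩
  have hFA0 : ∀ t ∈ Icc 0 l, E.FA.cdf t = 0 := fun t ht =>
    le_antisymm (hFAl ▸ E.FA.cdf_mono ht.2) (E.FA.cdf_nonneg t)
  have hθμ : 0 < M.θ - M.μ := by linarith [M.μ_lt_θ]
  have hμβ : 0 < M.μ - M.β := by linarith [M.β_lt_μ]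
  -- Constancy of the payoff is a linear equation for `disc * rem` with rate `rateN / (θ - μ)`;
  -- removing the decay rate `ρ + haz` of `disc` leaves `fakeRate`.
  have hX : ∀ t ∈ Icc l τ, 1 - σ * E.FA.cdf t = Real.exp (-∫ s in l..t, M.fakeRate s) := by
    intro t ht
    refine eq_exp_of_integral_equation (M := M) (q := rem σ E.FA)
      (n := fun s => M.rateN s / (M.θ - M.μ)) ht.1 (M.rateN_continuous.div_const _)
      (fun s => ?_) (rem_antitone h0 E.FA).intervalIntegrable (by simp [rem, hFAl]) fun x hx => ?_
    · rw [fakeRate, rateN, rateP]; field_simp; ring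
    · have hx0 := hl0.le.trans hx.1
      have e1 := hu hx0
      have e2 := hu hl0.le
      rw [hcond x ⟨hx.1, hx.2.trans ht.2⟩] at e1
      rw [hlS.2] at e2
      have hii : ∀ a b : ℝ, IntervalIntegrable
          (fun s => M.rateN s * (M.disc s * rem σ E.FA s)) volume a b := fun a b =>
        ((rem_antitone h0 E.FA).intervalIntegrable.continuousOn_mul
          M.disc_continuous.continuousOn).continuousOn_mul M.rateN_continuous.continuousOn
      have e3 := intervalIntegral.integral_add_adjacent_intervals (hii 0 l) (hii l x)
      have e4 : (∫ s in l..x, M.rateN s / (M.θ - M.μ) * (M.disc s * rem σ E.FA s))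
          = (∫ s in l..x, M.rateN s * (M.disc s * rem σ E.FA s)) / (M.θ - M.μ) := by
        rw [← intervalIntegral.integral_div]
        exact intervalIntegral.integral_congr fun s _ => by ring
      rw [e4, eq_sub_iff_add_eq, ← mul_left_inj' hθμ.ne', add_mul, div_mul_cancel₀ _ hθμ.ne']
      linarith
  have hστ : 1 - σ = Real.exp (-∫ s in l..τ, M.fakeRate s) := by
    rw [← hX τ ⟨hlS.1.2, le_rfl⟩, hreg.fake_eq_one, mul_one]
  have hlτ : l < τ := by
    refine lt_of_le_of_ne hlS.1.2 fun h => ?_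
    rw [h, intervalIntegral.integral_same, neg_zero, Real.exp_zero] at hστ
    linarith
  have hFP : ∀ t, 0 ≤ t → t < l → E.FP.cdf t = 0 := by
    intro t ht htl
    rw [E.FP.cdf_eq]
    exact hE.stopping_null h0 h1 measurableSet_Icc (fun x hx => hx.1)
      fun x hx => (hltV x hx.1 (hx.2.trans_lt htl)).ne
  -- `fakeRate > 0` puts faking mass immediately to the right of `s`. So optimal acted-on fakes
  -- accumulate at `s` from the right, and right continuity gives the value at `s` itself.
  have hRV : ∀ s ∈ Ico l τ, M.riskyA E.a E.FP s = M.payoffA E := by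
    intro s hs
    have hs0 := hl0.le.trans hs.1
    have hfreq : ∃ᶠ x in 𝓝[>] s, M.riskyA E.a E.FP x = M.payoffA E := by
      intro hev
      obtain ⟨u, hu', huI⟩ := (mem_nhdsGT_iff_exists_Ioo_subset' hs.2).1 hev
      obtain ⟨t, hst, htu⟩ := exists_between (lt_min hu' hs.2)
      have htτ := htu.le.trans (min_le_right _ _)
      have h3 : E.FA.law.real (Ioc s t) = 0 := by
        refine E.FA.law_real_eq_zero measurableSet_Ioc (fun x hx => hs0.trans hx.1.le) ?_
          fun x _ => hreg.atom_eq_zero x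
        filter_upwards [hE.ae_riskyA_eq hreg] with x h4 hx
        by_contra h5
        exact huI ⟨hx.1, hx.2.trans_lt (htu.trans_le (min_le_left _ _))⟩
          (h4 (hs0.trans hx.1.le) h5)
      rw [← E.FA.cdf_sub hs0 hst.le] at h3
      have e1 := hX s ⟨hs.1, hs.2.le⟩
      have e2 := hX t ⟨hs.1.trans hst.le, htτ⟩
      rw [show E.FA.cdf t = E.FA.cdf s by linarith, e1, Real.exp_eq_exp, neg_inj,
        ← intervalIntegral.integral_add_adjacent_intervals
          (fakeRate_continuous.intervalIntegrable l s (μ := volume))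
          (fakeRate_continuous.intervalIntegrable s t)] at e2
      linarith [hτ.integral_fakeRate_pos hs0 hst htτ]
    exact isClosed_singleton.mem_of_frequently_of_tendsto (b := 𝓝[>] s)
      (s := {M.payoffA E}) (by simpa using hfreq)
      (riskyA_rightCont hm ha E.FP hs0)
  -- With an atom of stopping at `l`, acted-on fakes just before `l` would be worth more than at
  -- `l`, hence more than the faker's payoff.
  have hPl : E.FP.cdf l = 0 := by
    have e1 := hRV l ⟨le_rfl, hlτ⟩
    have hbc : ContinuousWithinAt (M.baseA E.a E.FP) (Iio l) l :=
      ((baseA_continuousOn hm ha E.FP).continuousAt (Ici_mem_nhds hl0)).continuousWithinAt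
    have ht : Tendsto (fun t => M.baseA E.a E.FP t + M.disc t * (M.μ - M.β)) (𝓝[<] l)
        (𝓝 (M.baseA E.a E.FP l + M.disc l * (M.μ - M.β))) :=
      hbc.add ((M.disc_continuous.continuousAt.mono_left nhdsWithin_le_nhds).mul
        tendsto_const_nhds)
    have e2 : M.baseA E.a E.FP l + M.disc l * (M.μ - M.β) ≤ M.payoffA E := by
      refine le_of_tendsto ht ?_
      filter_upwards [Ioo_mem_nhdsLT hl0] with t ht
      have h3 := hreg.riskyA_le t ht.1.le (ht.2.trans hlτ)
      rw [riskyA, hFP t ht.1.le ht.2] at h3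
      linarith
    rw [← e1, riskyA] at e2
    have h3 : M.disc l * (M.μ - M.β) * E.FP.cdf l ≤ 0 := by linarith
    have h4 := mul_pos (M.disc_pos l) hμβ
    have h5 := E.FP.cdf_nonneg l
    nlinarith
  have hP : ∀ t ∈ Ico l τ, 1 - E.FP.cdf t = Real.exp (-∫ s in l..t, M.stopRate s) := by
    intro t ht
    have hq : ∀ a b : ℝ, IntervalIntegrable (fun s => 1 - E.FP.cdf s) volume a b := fun a b =>
      intervalIntegrable_const.sub E.FP.cdf_mono.intervalIntegrable
    refine eq_exp_of_integral_equation (M := M) (q := fun s => 1 - E.FP.cdf s)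
      (n := fun s => (M.μ * (1 - M.β) * M.haz s - M.ρ * M.β) / (M.μ - M.β)) ht.1
      (((continuous_const.mul M.haz_continuous).sub continuous_const).div_const _)
      (fun s => ?_) (hq l t) (by simp [hPl]) fun x hx => ?_
    · rw [stopRate, rateA]; field_simp; ring
    · have hx0 := hl0.le.trans hx.1
      have e1 := hRV x ⟨hx.1, hx.2.trans_lt ht.2⟩
      have e2 := hRV l ⟨le_rfl, hlτ⟩
      have e3 := primitive_sub hi hl0.le hx0
      have e4 : (∫ s in l..x, M.flowA E.a E.FP s) = (M.μ - M.β) * ∫ s in l..x,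
          (M.μ * (1 - M.β) * M.haz s - M.ρ * M.β) / (M.μ - M.β)
            * (M.disc s * (1 - E.FP.cdf s)) := by
        rw [← intervalIntegral.integral_const_mul]
        refine integral_congr_ae_Ioo hx.1 ?_
        filter_upwards [hreg.act] with s hs hsI
        rw [flowA, hs (hl0.le.trans hsI.1.le)]
        field_simp
      rw [riskyA, baseA] at e1 e2
      have e5 : (M.μ - M.β) * (M.disc x * (1 - E.FP.cdf x)) = (M.μ - M.β) *
          (M.disc l * (1 - E.FP.cdf l) - ∫ s in l..x,
          (M.μ * (1 - M.β) * M.haz s - M.ρ * M.β) / (M.μ - M.β)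
            * (M.disc s * (1 - E.FP.cdf s))) := by
        linear_combination e1 - e2 - e3 - e4
      exact mul_left_cancel₀ hμβ.ne' e5
  refine ⟨l, hl0, hlτ, hστ, hFA0, hX, fun t ht => ?_, fun t ht => ?_, hP, fun t ht => ?_,
    hreg.act, ?_⟩
  · exact le_antisymm (E.FA.cdf_le_one t) (hreg.fake_eq_one ▸ E.FA.cdf_mono ht)
  · exact le_antisymm (hPl ▸ E.FP.cdf_mono ht.2) (E.FP.cdf_nonneg t)
  · exact le_antisymm (E.FP.cdf_le_one t) (hreg.stop_eq_one ▸ E.FP.cdf_mono ht)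
  · rw [hV, ← hreg.uP_eq, hu hτ.pos.le, rem, hreg.fake_eq_one, mul_one]

end

end IsEquilibrium

end SearchModel

/-! ### Mixed times with a prescribed rate -/

namespace MixedTime

lemma exp_neg_primitive_hasDerivAt {k : ℝ → ℝ} (hk : Continuous k) (l t : ℝ) :
    HasDerivAt (fun t => Real.exp (-∫ s in l..t, k s))
      (-(k t * Real.exp (-∫ s in l..t, k s))) t := by
  have := (intervalIntegral.integral_hasDerivAt_right (hk.intervalIntegrable l t)
      hk.stronglyMeasurable.stronglyMeasurableAtFilter hk.continuousAt).neg.exp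
  exact this.congr_deriv (by simp only [Pi.neg_apply]; ring)

lemma exp_neg_primitive_continuous {k : ℝ → ℝ} (hk : Continuous k) (l : ℝ) :
    Continuous fun t => Real.exp (-∫ s in l..t, k s) :=
  continuous_iff_continuousAt.2 fun t => (exp_neg_primitive_hasDerivAt hk l t).continuousAt

lemma integral_rate_mul_exp {k : ℝ → ℝ} (hk : Continuous k) (l t : ℝ) :
    ∫ s in l..t, k s * Real.exp (-∫ x in l..s, k x) = 1 - Real.exp (-∫ s in l..t, k s) := by
  have := intervalIntegral.integral_eq_sub_of_hasDerivAt (a := l) (b := t)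
    (fun s _ => exp_neg_primitive_hasDerivAt hk l s)
    ((hk.mul (exp_neg_primitive_continuous hk l)).neg.intervalIntegrable _ _)
  rw [intervalIntegral.integral_neg, intervalIntegral.integral_same, neg_zero, Real.exp_zero]
    at this
  linarith

/-- The density on `[l, r]` of a time with rate `k`, scaled by `c`. -/
def rateDens (k : ℝ → ℝ) (l r c : ℝ) : ℝ → ℝ :=
  (Icc l r).indicator fun t => c * (k t * Real.exp (-∫ s in l..t, k s))

lemma setIntegral_rateDens {k : ℝ → ℝ} (hk : Continuous k) {l r c : ℝ} {B : Set ℝ} {t : ℝ}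
    (hlt : l ≤ t) (hB : B ∩ Icc l r = Icc l t) :
    ∫ s in B, rateDens k l r c s = c * (1 - Real.exp (-∫ s in l..t, k s)) := by
  rw [rateDens, setIntegral_indicator measurableSet_Icc, hB, integral_const_mul,
    integral_Icc_eq_integral_Ioc, ← intervalIntegral.integral_of_le hlt,
    integral_rate_mul_exp hk]

/-- A mixed time with rate `k` on `[l, r]`, scaled by `c`, and an atom of size `m` at `r`. -/
def ofRate (k : ℝ → ℝ) (hk : Continuous k) (l r c m : ℝ) (hl : 0 ≤ l) (hlr : l ≤ r)
    (hc : 0 ≤ c) (hm : 0 ≤ m) (hpos : ∀ t ∈ Icc l r, 0 ≤ k t)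
    (htot : c * (1 - Real.exp (-∫ s in l..r, k s)) + m ≤ 1) : MixedTime where
  dens := rateDens k l r c
  atom := Pi.single r m
  dens_nonneg t := indicator_nonneg
    (fun t ht => mul_nonneg hc (mul_nonneg (hpos t ht) (Real.exp_pos _).le)) t
  dens_integrable := by
    refine ((integrable_indicator_iff measurableSet_Icc).2 ?_).integrableOn
    exact (continuous_const.mul (hk.mul (exp_neg_primitive_continuous hk l))).integrableOn_Icc
  atom_nonneg s := by
    by_cases h : s = r
    · simp [h, hm]
    · simp [h]
  atom_of_neg s hs := by simp [(hs.trans_le (hl.trans hlr)).ne]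
  atom_summable := (hasSum_pi_single r m).summable
  total_le_one := by
    rw [setIntegral_rateDens hk hlr
      (inter_eq_right.2 fun x hx => hl.trans hx.1 : Ici 0 ∩ Icc l r = Icc l r), tsum_pi_single]
    exact htot

section ofRate

variable {k : ℝ → ℝ} {hk : Continuous k} {l r c m : ℝ} {hl : 0 ≤ l} {hlr : l ≤ r}
  {hc : 0 ≤ c} {hm : 0 ≤ m} {hpos : ∀ t ∈ Icc l r, 0 ≤ k t}
  {htot : c * (1 - Real.exp (-∫ s in l..r, k s)) + m ≤ 1}

lemma ofRate_atInfty : (ofRate k hk l r c m hl hlr hc hm hpos htot).atInfty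
    = 1 - (c * (1 - Real.exp (-∫ s in l..r, k s)) + m) := by
  rw [atInfty, ofRate, setIntegral_rateDens hk hlr
      (inter_eq_right.2 fun x hx => hl.trans hx.1 : Ici 0 ∩ Icc l r = Icc l r), tsum_pi_single]

lemma tsum_indicator_single (B : Set ℝ) :
    ∑' s, B.indicator (Pi.single r m) s = B.indicator (fun _ => m) r := by
  rw [tsum_eq_single r]
  · by_cases h : r ∈ B <;> simp [h]
  · intro s hs
    by_cases h : s ∈ B <;> simp [h, hs]

lemma ofRate_cdf_of_lt {t : ℝ} (hlt : l ≤ t) (htr : t < r) :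
    (ofRate k hk l r c m hl hlr hc hm hpos htot).cdf t
      = c * (1 - Real.exp (-∫ s in l..t, k s)) := by
  have hB : Icc 0 t ∩ Icc l r = Icc l t := by
    rw [Icc_inter_Icc, sup_eq_right.2 hl, inf_eq_left.2 htr.le]
  rw [cdf, ofRate, setIntegral_rateDens hk hlt hB, tsum_indicator_single,
    indicator_of_notMem (fun h => htr.not_ge h.2), add_zero]

lemma ofRate_cdf_of_ge {t : ℝ} (hrt : r ≤ t) :
    (ofRate k hk l r c m hl hlr hc hm hpos htot).cdf t
      = c * (1 - Real.exp (-∫ s in l..r, k s)) + m := by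
  have hB : Icc 0 t ∩ Icc l r = Icc l r := by
    rw [Icc_inter_Icc, sup_eq_right.2 hl, inf_eq_right.2 hrt]
  rw [cdf, ofRate, setIntegral_rateDens hk hlr hB, tsum_indicator_single,
    indicator_of_mem (show r ∈ Icc 0 t from ⟨hl.trans hlr, hrt⟩)]

lemma ofRate_cdf_of_le (h : l < r) {t : ℝ} (htl : t ≤ l) :
    (ofRate k hk l r c m hl hlr hc hm hpos htot).cdf t = 0 := by
  refine le_antisymm ((cdf_mono _ htl).trans ?_) (cdf_nonneg _ t)
  rw [ofRate_cdf_of_lt le_rfl h]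
  simp

end ofRate

lemma pure_zero_cdf {t : ℝ} (ht : 0 ≤ t) : (pure 0 le_rfl).cdf t = 1 := by
  rw [cdf, pure, tsum_indicator_single, indicator_of_mem (show (0 : ℝ) ∈ Icc 0 t from ⟨le_rfl, ht⟩)]
  simp

end MixedTime

/-! ### Construction of equilibria -/

namespace SearchModel

variable {M : SearchModel}

/-- A faking strategy that starts at `l`, keeps the principal indifferent until `τ`, and is then
exhausted or without further faking. -/
structure IsFaking (M : SearchModel) (σ l τ : ℝ) (FA : MixedTime) : Prop where
  atom_eq_zero : ∀ t, FA.atom t = 0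
  dens_eq_zero : ∀ t, t ∉ Icc l τ → FA.dens t = 0
  dens_eq : ∀ t ∈ Icc l τ, σ * FA.dens t = M.fakeRate t * Real.exp (-∫ s in l..t, M.fakeRate s)
  rem_before : ∀ t, t ≤ l → rem σ FA t = 1
  rem_eq : ∀ t ∈ Icc l τ, rem σ FA t = Real.exp (-∫ s in l..t, M.fakeRate s)

/-- The rate uses a fraction `σ⁻¹ (1 - exp ...)` of the faker's probability, which `h` keeps at most
one; the rest goes to `∞` and vanishes when `h` is an equality. -/
lemma exists_isFaking {σ l τ : ℝ} (h0 : 0 < σ) (hτ : M.IsThreshold τ) (hl : 0 ≤ l) (hlτ : l < τ)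
    (h : 1 - σ ≤ Real.exp (-∫ s in l..τ, M.fakeRate s)) :
    ∃ FA, IsFaking M σ l τ FA ∧
      FA.atInfty = 1 - σ⁻¹ * (1 - Real.exp (-∫ s in l..τ, M.fakeRate s)) := by
  have hpos : ∀ t ∈ Icc l τ, 0 ≤ M.fakeRate t := fun t ht =>
    div_nonneg (hτ.rateP_nonneg (hl.trans ht.1) ht.2) (by linarith [M.μ_lt_θ])
  have htot : σ⁻¹ * (1 - Real.exp (-∫ s in l..τ, M.fakeRate s)) + 0 ≤ 1 := by
    rw [add_zero, inv_mul_le_iff₀ h0]; linarith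
  refine ⟨MixedTime.ofRate M.fakeRate fakeRate_continuous l τ σ⁻¹ 0 hl hlτ.le
    (inv_nonneg.2 h0.le) le_rfl hpos htot, ⟨fun t => ?_, fun t ht => ?_, fun t ht => ?_,
    fun t ht => ?_, fun t ht => ?_⟩, ?_⟩
  · simp [MixedTime.ofRate]
  · simp [MixedTime.ofRate, MixedTime.rateDens, ht]
  · simp only [MixedTime.ofRate, MixedTime.rateDens, indicator_of_mem ht]
    rw [← mul_assoc,
      mul_inv_cancel₀ h0.ne', one_mul]
  · rw [rem, MixedTime.ofRate_cdf_of_le hlτ ht]; simp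
  · have : (MixedTime.ofRate M.fakeRate fakeRate_continuous l τ σ⁻¹ 0 hl hlτ.le
        (inv_nonneg.2 h0.le) le_rfl hpos htot).cdf t
        = σ⁻¹ * (1 - Real.exp (-∫ s in l..t, M.fakeRate s)) := by
      rcases ht.2.lt_or_eq with h' | h'
      · exact MixedTime.ofRate_cdf_of_lt ht.1 h'
      · rw [h', MixedTime.ofRate_cdf_of_ge le_rfl, add_zero]
    rw [rem, this, ← mul_assoc, mul_inv_cancel₀ h0.ne']
    ring
  · rw [MixedTime.ofRate_atInfty, add_zero]

namespace IsFaking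

variable {σ l τ : ℝ} {FA : MixedTime} (hF : IsFaking M σ l τ FA) (h0 : 0 < σ) (h1 : σ < 1)
  (hτ : M.IsThreshold τ) (hl : 0 ≤ l) (hlτ : l < τ)
include hF h0 h1

/-- `fakeRate` must leave the principal a reward for the delay: the loss from fakes falls short of
the benefit of real news by `ρ θ` times `rem`, so the posterior stays strictly above `θ`. -/
lemma optimalResponse : M.OptimalResponse σ (fun _ => 1) FA := by
  intro t ht
  have hθ : M.θ < M.belief σ FA t := by
    rw [M.theta_lt_belief_iff h0 h1 ht (hF.atom_eq_zero t)]
    by_cases h : t ∈ Icc l τ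
    · rw [hF.dens_eq t h, hF.rem_eq t h, fakeRate, rateP]
      have h3 : M.θ - M.μ ≠ 0 := by linarith [M.μ_lt_θ]
      have h4 := mul_pos (mul_pos M.ρ_pos M.θ_pos)
        (Real.exp_pos (-∫ s in l..t, M.fakeRate s))
      rw [← mul_assoc, mul_div_cancel₀ _ h3]
      linarith
    · rw [hF.dens_eq_zero t h, mul_zero, mul_zero]
      exact mul_pos (mul_pos (mul_pos M.μ_pos (by linarith [M.θ_lt_one])) (M.haz_pos ht))
        (rem_pos h0 h1 FA t)
  exact ⟨fun _ => rfl, fun h => (hθ.not_gt h).elim⟩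

lemma flowP_eq {t : ℝ} (ht : 0 ≤ t) : M.flowP σ FA t
    = M.disc t * (rem σ FA t * M.rateP t) - (M.θ - M.μ) * σ * (M.disc t * FA.dens t) :=
  flowP_of_response_pos h0 h1 (hF.optimalResponse h0 h1) ht (hF.atom_eq_zero t) one_pos

lemma flowP_eq_zero {t : ℝ} (ht : 0 ≤ t) (h : t ∈ Icc l τ) : M.flowP σ FA t = 0 := by
  have h3 : M.θ - M.μ ≠ 0 := by linarith [M.μ_lt_θ]
  have h4 := hF.dens_eq t h
  rw [fakeRate, div_mul_eq_mul_div, eq_div_iff h3] at h4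
  rw [hF.flowP_eq h0 h1 ht, hF.rem_eq t h]
  linear_combination (-M.disc t) * h4

include hl

lemma uP_eq_of_mem {t : ℝ} (h : t ∈ Icc l τ) :
    M.uP σ (fun _ => 1) FA t = M.uP σ (fun _ => 1) FA l := by
  have h3 := uP_sub h0 h1 (hF.optimalResponse h0 h1) hl (hl.trans h.1)
  rw [intervalIntegral.integral_congr (g := fun _ => 0) fun s hs => ?_] at h3
  · simp only [intervalIntegral.integral_zero] at h3
    linarith
  · rw [uIcc_of_le h.1] at hs
    exact hF.flowP_eq_zero h0 h1 (hl.trans hs.1) ⟨hs.1, hs.2.trans h.2⟩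

include hτ hlτ

lemma uP_lt {t : ℝ} (ht : 0 ≤ t) (htl : t < l) :
    M.uP σ (fun _ => 1) FA t < M.uP σ (fun _ => 1) FA l := by
  have h3 := integral_pos_of_ae_pos htl
    (intervalIntegrable_of_Ici (M.integrableOn_flowP h0 h1 FA) ht hl)
    (Eventually.of_forall fun s hs => by
      have hs0 := ht.trans hs.1.le
      rw [hF.flowP_eq h0 h1 hs0, hF.dens_eq_zero s fun h => hs.2.not_ge h.1, mul_zero, mul_zero,
        sub_zero]
      exact mul_pos (M.disc_pos s) (mul_pos (rem_pos h0 h1 FA s)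
        (hτ.rateP_pos hs0 (hs.2.trans hlτ))))
  rw [← uP_sub h0 h1 (hF.optimalResponse h0 h1) ht hl] at h3
  linarith

/-- The payoff of stopping rises up to `l`, is flat until `τ` and falls afterwards. -/
lemma uP_le {t : ℝ} (ht : 0 ≤ t) :
    M.uP σ (fun _ => 1) FA t ≤ M.uP σ (fun _ => 1) FA l := by
  rcases lt_or_ge t l with h | h
  · exact (hF.uP_lt h0 h1 hτ hl hlτ ht h).le
  rcases le_or_gt t τ with h' | h'
  · exact (hF.uP_eq_of_mem h0 h1 hl ⟨h, h'⟩).le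
  · exact (uP_strictAnti h0 h1 (hF.optimalResponse h0 h1) hτ le_rfl h').le.trans
      (hF.uP_eq_of_mem h0 h1 hl ⟨hlτ.le, le_rfl⟩).le

lemma uPInf_le : M.uPInf σ (fun _ => 1) FA ≤ M.uP σ (fun _ => 1) FA l :=
  (uPInf_lt h0 h1 (hF.optimalResponse h0 h1) hτ).le.trans
    (hF.uP_le h0 h1 hτ hl hlτ hτ.pos.le)

omit hτ hlτ hl in
lemma uP_zero : M.uP σ (fun _ => 1) FA 0 = M.θ := by
  rw [M.uP_eq h0 h1 (hF.optimalResponse h0 h1) le_rfl]; simp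

lemma expect_uP_le (F : MixedTime) :
    F.expect (M.uP σ (fun _ => 1) FA) (M.uPInf σ (fun _ => 1) FA)
      ≤ M.uP σ (fun _ => 1) FA l := by
  refine F.expect_le (fun t ht => hF.uP_le h0 h1 hτ hl hlτ ht) (hF.uPInf_le h0 h1 hτ hl hlτ) ?_
  have := hF.uP_le h0 h1 hτ hl hlτ le_rfl
  rw [hF.uP_zero h0 h1] at this
  exact M.θ_pos.le.trans this

/-- If the search is not beneficial, there is an equilibrium with immediate stopping. -/
lemma isEquilibrium_pure_zero (hl0 : l = 0) :
    M.IsEquilibrium σ ⟨fun _ => 1, MixedTime.pure 0 le_rfl, FA⟩ := by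
  have hm : Measurable fun _ : ℝ => (1 : ℝ) := measurable_const
  have ha : ∀ t : ℝ, (1 : ℝ) ∈ Icc (0 : ℝ) 1 := fun _ => ⟨zero_le_one, le_rfl⟩
  -- The principal is gone at `0`, and ties go to her, so every faking time is worth `β`.
  have hu : ∀ t, 0 ≤ t → M.uA (fun _ => 1) (MixedTime.pure 0 le_rfl) t = M.β := by
    intro t ht
    rw [M.uA_eq hm ha _ ht, MixedTime.pure_zero_cdf ht, baseA,
      intervalIntegral.integral_congr (g := fun _ => 0) fun s hs => ?_]
    · simp
    · rw [uIcc_of_le ht] at hs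
      simp [flowA, MixedTime.pure_zero_cdf hs.1]
  have hInf : M.uAInf (fun _ => 1) (MixedTime.pure 0 le_rfl) = M.β := by
    refine tendsto_nhds_unique (M.tendsto_uA hm ha _) (tendsto_const_nhds.congr' ?_)
    filter_upwards [eventually_ge_atTop 0] with t ht
    exact (hu t ht).symm
  refine ⟨hm, ha, fun F => ?_, hF.optimalResponse h0 h1, fun F => ?_⟩
  · rw [FA.expect_eq (V := M.β) (Eventually.of_forall fun t ht _ => hu t ht)
      (fun t ht => hu t (FA.nonneg_of_atom_ne ht)) fun _ => hInf]
    exact F.expect_le (fun t ht => (hu t ht).le) hInf.le M.β_pos.le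
  · rw [payoffP, MixedTime.pure_expect]
    refine (hF.expect_uP_le h0 h1 hτ hl hlτ F).trans ?_
    rw [hl0]

/-- The equilibrium in which both sides mix between `l` and `τ`. -/
lemma exists_isEquilibrium (hinf : FA.atInfty = 0) :
    ∃ E, M.IsEquilibrium σ E ∧ M.payoffP σ E = M.uP σ (fun _ => 1) FA l := by
  have hspos : ∀ t ∈ Icc l τ, 0 ≤ M.stopRate t := fun t ht =>
    (hτ.stopRate_pos (hl.trans ht.1) ht.2).le
  set q : ℝ → ℝ := fun t => Real.exp (-∫ s in l..t, M.stopRate s) with hq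
  have htot : 1 * (1 - Real.exp (-∫ s in l..τ, M.stopRate s)) + q τ ≤ 1 := by simp [hq]
  -- The probability that the rate leaves over is an atom at `τ`.
  set FP : MixedTime := MixedTime.ofRate M.stopRate stopRate_continuous l τ 1 (q τ) hl hlτ.le
    zero_le_one (Real.exp_pos _).le hspos htot with hFP
  have hP1 : ∀ t, t ≤ l → FP.cdf t = 0 := fun t ht => MixedTime.ofRate_cdf_of_le hlτ ht
  have hP2 : ∀ t, l ≤ t → t < τ → FP.cdf t = 1 - q t := fun t ht htτ => by
    rw [hFP, MixedTime.ofRate_cdf_of_lt ht htτ, one_mul]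
  have hP3 : ∀ t, τ ≤ t → FP.cdf t = 1 := fun t ht => by
    rw [hFP, MixedTime.ofRate_cdf_of_ge ht]; simp [hq]
  have hm : Measurable fun _ : ℝ => (1 : ℝ) := measurable_const
  have ha : ∀ t : ℝ, (1 : ℝ) ∈ Icc (0 : ℝ) 1 := fun _ => ⟨zero_le_one, le_rfl⟩
  set a : ℝ → ℝ := fun _ => 1 with hadef
  have hi := M.integrableOn_flowA hm ha FP
  have hμβ : 0 < M.μ - M.β := by linarith [M.β_lt_μ]
  set V := M.riskyA a FP l with hV
  have huA : ∀ t, 0 ≤ t → M.uA a FP t = M.riskyA a FP t := fun t ht => by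
    rw [M.uA_eq hm ha FP ht, riskyA, mul_one]
  -- Stated with `q` in place of `1 - F_P`, the indifference extends to `τ`, where `F_P` jumps; it
  -- then shows that faking at or after `τ` is worse.
  have hbase : ∀ t ∈ Icc l τ, M.baseA a FP t + M.disc t * q t * (M.μ - M.β) = V := by
    intro t ht
    have hd : ∀ s, HasDerivAt (fun s => M.disc s * q s)
        (-((M.ρ + M.haz s) * M.disc s) * q s + M.disc s * (-(M.stopRate s * q s))) s := fun s =>
      (M.disc_hasDerivAt s).mul (MixedTime.exp_neg_primitive_hasDerivAt stopRate_continuous l s)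
    have hqc : Continuous q := MixedTime.exp_neg_primitive_continuous stopRate_continuous l
    have hc : Continuous fun s =>
        -((M.ρ + M.haz s) * M.disc s) * q s + M.disc s * (-(M.stopRate s * q s)) := by
      have := M.haz_continuous
      have := M.disc_continuous
      have := stopRate_continuous (M := M)
      fun_prop
    have e1 := intervalIntegral.integral_eq_sub_of_hasDerivAt (a := l) (b := t)
      (fun s _ => hd s) (hc.intervalIntegrable _ _)
    have e2 : (∫ s in l..t, M.flowA a FP s) = -(M.μ - M.β) * ∫ s in l..t,
        (-((M.ρ + M.haz s) * M.disc s) * q s + M.disc s * (-(M.stopRate s * q s))) := by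
      rw [← intervalIntegral.integral_const_mul]
      refine integral_congr_ae_Ioo ht.1 (Eventually.of_forall fun s hs => ?_)
      rw [flowA, hP2 s hs.1.le (hs.2.trans_le ht.2), stopRate, rateA]
      simp only [hadef]
      field_simp
      ring
    have e3 := primitive_sub hi hl (hl.trans ht.1)
    have e4 : q l = 1 := by simp [hq]
    rw [hV, riskyA, hP1 l le_rfl, baseA, baseA]
    rw [e1, e4] at e2
    linear_combination e3 + e2
  have hlate : ∀ t, τ ≤ t → M.uA a FP t = M.baseA a FP τ := by
    intro t ht
    have ht0 := hτ.pos.le.trans ht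
    rw [M.uA_eq hm ha FP ht0, hP3 t ht]
    have : (∫ s in τ..t, M.flowA a FP s) = 0 := by
      rw [intervalIntegral.integral_congr (g := fun _ => 0)]
      · simp
      · intro s hs
        rw [uIcc_of_le ht] at hs
        simp [flowA, hP3 s hs.1]
    rw [← primitive_sub hi hτ.pos.le ht0] at this
    unfold baseA
    linarith
  have hmid : ∀ t, l ≤ t → t < τ → M.uA a FP t = V := by
    intro t ht htτ
    rw [huA t (hl.trans ht), riskyA, hP2 t ht htτ, ← hbase t ⟨ht, htτ.le⟩]
    ring
  have hτV : M.baseA a FP τ ≤ V := by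
    have h3 := hbase τ ⟨hlτ.le, le_rfl⟩
    have h4 := mul_pos (mul_pos (M.disc_pos τ) (show 0 < q τ from Real.exp_pos _)) hμβ
    linarith
  have hle : ∀ t, 0 ≤ t → M.uA a FP t ≤ V := by
    intro t ht
    rcases lt_or_ge t l with h | h
    · rw [huA t ht]
      refine (riskyA_lt_riskyA hm ha hτ ht h hlτ.le (Eventually.of_forall fun _ _ => rfl)
        (fun x hx => ?_) ?_).le
      · rw [hP1 x hx.2, hP1 t h.le]
      · rw [hP1 t h.le]; exact one_pos
    rcases lt_or_ge t τ with h' | h'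
    · exact (hmid t h h').le
    · rw [hlate t h']; exact hτV
  have hInf : M.uAInf a FP ≤ V := by
    refine le_of_tendsto (M.tendsto_uA hm ha FP) ?_
    filter_upwards [eventually_ge_atTop 0] with t ht
    exact hle t ht
  have hV0 : 0 ≤ V := by
    refine le_trans ?_ (hle 0 le_rfl)
    rw [huA 0 le_rfl, riskyA, hP1 0 hl, baseA, M.disc_zero]
    simp [M.μ_pos.le]
  have hpay : M.payoffP σ ⟨a, FP, FA⟩ = M.uP σ a FA l := by
    refine FP.expect_eq (Eventually.of_forall fun t _ ht => ?_) (fun t ht => ?_) fun h => ?_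
    · refine hF.uP_eq_of_mem h0 h1 hl ?_
      by_contra hn
      exact ht (by simp [hFP, MixedTime.ofRate, MixedTime.rateDens, hn])
    · have : t = τ := by
        by_contra hn
        exact ht (by simp [hFP, MixedTime.ofRate, hn])
      rw [this]
      exact hF.uP_eq_of_mem h0 h1 hl ⟨hlτ.le, le_rfl⟩
    · refine (h ?_).elim
      rw [hFP, MixedTime.ofRate_atInfty]
      simp [hq]
  refine ⟨⟨a, FP, FA⟩, ⟨hm, ha, fun F => ?_, hF.optimalResponse h0 h1, fun F => ?_⟩, hpay⟩
  · have : FA.expect (M.uA a FP) (M.uAInf a FP) = V := by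
      refine FA.expect_eq ?_ (fun t ht => (ht (hF.atom_eq_zero t)).elim)
        fun h => (h hinf).elim
      -- At `τ` the stopping atom comes first and the faker is not indifferent; a single time does
      -- not matter for the density.
      filter_upwards [compl_mem_ae_iff.2 (measure_singleton τ)] with t h3 _ h5
      have h6 : t ∈ Icc l τ := by
        by_contra hn
        exact h5 (hF.dens_eq_zero t hn)
      exact hmid t h6.1 (lt_of_le_of_ne h6.2 h3)
    rw [this]
    exact F.expect_le hle hInf hV0
  · rw [hpay]
    exact hF.expect_uP_le h0 h1 hτ hl hlτ F

end IsFaking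

end SearchModel

namespace SearchModel

variable {M : SearchModel}

/-! ### The first best and naive search -/

lemma integral_news {t : ℝ} (ht : 0 ≤ t) (c : ℝ) :
    (∫ s in (0 : ℝ)..t, Real.exp (-M.ρ * s) * M.g s * c)
      = ∫ s in (0 : ℝ)..t, M.disc s * M.haz s * c := by
  refine intervalIntegral.integral_congr fun s hs => ?_
  rw [uIcc_of_le ht] at hs
  simp only [M.disc_mul_haz hs.1]

/-- The payoff of waiting for real news with expected payoff `c`, followed by a payoff `d`. -/
lemma wait_eq {t : ℝ} (ht : 0 ≤ t) (c d : ℝ) :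
    (∫ s in (0 : ℝ)..t, Real.exp (-M.ρ * s) * M.g s * c)
        + Real.exp (-M.ρ * t) * (1 - M.G t) * d
      = d + ∫ s in (0 : ℝ)..t, M.disc s * (M.haz s * c - (M.ρ + M.haz s) * d) := by
  have hh := M.haz_continuous
  have hd := M.disc_continuous
  have e1 := M.integral_disc 0 t
  rw [M.disc_zero] at e1
  have e2 : (∫ s in (0 : ℝ)..t, M.disc s * (M.haz s * c - (M.ρ + M.haz s) * d))
      = (∫ s in (0 : ℝ)..t, M.disc s * M.haz s * c)
        - d * ∫ s in (0 : ℝ)..t, (M.ρ + M.haz s) * M.disc s := by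
    rw [← intervalIntegral.integral_const_mul, ← intervalIntegral.integral_sub
      (Continuous.intervalIntegrable (by fun_prop) _ _)
      (Continuous.intervalIntegrable (by fun_prop) _ _)]
    exact intervalIntegral.integral_congr fun s _ => by ring
  rw [integral_news ht, ← M.disc_eq ht, e2, e1]
  ring

lemma uFB_eq {t : ℝ} (ht : 0 ≤ t) :
    M.uFB t = M.θ + ∫ s in (0 : ℝ)..t, M.disc s * M.rateP s := by
  rw [uFB, wait_eq ht]
  congr 1
  exact intervalIntegral.integral_congr fun s _ => by simp only [rateP]; ring

lemma naiveA_before {τ t : ℝ} (ht : 0 ≤ t) (htτ : t ≤ τ) :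
    M.naiveA τ t = M.μ + ∫ s in (0 : ℝ)..t, M.disc s * M.rateA s := by
  rw [naiveA, if_pos htτ, wait_eq ht]
  congr 1
  exact intervalIntegral.integral_congr fun s _ => by simp only [rateA]; ring

/-- With `μ` as the terminal payoff the waiting flow is `rateN`. This puts naive search in the form
of `uP_eq_of_response_pos`, so the two differ only in the factor `rem` under the integral. -/
lemma naivePayoff_eq (σ : ℝ) {τ : ℝ} (hτ : 0 ≤ τ) :
    M.naivePayoff σ τ = M.μ + (∫ s in (0 : ℝ)..τ, M.rateN s * M.disc s)
      + M.disc τ * (1 - σ) * (M.θ - M.μ) := by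
  have h := wait_eq (M := M) hτ (M.μ + (1 - M.μ) * M.θ) M.μ
  have h2 : (∫ s in (0 : ℝ)..τ, M.disc s *
      (M.haz s * (M.μ + (1 - M.μ) * M.θ) - (M.ρ + M.haz s) * M.μ))
      = ∫ s in (0 : ℝ)..τ, M.rateN s * M.disc s :=
    intervalIntegral.integral_congr fun s _ => by simp only [rateN]; ring
  rw [h2] at h
  rw [naivePayoff, M.disc_eq hτ]
  linear_combination h

lemma naiveP_eq_naivePayoff (σ τ : ℝ) : M.naiveP σ τ τ = M.naivePayoff σ τ := by
  rw [naiveP, if_pos le_rfl, uFB, naivePayoff]; ring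

namespace IsThreshold

variable {τ : ℝ} (hτ : M.IsThreshold τ)
include hτ

lemma uFB_lt {t : ℝ} (ht : 0 ≤ t) (hne : t ≠ τ) : M.uFB t < M.uFB τ := by
  have hc : Continuous fun s => M.disc s * M.rateP s := M.disc_continuous.mul M.rateP_continuous
  rw [uFB_eq ht, uFB_eq hτ.pos.le]
  have h := intervalIntegral.integral_add_adjacent_intervals
    (hc.intervalIntegrable 0 t (μ := volume)) (hc.intervalIntegrable t τ)
  rcases lt_or_gt_of_ne hne with h' | h'
  · have := integral_pos_of_ae_pos h' (hc.intervalIntegrable _ _) (Eventually.of_forall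
      fun s hs => mul_pos (M.disc_pos s) (hτ.rateP_pos (ht.trans hs.1.le) hs.2))
    linarith
  · have := integral_neg_of_ae_neg h' (hc.intervalIntegrable _ _) (Eventually.of_forall
      fun s hs => mul_neg_of_pos_of_neg (M.disc_pos s) (hτ.rateP_neg hs.1))
    rw [intervalIntegral.integral_symm] at this
    linarith

lemma naiveA_lt {t : ℝ} (ht : 0 ≤ t) (hne : t ≠ τ) : M.naiveA τ t < M.naiveA τ τ := by
  rcases lt_or_gt_of_ne hne with h' | h'
  · have hc : Continuous fun s => M.disc s * M.rateA s := M.disc_continuous.mul M.rateA_continuous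
    rw [naiveA_before ht h'.le, naiveA_before hτ.pos.le le_rfl]
    have h := intervalIntegral.integral_add_adjacent_intervals
      (hc.intervalIntegrable 0 t (μ := volume)) (hc.intervalIntegrable t τ)
    have := integral_pos_of_ae_pos h' (hc.intervalIntegrable _ _) (Eventually.of_forall
      fun s hs => mul_pos (M.disc_pos s) (hτ.rateA_pos (ht.trans hs.1.le) hs.2.le))
    linarith
  · rw [naiveA, naiveA, if_neg h'.not_ge, if_pos le_rfl, ← M.disc_eq hτ.pos.le]
    have := mul_lt_mul_of_pos_left M.β_lt_μ (M.disc_pos τ)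
    linarith

/-- Naive search is better than a search with the same end and an earlier faking time. -/
lemma lt_naivePayoff {σ l : ℝ} (h0 : 0 < σ) {FA : MixedTime} (hlτ : l < τ) (hl : 0 ≤ l)
    (hFA : ∀ t ∈ Ioo l τ, 0 < FA.cdf t) :
    M.μ + (∫ s in (0 : ℝ)..τ, M.rateN s * (M.disc s * rem σ FA s))
      + M.disc τ * (1 - σ) * (M.θ - M.μ) < M.naivePayoff σ τ := by
  have i1 : ∀ a b : ℝ, IntervalIntegrable (fun s => M.rateN s * M.disc s) volume a b :=
    (M.rateN_continuous.mul M.disc_continuous).intervalIntegrable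
  have i2 : ∀ a b : ℝ, IntervalIntegrable
      (fun s => M.rateN s * (M.disc s * rem σ FA s)) volume a b := fun a b =>
    ((rem_antitone h0 FA).intervalIntegrable.continuousOn_mul
      M.disc_continuous.continuousOn).continuousOn_mul M.rateN_continuous.continuousOn
  have key : ∀ s, M.rateN s * M.disc s - M.rateN s * (M.disc s * rem σ FA s)
      = M.rateN s * M.disc s * (σ * FA.cdf s) := fun s => by rw [rem]; ring
  have n1 : 0 ≤ ∫ s in (0 : ℝ)..l,
      (M.rateN s * M.disc s - M.rateN s * (M.disc s * rem σ FA s)) := by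
    refine intervalIntegral.integral_nonneg hl fun s hs => ?_
    rw [key]
    exact mul_nonneg (mul_nonneg (hτ.rateN_pos hs.1 (hs.2.trans hlτ.le)).le (M.disc_pos s).le)
      (mul_nonneg h0.le (FA.cdf_nonneg s))
  have n2 : 0 < ∫ s in l..τ, (M.rateN s * M.disc s - M.rateN s * (M.disc s * rem σ FA s)) := by
    refine integral_pos_of_ae_pos hlτ ((i1 _ _).sub (i2 _ _)) (Eventually.of_forall fun s hs => ?_)
    rw [key]
    exact mul_pos (mul_pos (hτ.rateN_pos (hl.trans hs.1.le) hs.2.le) (M.disc_pos s))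
      (mul_pos h0 (hFA s hs))
  have h3 := intervalIntegral.integral_add_adjacent_intervals
    ((i1 0 l).sub (i2 0 l)) ((i1 l τ).sub (i2 l τ))
  have h4 := intervalIntegral.integral_sub (i1 0 τ) (i2 0 τ)
  rw [naivePayoff_eq σ hτ.pos.le]
  linarith

/-- At the threshold prior, naive search is still better than no search. -/
lemma theta_lt_naivePayoff_sigmaBar : M.θ < M.naivePayoff (M.sigmaBar τ) τ := by
  have h0 := hτ.sigmaBar_pos
  have h1 := hτ.sigmaBar_lt_one
  -- At this prior the faking that keeps the principal indifferent starts at `0` and uses up the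
  -- whole faker type, so searching until `τ` is worth `θ`; naive search improves on it.
  obtain ⟨FA, hF, -⟩ := exists_isFaking h0 hτ le_rfl hτ.pos hτ.one_sub_sigmaBar.le
  have hu := uP_eq_of_response_pos h0 h1 (hF.optimalResponse h0 h1) hF.atom_eq_zero
    (Eventually.of_forall fun _ _ => one_pos) hτ.pos.le
  rw [hF.uP_eq_of_mem h0 h1 le_rfl ⟨hτ.pos.le, le_rfl⟩, hF.uP_zero h0 h1,
    hF.rem_eq τ ⟨hτ.pos.le, le_rfl⟩, ← hτ.one_sub_sigmaBar] at hu
  refine hu.trans_lt (hτ.lt_naivePayoff h0 hτ.pos le_rfl fun t ht => ?_)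
  have h3 := hF.rem_eq t ⟨ht.1.le, ht.2.le⟩
  have h4 : Real.exp (-∫ s in (0 : ℝ)..t, M.fakeRate s) < 1 := by
    rw [Real.exp_lt_one_iff]
    linarith [hτ.integral_fakeRate_pos le_rfl ht.1 ht.2.le]
  rw [rem] at h3
  exact (mul_pos_iff_of_pos_left h0).1 (by linarith)

lemma naivePayoff_sub (σ σ' : ℝ) : M.naivePayoff σ τ - M.naivePayoff σ' τ
    = (σ' - σ) * (M.disc τ * (M.θ - M.μ)) := by
  rw [naivePayoff_eq σ hτ.pos.le, naivePayoff_eq σ' hτ.pos.le]; ring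

/-- Later starts of faking require less faking. -/
lemma integral_fakeRate_lt {l l' : ℝ} (hl : 0 ≤ l) (h : l < l') (h' : l' ≤ τ) :
    (∫ s in l'..τ, M.fakeRate s) < ∫ s in l..τ, M.fakeRate s := by
  have h3 := intervalIntegral.integral_add_adjacent_intervals
    ((fakeRate_continuous (M := M)).intervalIntegrable l l' (μ := volume))
    ((fakeRate_continuous (M := M)).intervalIntegrable l' τ)
  have := hτ.integral_fakeRate_pos hl h h'
  linarith

lemma exists_start {σ : ℝ} (h0 : 0 < σ) (h1 : σ < M.sigmaBar τ) :
    ∃ l, 0 < l ∧ l < τ ∧ 1 - σ = Real.exp (-∫ s in l..τ, M.fakeRate s) := by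
  have hc : Continuous fun l => Real.exp (-∫ s in l..τ, M.fakeRate s) := by
    have : (fun l => Real.exp (-∫ s in l..τ, M.fakeRate s))
        = fun l => Real.exp (∫ s in τ..l, M.fakeRate s) := by
      ext l; rw [intervalIntegral.integral_symm, neg_neg]
    rw [this]
    exact Real.continuous_exp.comp (intervalIntegral.continuous_primitive
      (fun a b => fakeRate_continuous.intervalIntegrable a b) τ)
  obtain ⟨l, hl, hle⟩ := intermediate_value_Ioo hτ.pos.le hc.continuousOn
    (show 1 - σ ∈ _ from ⟨by rw [← hτ.one_sub_sigmaBar]; linarith, by simp [h0]⟩)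
  exact ⟨l, hl.1, hl.2, hle.symm⟩

end IsThreshold

/-! ### Uniqueness and comparison with naive search -/

namespace IsEquilibrium

variable {σ τ : ℝ} {E E' : Profile}

lemma same (hE : M.IsEquilibrium σ E) (hE' : M.IsEquilibrium σ E') (h0 : 0 < σ) (h1 : σ < 1)
    (hτ : M.IsThreshold τ) (hB : M.Beneficial σ E) (hB' : M.Beneficial σ E') : E.Same E' := by
  obtain ⟨l, hl0, hlτ, hσ, a1, a2, a3, p1, p2, p3, act, -⟩ := hE.beneficial_structure h0 h1 hτ hB
  obtain ⟨l', hl0', hlτ', hσ', b1, b2, b3, q1, q2, q3, act', -⟩ :=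
    hE'.beneficial_structure h0 h1 hτ hB'
  -- The start is determined by `σ`, since the integral of `fakeRate` up to `τ` is strictly
  -- decreasing in its lower end.
  have hll : l = l' := by
    rw [hσ, Real.exp_eq_exp, neg_inj] at hσ'
    rcases lt_trichotomy l l' with h | h | h
    · exact absurd hσ' (hτ.integral_fakeRate_lt hl0.le h hlτ'.le).ne'
    · exact h
    · exact absurd hσ' (hτ.integral_fakeRate_lt hl0'.le h hlτ.le).ne
  subst hll
  refine ⟨fun t ht => ?_, fun t ht => ?_, ?_⟩
  · rcases le_or_gt t l with h | h
    · rw [p1 t ⟨ht, h⟩, q1 t ⟨ht, h⟩]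
    rcases lt_or_ge t τ with h' | h'
    · have e1 := p2 t ⟨h.le, h'⟩
      have e2 := q2 t ⟨h.le, h'⟩
      linarith
    · rw [p3 t h', q3 t h']
  · rcases le_or_gt t l with h | h
    · rw [a1 t ⟨ht, h⟩, b1 t ⟨ht, h⟩]
    rcases lt_or_ge t τ with h' | h'
    · have e1 := a2 t ⟨h.le, h'.le⟩
      have e2 := b2 t ⟨h.le, h'.le⟩
      exact mul_left_cancel₀ h0.ne' (by linarith)
    · rw [a3 t h', b3 t h']
  · refine (ae_restrict_iff' measurableSet_Ici).2 ?_
    filter_upwards [act, act'] with t h3 h4 ht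
    rw [h3 ht, h4 ht]

/-- Faking that starts at some `l > 0` uses up less probability than faking from `0`, which uses up
`sigmaBar`. -/
lemma lt_sigmaBar_of_beneficial (hE : M.IsEquilibrium σ E) (h0 : 0 < σ) (h1 : σ < 1)
    (hτ : M.IsThreshold τ) (hB : M.Beneficial σ E) : σ < M.sigmaBar τ := by
  obtain ⟨l, hl0, hlτ, hσ, -⟩ := hE.beneficial_structure h0 h1 hτ hB
  have h3 := hτ.integral_fakeRate_lt le_rfl hl0 hlτ.le
  have h4 : 1 - M.sigmaBar τ < 1 - σ := by
    rw [hσ, hτ.one_sub_sigmaBar, Real.exp_lt_exp]; linarith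
  linarith

lemma payoffP_lt_of_beneficial (hE : M.IsEquilibrium σ E) (h0 : 0 < σ) (h1 : σ < 1)
    (hτ : M.IsThreshold τ) (hB : M.Beneficial σ E) :
    M.payoffP σ E < M.naivePayoff σ τ := by
  obtain ⟨l, hl0, hlτ, hσ, -, a2, -, -, -, -, -, hpay⟩ := hE.beneficial_structure h0 h1 hτ hB
  rw [hpay]
  refine hτ.lt_naivePayoff h0 hlτ hl0.le fun t ht => ?_
  have h3 := a2 t ⟨ht.1.le, ht.2.le⟩
  have h4 : Real.exp (-∫ s in l..t, M.fakeRate s) < 1 := by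
    rw [Real.exp_lt_one_iff]
    linarith [hτ.integral_fakeRate_pos hl0.le ht.1 ht.2.le]
  exact (mul_pos_iff_of_pos_left h0).1 (by linarith)

end IsEquilibrium

end SearchModel

end
theorem proposition4 (M : SearchModel) (hA1 : M.A1) (hA2 : M.A2) :
    ∃ τ : ℝ, 0 < τ ∧
      -- `τ` is the principal's unique optimal search duration in her first best
      (∀ t, 0 ≤ t → t ≠ τ → M.uFB t < M.uFB τ) ∧
      0 < M.sigmaBar τ ∧ M.sigmaBar τ < 1 ∧
      -- with the commitment, the faker's unique best response is to fake at `τ`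
      (∀ t, 0 ≤ t → t ≠ τ → M.naiveA τ t < M.naiveA τ τ) ∧
      (∀ σ, M.naiveP σ τ τ = M.naivePayoff σ τ) ∧
      -- below the threshold
      (∀ σ, 0 < σ → σ < M.sigmaBar τ →
        (∃ E, M.IsEquilibrium σ E ∧ M.Beneficial σ E) ∧
        (∀ E E', M.IsEquilibrium σ E → M.Beneficial σ E →
          M.IsEquilibrium σ E' → M.Beneficial σ E' → E.Same E') ∧
        (∀ E, M.IsEquilibrium σ E → M.payoffP σ E < M.naivePayoff σ τ)) ∧
      -- above the threshold
      (∃ σN, M.sigmaBar τ < σN ∧ σN ≤ 1 ∧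
        ∀ σ, M.sigmaBar τ < σ → σ < σN →
          (∃ E, M.IsEquilibrium σ E) ∧
          (∀ E, M.IsEquilibrium σ E →
            ¬ M.Beneficial σ E ∧ M.payoffP σ E < M.naivePayoff σ τ)) := by
  obtain ⟨τ, hτ⟩ := SearchModel.exists_isThreshold hA1 hA2
  have hs0 := hτ.sigmaBar_pos
  have hs1 := hτ.sigmaBar_lt_one
  have hθ := hτ.theta_lt_naivePayoff_sigmaBar
  have hK : 0 < M.disc τ * (M.θ - M.μ) := mul_pos (M.disc_pos τ) (by linarith [M.μ_lt_θ])
  refine ⟨τ, hτ.pos, fun t ht hne => hτ.uFB_lt ht hne, hs0, hs1,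
    fun t ht hne => hτ.naiveA_lt ht hne, fun σ => SearchModel.naiveP_eq_naivePayoff σ τ,
    fun σ h0 hσ => ?_, ?_⟩
  · have h1 := hσ.trans hs1
    refine ⟨?_, fun E E' hE hB hE' hB' => hE.same hE' h0 h1 hτ hB hB', fun E hE => ?_⟩
    · obtain ⟨l, hl0, hlτ, hl⟩ := hτ.exists_start h0 hσ
      obtain ⟨FA, hF, hinf⟩ := SearchModel.exists_isFaking h0 hτ hl0.le hlτ hl.le
      rw [← hl, sub_sub_cancel, inv_mul_cancel₀ h0.ne', sub_self] at hinf
      obtain ⟨E, hE, hpay⟩ := hF.exists_isEquilibrium h0 h1 hτ hl0.le hlτ hinf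
      refine ⟨E, hE, ?_⟩
      rw [SearchModel.Beneficial, hpay, ← hF.uP_zero h0 h1]
      exact hF.uP_lt h0 h1 hτ hl0.le hlτ le_rfl hl0
    · by_cases hB : M.Beneficial σ E
      · exact hE.payoffP_lt_of_beneficial h0 h1 hτ hB
      -- Search without benefit is worth at most `θ`, less than the naive payoff at `sigmaBar`,
      -- which in turn is less than at the smaller `σ`.
      · have h3 := hτ.naivePayoff_sub σ (M.sigmaBar τ)
        have h4 := mul_pos (sub_pos.2 hσ) hK
        have h5 : M.payoffP σ E ≤ M.θ := not_lt.1 hB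
        linarith
  -- The naive payoff is affine in `σ` with slope `-disc τ (θ - μ)`; the second bound is the prior
  -- at which it has fallen to `θ`.
  · refine ⟨min 1 (M.sigmaBar τ + (M.naivePayoff (M.sigmaBar τ) τ - M.θ)
      / (M.disc τ * (M.θ - M.μ))), lt_min hs1 (by
        have := div_pos (sub_pos.2 hθ) hK
        linarith), min_le_left _ _, fun σ hσ hσN => ?_⟩
    have h0 := hs0.trans hσ
    have h1 := hσN.trans_le (min_le_left _ _)
    refine ⟨?_, fun E hE => ?_⟩
    -- Faking from `0` on uses up only `sigmaBar` of the mass `σ`; the remaining fakers never fake.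
    · obtain ⟨FA, hF, -⟩ := SearchModel.exists_isFaking h0 hτ le_rfl hτ.pos
        (by rw [← hτ.one_sub_sigmaBar]; linarith)
      exact ⟨_, hF.isEquilibrium_pure_zero h0 h1 hτ le_rfl hτ.pos rfl⟩
    · have hB : ¬ M.Beneficial σ E := fun hB =>
        (hE.lt_sigmaBar_of_beneficial h0 h1 hτ hB).not_gt hσ
      refine ⟨hB, ?_⟩
      have h3 := hτ.naivePayoff_sub σ (M.sigmaBar τ)
      have h4 := hσN.trans_le (min_le_right _ _)
      rw [← sub_lt_iff_lt_add', lt_div_iff₀ hK] at h4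
      have h5 : M.payoffP σ E ≤ M.θ := not_lt.1 hB
      linarith
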